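/- **Setting.** Let $c_{crit}>0$ be the unique positive solution of $c\sinh c-\cosh c=0$ and $\sigma_{crit}=\cosh(c_{crit})/c_{crit}$. For $\sigma>\sigma_{crit}$ let $c_{in}$ be the solution of $\sigma=\cosh(c)/c$ with $c>c_{crit}$, and let $u_{in}(z)=\cosh(c_{in}z)/\cosh(c_{in})-1$ be the inner catenoid. Let $q\in(2,\infty)$ and $W^2_{q,D}(-1,1)=\{f\in W^2_q(-1,1): f(\pm1)=0\}$; its elements are identified with their representatives in $C^1([-1,1])$. The small aspect ratio model with parameters $\sigma$ and $\lambda\ge 0$ asks for $u\in W^2_{q,D}(-1,1)$ with $-1<u<1$ on $(-1,1)$ and $$-\sigma\,\partial_z\arctan(\sigma\,\partial_z u)=-\frac1{u+1}+\lambda\,g_{sar}(u),\qquad g_{sar}(u)=\frac{(1+\sigma^2(\partial_z u)^2)^{1/2}}{(u+1)^2\ln^2\!\big(\tfrac{2}{u+1}\big)} .$$ A *curve emanating from the inner catenoid* is an analytic map $[0,\delta_0)\to W^2_{q,D}(-1,1)$, $\lambda\mapsto u^\lambda_{in}$, with some $\delta_0>0$, such that $u^0_{in}=u_{in}$ and $u^\lambda_{in}$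 solves the model with parameter $\lambda$ for each $\lambda\in[0,\delta_0)$. Its derivative at $\lambda=0$ is denoted by $\partial_\lambda u^0_{in}\in W^2_{q,D}(-1,1)$. Call $\sigma_*>\sigma_{crit}$ a *lower threshold* if for all $\sigma\in(\sigma_{crit},\sigma_*)$, all $q\in(2,\infty)$ and all curves emanating from the inner catenoid, $w=\partial_\lambda u^0_{in}$ satisfies $w<0$ on $(-1,1)$, $\partial_z w(-1)<0$ and $\partial_z w(1)>0$. Call $\sigma^*>\sigma_{crit}$ an *upper threshold* if for all $\sigma>\sigma^*$, all $q\in(2,\infty)$ and all curves emanating from the inner catenoid there is $\rho\in(0,1)$ such that $w=\partial_\lambda u^0_{in}$ satisfies $w<0$ on $(-\rho,\rho)$, $w>0$ on $(-1,-\rho)\cup(\rho,1)$, $\partial_z w(-1)>0$, $\partial_z w(-\rho)<0$, $\partial_z w(\rho)>0$ and $\partial_z w(1)<0$. **Theorem.** For all $q\in(2,\infty)$ and $\sigma>\sigma_{crit}$ a curve emanating from the inner catenoid exists. There exist a lower threshold $\sigma_*$ and an upper threshold $\sigma^*$ with $\sigma_*\le\sigma^*$. Moreover, let $\sigma_*$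 be any lower and $\sigma^*$ any upper threshold, let $q\in(2,\infty)$ and $\sigma>\sigma_{crit}$, and let $[\lambda\mapsto u^\lambda_{in}]$, $\lambda\in[0,\delta_0)$, be any curve emanating from the inner catenoid. Then: (i) If $\sigma<\sigma_*$, there is $\delta\in(0,\delta_0]$ such that $$u^{\bar\lambda}_{in}(z)>u^{\lambda}_{in}(z),\qquad 0\le\bar\lambda<\lambda<\delta,\quad z\in(-1,1).$$ (ii) If $\sigma>\sigma^*$, there are $\delta\in(0,\delta_0]$, $r_0\in(0,1)$ and an integer $n\ge1$ with $2/n<\min\{r_0,1-r_0\}$ such that for all $0\le\bar\lambda<\lambda<\delta$ $$u^{\bar\lambda}_{in}(z)>u^{\lambda}_{in}(z)\quad\text{for } z\in[-r_0+\tfrac1n,\,r_0-\tfrac1n],$$ $$u^{\bar\lambda}_{in}(z)<u^{\lambda}_{in}(z)\quad\text{for } z\in(-1,-r_0-\tfrac1n]\cup[r_0+\tfrac1n,1),$$ and $u^\lambda_{in}$ and $u^{\bar\lambda}_{in}$ intersect on $(-1,1)$ in exactly two points $z_1,z_2$, where $z_1\in(-r_0-\frac1n,-r_0+\frac1n)$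 and $z_2\in(r_0-\frac1n,r_0+\frac1n)$. Moreover, for each $\lambda\in[0,\delta)$, $u^\lambda_{in}$ is strictly decreasing on $[-r_0-\frac1n,-r_0+\frac1n]$ and strictly increasing on $[r_0-\frac1n,r_0+\frac1n]$. -/

import Mathlib

open Set MeasureTheory
open scoped ENNReal ContDiff

noncomputable section

namespace SoapFilm

/-! ### The critical value of the aspect ratio -/

/-- The equation `c sinh c - cosh c = 0` has exactly one positive solution. -/
theorem existsUnique_cCrit :
    ∃! c : ℝ, 0 < c ∧ c * Real.sinh c - Real.cosh c = 0 := by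
  have hderiv : ∀ x : ℝ, HasDerivAt (fun c : ℝ => c * Real.sinh c - Real.cosh c)
      (x * Real.cosh x) x := by
    intro x
    have h := ((hasDerivAt_id' x).mul (Real.hasDerivAt_sinh x)).sub (Real.hasDerivAt_cosh x)
    exact h.congr_deriv (by ring)
  have hcont : Continuous (fun c : ℝ => c * Real.sinh c - Real.cosh c) := by fun_prop
  have hmono : StrictMonoOn (fun c : ℝ => c * Real.sinh c - Real.cosh c) (Ici 0) := by
    apply strictMonoOn_of_deriv_pos (convex_Ici 0) hcont.continuousOn
    intro x hx
    rw [interior_Ici] at hx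
    rw [(hderiv x).deriv]
    exact mul_pos hx (Real.cosh_pos x)
  have h2 : 0 ≤ 2 * Real.sinh 2 - Real.cosh 2 := by
    have e : Real.cosh 2 - Real.sinh 2 = Real.exp (-2) := Real.cosh_sub_sinh 2
    have h1 : Real.exp (-2) ≤ 1 := Real.exp_le_one_iff.mpr (by norm_num)
    have h3 : (2 : ℝ) ≤ Real.sinh 2 := Real.self_le_sinh_iff.mpr (by norm_num)
    linarith
  obtain ⟨c, hc, hc0⟩ := intermediate_value_Icc (by norm_num : (0 : ℝ) ≤ 2) hcont.continuousOn
    (show (0 : ℝ) ∈ Icc _ _ from ⟨by simp, h2⟩)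
  have hc' : c * Real.sinh c - Real.cosh c = 0 := hc0
  have hpos : 0 < c := by
    rcases hc.1.eq_or_lt with h | h
    · exfalso
      rw [← h] at hc'
      simp at hc'
    · exact h
  refine ⟨c, ⟨hpos, hc'⟩, ?_⟩
  rintro d ⟨hd, hd0⟩
  exact hmono.injOn (mem_Ici.mpr hd.le) (mem_Ici.mpr hpos.le) (hd0.trans hc'.symm)

/-- `c_crit`, the positive solution of `c sinh c - cosh c = 0`. -/
def cCrit : ℝ := existsUnique_cCrit.choose

/-- `σ_crit = cosh c_crit / c_crit`. -/
def sigmaCrit : ℝ := Real.cosh cCrit / cCrit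

/-! ### Sobolev functions on the interval `(-1,1)` -/

/-- Lebesgue measure on `(-1,1)`. -/
abbrev μI : Measure ℝ := volume.restrict (Ioo (-1 : ℝ) 1)

/-- Test functions: elements of `C_c^∞((-1,1))`, extended by zero. -/
def IsTestFunction (φ : ℝ → ℝ) : Prop :=
  ContDiff ℝ ∞ φ ∧ HasCompactSupport φ ∧ tsupport φ ⊆ Ioo (-1 : ℝ) 1

/-- For `f, g ∈ L_1(-1,1)`: `g` is the weak derivative of `f` on `(-1,1)`. -/
def IsWeakDeriv (f g : ℝ → ℝ) : Prop :=
  Integrable f μI ∧ Integrable g μI ∧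
    ∀ φ : ℝ → ℝ, IsTestFunction φ → ∫ z, f z * deriv φ z ∂μI = -∫ z, g z * φ z ∂μI

theorem IsTestFunction.integrable_mul {φ f : ℝ → ℝ} (hφ : IsTestFunction φ)
    (hf : Integrable f μI) : Integrable (fun z => f z * φ z) μI := by
  obtain ⟨C, hC⟩ := hφ.2.1.exists_bound_of_continuous hφ.1.continuous
  exact hf.mul_bdd hφ.1.continuous.aestronglyMeasurable (Filter.Eventually.of_forall hC)

theorem IsTestFunction.integrable_mul_deriv {φ f : ℝ → ℝ} (hφ : IsTestFunction φ)
    (hf : Integrable f μI) : Integrable (fun z => f z * deriv φ z) μI := by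
  have hc : Continuous (deriv φ) := hφ.1.continuous_deriv (by simp)
  obtain ⟨C, hC⟩ := hφ.2.1.deriv.exists_bound_of_continuous hc
  exact hf.mul_bdd hc.aestronglyMeasurable (Filter.Eventually.of_forall hC)

theorem IsWeakDeriv.congr {f g f' g' : ℝ → ℝ} (h : IsWeakDeriv f g)
    (hf : f =ᵐ[μI] f') (hg : g =ᵐ[μI] g') : IsWeakDeriv f' g' := by
  refine ⟨h.1.congr hf, h.2.1.congr hg, fun φ hφ => ?_⟩
  have e1 : ∫ z, f z * deriv φ z ∂μI = ∫ z, f' z * deriv φ z ∂μI :=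
    integral_congr_ae (hf.mono fun z hz => by simp only [hz])
  have e2 : ∫ z, g z * φ z ∂μI = ∫ z, g' z * φ z ∂μI :=
    integral_congr_ae (hg.mono fun z hz => by simp only [hz])
  rw [← e1, ← e2]
  exact h.2.2 φ hφ

theorem IsWeakDeriv.add {f g f' g' : ℝ → ℝ} (h : IsWeakDeriv f g) (h' : IsWeakDeriv f' g') :
    IsWeakDeriv (f + f') (g + g') := by
  refine ⟨h.1.add h'.1, h.2.1.add h'.2.1, fun φ hφ => ?_⟩
  simp only [Pi.add_apply, add_mul]
  rw [integral_add (hφ.integrable_mul_deriv h.1) (hφ.integrable_mul_deriv h'.1),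
    integral_add (hφ.integrable_mul h.2.1) (hφ.integrable_mul h'.2.1),
    h.2.2 φ hφ, h'.2.2 φ hφ]
  ring

theorem IsWeakDeriv.smul {f g : ℝ → ℝ} (a : ℝ) (h : IsWeakDeriv f g) :
    IsWeakDeriv (a • f) (a • g) := by
  refine ⟨h.1.smul a, h.2.1.smul a, fun φ hφ => ?_⟩
  simp only [Pi.smul_apply, smul_eq_mul, mul_assoc]
  rw [integral_const_mul, integral_const_mul, h.2.2 φ hφ]
  ring

theorem isWeakDeriv_zero : IsWeakDeriv 0 0 :=
  ⟨integrable_zero _ _ _, integrable_zero _ _ _, fun φ _ => by simp⟩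

/-- `f` is (the restriction to `[-1,1]` of) the continuous representative of a function `v` on
`(-1,1)`, and it vanishes at both end points. -/
def IsContRepZeroTrace (v f : ℝ → ℝ) : Prop :=
  ContinuousOn f (Icc (-1) 1) ∧ v =ᵐ[μI] f ∧ f (-1) = 0 ∧ f 1 = 0

/-- The Sobolev space `W²_{q,D}(-1,1)` of functions in `W²_q(-1,1)` with zero trace. A function
`w ∈ W²_q(-1,1)` is recorded as the triple `(w, ∂_z w, ∂_zz w)` of elements of `L_q(-1,1)`, the
derivatives being weak ones; the norm is the maximum of the three `L_q`-norms, which is equivalent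
to the usual `W²_q`-norm. -/
def W2D (q : ℝ≥0∞) [Fact (1 ≤ q)] : Submodule ℝ (Lp ℝ q μI × Lp ℝ q μI × Lp ℝ q μI) where
  carrier := {w | IsWeakDeriv w.1 w.2.1 ∧ IsWeakDeriv w.2.1 w.2.2 ∧
    ∃ f : ℝ → ℝ, IsContRepZeroTrace w.1 f}
  zero_mem' := by
    have h0 : ((0 : Lp ℝ q μI) : ℝ → ℝ) =ᵐ[μI] 0 := Lp.coeFn_zero ℝ q μI
    exact ⟨isWeakDeriv_zero.congr h0.symm h0.symm, isWeakDeriv_zero.congr h0.symm h0.symm,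
      0, continuousOn_const, h0, rfl, rfl⟩
  add_mem' := by
    rintro a b ⟨ha1, ha2, f, hf1, hf2, hf3, hf4⟩ ⟨hb1, hb2, g, hg1, hg2, hg3, hg4⟩
    refine ⟨(ha1.add hb1).congr (Lp.coeFn_add _ _).symm (Lp.coeFn_add _ _).symm,
      (ha2.add hb2).congr (Lp.coeFn_add _ _).symm (Lp.coeFn_add _ _).symm,
      f + g, hf1.add hg1, (Lp.coeFn_add _ _).trans (hf2.add hg2), ?_, ?_⟩
    · simp [hf3, hg3]
    · simp [hf4, hg4]
  smul_mem' := by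
    rintro r a ⟨ha1, ha2, f, hf1, hf2, hf3, hf4⟩
    refine ⟨(ha1.smul r).congr (Lp.coeFn_smul _ _).symm (Lp.coeFn_smul _ _).symm,
      (ha2.smul r).congr (Lp.coeFn_smul _ _).symm (Lp.coeFn_smul _ _).symm,
      r • f, hf1.const_smul r, (Lp.coeFn_smul _ _).trans (hf2.const_smul r), ?_, ?_⟩
    · simp [hf3]
    · simp [hf4]

variable {q : ℝ≥0∞} [Fact (1 ≤ q)]

/-- The continuous representative of `w ∈ W²_{q,D}(-1,1)`, to be evaluated on `[-1,1]` only,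
where it is uniquely determined. -/
def rep (w : W2D q) : ℝ → ℝ := w.2.2.2.choose

/-- The weak derivative `∂_z w ∈ L_q(-1,1)` of `w ∈ W²_{q,D}(-1,1)`. -/
def weakD (w : W2D q) : ℝ → ℝ := (w : Lp ℝ q μI × Lp ℝ q μI × Lp ℝ q μI).2.1

/-- The pointwise derivative `∂_z w (z)` at a point `z ∈ [-1,1]`, one-sided at the end points. -/
def pointD (w : W2D q) (z : ℝ) : ℝ := derivWithin (rep w) (Icc (-1) 1) z

/-! ### The small aspect ratio model -/

/-- The electrostatic force of the small aspect ratio model, as a function of the values `y = u(z)`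
and `p = ∂_z u(z)`. -/
def gSar (σ y p : ℝ) : ℝ :=
  Real.sqrt (1 + σ ^ 2 * p ^ 2) * (1 / ((y + 1) ^ 2 * (Real.log (2 / (y + 1))) ^ 2))

/-- `u ∈ W²_{q,D}(-1,1)` solves
`-σ ∂_z arctan(σ ∂_z u) = -1/(u+1) + λ g_sar(u)`, `u(±1) = 0`, `-1 < u < 1`. -/
def IsSolution (σ lam : ℝ) (u : W2D q) : Prop :=
  (∀ z ∈ Ioo (-1 : ℝ) 1, -1 < rep u z ∧ rep u z < 1) ∧
  IsWeakDeriv (fun z => -σ * Real.arctan (σ * weakD u z))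
    (fun z => -(1 / (rep u z + 1)) + lam * gSar σ (rep u z) (weakD u z))

/-- `f` is on `[-1,1]` the inner catenoid `cosh(c z) / cosh c - 1`, where `c = c_in` is the solution
of `σ = cosh c / c` with `c > c_crit`. -/
def IsInnerCatenoid (σ : ℝ) (f : ℝ → ℝ) : Prop :=
  ∃ c : ℝ, cCrit < c ∧ σ = Real.cosh c / c ∧
    ∀ z ∈ Icc (-1 : ℝ) 1, f z = Real.cosh (c * z) / Real.cosh c - 1

/-- `u` is a curve `[λ ↦ u^λ_in] : [0,δ₀) → W²_{q,D}(-1,1)` of stationary solutions emanating from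
the inner catenoid: it is analytic, `u^0_in` is the inner catenoid, and `u^λ_in` solves the small
aspect ratio model with parameter `λ`. -/
structure IsInnerBranch (σ δ₀ : ℝ) (u : ℝ → W2D q) : Prop where
  pos : 0 < δ₀
  analytic : AnalyticOn ℝ u (Ico 0 δ₀)
  init : IsInnerCatenoid σ (rep (u 0))
  solves : ∀ lam ∈ Ico 0 δ₀, IsSolution σ lam (u lam)

/-- `∂_λ u^0_in`, the (right) derivative of the curve at `λ = 0`, in `W²_{q,D}(-1,1)`. -/
def dLam (δ₀ : ℝ) (u : ℝ → W2D q) : W2D q := derivWithin u (Ico 0 δ₀) 0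

/-- Infinitesimal inward deflection: `w < 0` in `(-1,1)`, with strict signs of the slopes at the
end points. -/
def DeflectsInward (w : W2D q) : Prop :=
  (∀ z ∈ Ioo (-1 : ℝ) 1, rep w z < 0) ∧ pointD w (-1) < 0 ∧ 0 < pointD w 1

/-- Infinitesimal deflection inward on `(-r₀,r₀)` and outward on `(-1,-r₀) ∪ (r₀,1)`, with strict
signs of the slopes at `±r₀` and `±1`. -/
def DeflectsMixed (w : W2D q) (r₀ : ℝ) : Prop :=
  (∀ z ∈ Ioo (-r₀) r₀, rep w z < 0) ∧
  (∀ z ∈ Ioo (-1) (-r₀) ∪ Ioo r₀ 1, 0 < rep w z) ∧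
  0 < pointD w (-1) ∧ pointD w (-r₀) < 0 ∧ 0 < pointD w r₀ ∧ pointD w 1 < 0

/-- `s` can serve as the lower threshold `σ_*`: `s > σ_crit`, and for all `σ ∈ (σ_crit, s)` the
curves emanating from the inner catenoid deflect inward infinitesimally. -/
def IsLowerThreshold (s : ℝ) : Prop :=
  sigmaCrit < s ∧ ∀ σ : ℝ, sigmaCrit < σ → σ < s →
    ∀ (q : ℝ≥0∞) [Fact (1 ≤ q)], 2 < q → q < ⊤ →
      ∀ (δ₀ : ℝ) (u : ℝ → W2D q), IsInnerBranch σ δ₀ u → DeflectsInward (dLam δ₀ u)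

/-- `s` can serve as the upper threshold `σ^*`: `s > σ_crit`, and for all `σ > s` the curves
emanating from the inner catenoid have mixed infinitesimal deflection. -/
def IsUpperThreshold (s : ℝ) : Prop :=
  sigmaCrit < s ∧ ∀ σ : ℝ, s < σ →
    ∀ (q : ℝ≥0∞) [Fact (1 ≤ q)], 2 < q → q < ⊤ →
      ∀ (δ₀ : ℝ) (u : ℝ → W2D q), IsInnerBranch σ δ₀ u →
        ∃ r₀ ∈ Ioo (0 : ℝ) 1, DeflectsMixed (dLam δ₀ u) r₀

end SoapFilm

end

noncomputable section

namespace SoapFilm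

open Filter Topology

/-! ### Weak derivatives on the interval and indefinite integrals -/

section WeakDerivatives

/-! A function u with zero boundary values is recovered from its second derivative f: `sol f` is u
and `slope f` is u'. The model then reads f = `rhsC σ (λ, 1 + sol f, slope f)` in the Banach algebra
C([-1,1]), where the right-hand side is analytic. Its linearization at the inner catenoid is w'' -
2c tanh(cz) w' + c² w (`linOp`), with the explicit homogeneous solutions sinh(cz) and y(cz), y(x) =
x sinh x - cosh x (`yEven`). For c > c_crit one has y(c) > 0, so the operator is invertible under
zero boundary conditions, and the implicit function theorem gives a branch (`exists_isInnerBranch`).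

Conversely, solutions along an arbitrary branch satisfy the integrated form of the equation.
Differentiating it at λ = 0 shows that w = ∂_λ u⁰ solves the linearized problem with right-hand side
-`source` (`IsInnerBranch.exists_dLam_eq`). By uniqueness w is even. Lagrange's identity with y(cz),
integrated over [0,1], gives w'(1) y(c) / cosh² c = c² `signIntegral c` (`bracketEven_one_eq`). The
same bracket governs the derivative of w / y, so a Sturm-type argument turns the sign of this one
number into the whole sign pattern of w (`sol_neg_of_bracket_pos`, `exists_sol_sign_change`). The
integral is positive at c_crit, hence slightly above it, and negative for large c. As c ↦ cosh c / c
increases beyond c_crit, this yields both thresholds.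

For finite λ, the branch is strictly differentiable at 0 as a curve in C¹, so difference quotients
of u^λ between small parameters are C¹-close to w (`IsInnerBranch.exists_quotient_mem`). The sign
patterns of w survive small C¹ perturbations: compact pieces are stable in the supremum norm, while
near ±1 and near the interior zeros the strict slopes take over. -/

theorem intervalIntegrable_of_integrable_muI {g : ℝ → ℝ} (hg : Integrable g μI) {a b : ℝ}
    (ha : a ∈ Icc (-1 : ℝ) 1) (hb : b ∈ Icc (-1 : ℝ) 1) : IntervalIntegrable g volume a b := by
  have h : IntervalIntegrable g volume (-1) 1 := by
    rw [intervalIntegrable_iff_integrableOn_Ioo_of_le (by norm_num)]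
    exact hg
  refine h.mono_set ?_
  rw [uIcc_of_le (by norm_num : (-1 : ℝ) ≤ 1)]
  exact uIcc_subset_Icc ha hb

theorem integral_muI (g : ℝ → ℝ) : ∫ z, g z ∂μI = ∫ z in (-1 : ℝ)..1, g z := by
  rw [intervalIntegral.integral_of_le (by norm_num), integral_Ioc_eq_integral_Ioo]

theorem integrable_muI_of_continuousOn {f : ℝ → ℝ} (hf : ContinuousOn f (Icc (-1) 1)) :
    Integrable f μI :=
  (hf.integrableOn_Icc).mono_set Ioo_subset_Icc_self

theorem continuousOn_primitive_muI {g : ℝ → ℝ} (hg : Integrable g μI) :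
    ContinuousOn (fun z => ∫ t in (-1 : ℝ)..z, g t) (Icc (-1) 1) := by
  have h := intervalIntegrable_of_integrable_muI hg (a := -1) (b := 1) (by norm_num) (by norm_num)
  have := (h.absolutelyContinuousOnInterval_intervalIntegral (c := -1) (by simp)).continuousOn
  rwa [uIcc_of_le (by norm_num : (-1 : ℝ) ≤ 1)] at this

theorem IsTestFunction.eq_zero {φ : ℝ → ℝ} (hφ : IsTestFunction φ) {z : ℝ}
    (hz : z ∉ Ioo (-1 : ℝ) 1) : φ z = 0 :=
  image_eq_zero_of_notMem_tsupport fun h => hz (hφ.2.2 h)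

/-- An indefinite Lebesgue integral has the integrand as weak derivative. -/
theorem isWeakDeriv_primitive {g : ℝ → ℝ} (hg : Integrable g μI) (C : ℝ) :
    IsWeakDeriv (fun z => C + ∫ t in (-1 : ℝ)..z, g t) g := by
  have hint := intervalIntegrable_of_integrable_muI hg (a := -1) (b := 1) (by norm_num)
    (by norm_num)
  have hac := hint.absolutelyContinuousOnInterval_intervalIntegral (c := -1) (by simp)
  refine ⟨integrable_muI_of_continuousOn
    (continuousOn_const.add (continuousOn_primitive_muI hg)), hg, fun φ hφ => ?_⟩
  have hφac : AbsolutelyContinuousOnInterval φ (-1) 1 :=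
    ContDiffOn.absolutelyContinuousOnInterval (hφ.1.of_le (by simp)).contDiffOn
  have h := hac.integral_mul_deriv_eq_deriv_mul hφac
  have hd : ∫ z in (-1 : ℝ)..1, deriv (fun z => ∫ t in (-1 : ℝ)..z, g t) z * φ z
      = ∫ z in (-1 : ℝ)..1, g z * φ z := by
    apply intervalIntegral.integral_congr_ae
    -- By Lebesgue differentiation the derivative of the primitive is the integrand almost
    -- everywhere, which suffices under the integral.
    filter_upwards [hint.ae_hasDerivAt_integral] with x hx hx'
    rw [(hx (uIoc_subset_uIcc hx') (-1) (by simp)).deriv]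
  have hφ1 : φ 1 = 0 := hφ.eq_zero (by simp)
  have hφ2 : φ (-1) = 0 := hφ.eq_zero (by simp)
  rw [hd, hφ1, hφ2] at h
  have hφd : ∫ z in (-1 : ℝ)..1, deriv φ z = 0 := by
    rw [hφac.integral_deriv_eq_sub, hφ1, hφ2, sub_zero]
  have hdc : Continuous (deriv φ) := hφ.1.continuous_deriv (by simp)
  rw [integral_muI, integral_muI]
  have hadd : ∫ z in (-1 : ℝ)..1, (C + ∫ t in (-1 : ℝ)..z, g t) * deriv φ z
      = C * (∫ z in (-1 : ℝ)..1, deriv φ z)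
        + ∫ z in (-1 : ℝ)..1, (∫ t in (-1 : ℝ)..z, g t) * deriv φ z := by
    rw [← intervalIntegral.integral_const_mul, ← intervalIntegral.integral_add]
    · simp only [add_mul]
    · exact (continuous_const.mul hdc).intervalIntegrable _ _
    · apply ContinuousOn.intervalIntegrable
      exact hac.continuousOn.mul hdc.continuousOn
  rw [hadd, h, hφd]
  ring

/-- A test function with vanishing integral is the derivative of a test function. -/
theorem IsTestFunction.exists_primitive {θ : ℝ → ℝ} (hθ : IsTestFunction θ)
    (h0 : ∫ z, θ z ∂μI = 0) : ∃ Θ : ℝ → ℝ, IsTestFunction Θ ∧ deriv Θ = θ := by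
  have hθc : Continuous θ := hθ.1.continuous
  have hder : ∀ z, HasDerivAt (fun z => ∫ t in (-1 : ℝ)..z, θ t) (θ z) z := fun z =>
    intervalIntegral.integral_hasDerivAt_right (hθc.intervalIntegrable _ _)
      hθc.stronglyMeasurable.stronglyMeasurableAtFilter hθc.continuousAt
  have hd : deriv (fun z => ∫ t in (-1 : ℝ)..z, θ t) = θ := funext fun z => (hder z).deriv
  refine ⟨_, ?_, hd⟩
  -- The primitive is supported in any [a,b] containing the support of θ: it vanishes left of a
  -- trivially, and right of b because the total integral is zero.
  obtain ⟨a, b, ha, hb, hab, hK⟩ : ∃ a b : ℝ, -1 < a ∧ b < 1 ∧ a ≤ b ∧ tsupport θ ⊆ Icc a b := by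
    rcases (tsupport θ).eq_empty_or_nonempty with he | hne
    · exact ⟨0, 0, by norm_num, by norm_num, le_rfl, by simp [he]⟩
    · have hcpt : IsCompact (tsupport θ) := hθ.2.1
      obtain ⟨a, ha⟩ := hcpt.exists_isLeast hne
      obtain ⟨b, hb⟩ := hcpt.exists_isGreatest hne
      exact ⟨a, b, (hθ.2.2 ha.1).1, (hθ.2.2 hb.1).2, ha.2 hb.1, fun x hx => ⟨ha.2 hx, hb.2 hx⟩⟩
  have hz : ∀ z, z ∉ Icc a b → θ z = 0 := fun z h =>
    image_eq_zero_of_notMem_tsupport fun h' => h (hK h')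
  have hsupp : Function.support (fun z => ∫ t in (-1 : ℝ)..z, θ t) ⊆ Icc a b := by
    intro z hzs
    by_contra hn
    apply hzs
    rw [mem_Icc, not_and_or, not_le, not_le] at hn
    rcases hn with hn | hn
    · change ∫ t in (-1 : ℝ)..z, θ t = 0
      apply intervalIntegral.integral_zero_ae
      refine ae_of_all _ fun t ht => hz t fun h => ?_
      have := (uIoc_subset_uIcc ht)
      rw [mem_uIcc] at this
      rcases this with h' | h' <;> linarith [h.1, h'.1, h'.2]
    · change ∫ t in (-1 : ℝ)..z, θ t = 0
      rw [← intervalIntegral.integral_add_adjacent_intervals (b := 1)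
        (hθc.intervalIntegrable _ _) (hθc.intervalIntegrable _ _), ← integral_muI, h0, zero_add]
      apply intervalIntegral.integral_zero_ae
      refine ae_of_all _ fun t ht => hz t fun h => ?_
      have := (uIoc_subset_uIcc ht)
      rw [mem_uIcc] at this
      rcases this with h' | h' <;> linarith [h.2, h'.1, h'.2]
  have hts : tsupport (fun z => ∫ t in (-1 : ℝ)..z, θ t) ⊆ Icc a b :=
    closure_minimal hsupp isClosed_Icc
  refine ⟨?_, HasCompactSupport.of_support_subset_isCompact isCompact_Icc hsupp,
    fun z hz' => ⟨ha.trans_le (hts hz').1, (hts hz').2.trans_lt hb⟩⟩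
  rw [contDiff_infty_iff_deriv, hd]
  exact ⟨fun z => (hder z).differentiableAt, hθ.1⟩

theorem exists_isTestFunction_integral_eq_one :
    ∃ ψ : ℝ → ℝ, IsTestFunction ψ ∧ ∫ z, ψ z ∂μI = 1 := by
  obtain ⟨f, hf1, hf2, hf3, hf4, hf5⟩ := exists_contDiff_tsupport_subset (n := ⊤)
    (Ioo_mem_nhds (by norm_num : (-1 : ℝ) < 0) (by norm_num : (0 : ℝ) < 1))
  have hpos : 0 < ∫ z, f z ∂μI := by
    rw [integral_muI]
    refine intervalIntegral.integral_pos (by norm_num) hf3.continuous.continuousOn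
      (fun x _ => (hf4 (mem_range_self x)).1) ⟨0, by norm_num, by rw [hf5]; norm_num⟩
  refine ⟨fun z => (∫ z, f z ∂μI)⁻¹ * f z, ⟨contDiff_const.mul hf3, hf2.mul_left, ?_⟩, ?_⟩
  · exact (tsupport_mul_subset_right).trans hf1
  · rw [integral_const_mul, inv_mul_cancel₀ hpos.ne']

theorem IsTestFunction.integrable {φ : ℝ → ℝ} (hφ : IsTestFunction φ) : Integrable φ μI :=
  integrable_muI_of_continuousOn hφ.1.continuous.continuousOn

theorem IsTestFunction.sub_mul {η ψ : ℝ → ℝ} (hη : IsTestFunction η) (hψ : IsTestFunction ψ)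
    (a : ℝ) : IsTestFunction (fun z => η z - a * ψ z) := by
  refine ⟨hη.1.sub (contDiff_const.mul hψ.1), hη.2.1.sub hψ.2.1.mul_left, ?_⟩
  refine (tsupport_sub _ _).trans (union_subset hη.2.2 ?_)
  exact tsupport_mul_subset_right.trans hψ.2.2

/-- A function with vanishing weak derivative is constant. -/
theorem IsWeakDeriv.exists_ae_eq_const {h : ℝ → ℝ} (hh : IsWeakDeriv h 0) :
    ∃ C : ℝ, h =ᵐ[μI] fun _ => C := by
  obtain ⟨ψ, hψ, hψ1⟩ := exists_isTestFunction_integral_eq_one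
  refine ⟨∫ z, h z * ψ z ∂μI, ?_⟩
  set C := ∫ z, h z * ψ z ∂μI
  -- Du Bois-Reymond's argument: η minus (∫ η) ψ has mean zero, hence is the derivative of a test
  -- function and is annihilated by h.
  have key : ∀ η, IsTestFunction η → ∫ z, η z • (h z - C) ∂μI = 0 := by
    intro η hη
    obtain ⟨Θ, hΘ, hΘ'⟩ := (hη.sub_mul hψ (∫ z, η z ∂μI)).exists_primitive (by
      rw [integral_sub hη.integrable (hψ.integrable.const_mul _), integral_const_mul, hψ1]; ring)
    have e := hh.2.2 Θ hΘ
    rw [hΘ'] at e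
    simp only [Pi.zero_apply, zero_mul, integral_zero, neg_zero] at e
    have e2 : ∫ z, h z * (η z - (∫ z, η z ∂μI) * ψ z) ∂μI
        = ∫ z, h z * η z ∂μI - (∫ z, η z ∂μI) * C := by
      rw [← integral_const_mul, ← integral_sub (hη.integrable_mul hh.1)
        ((hψ.integrable_mul hh.1).const_mul _)]
      congr 1; ext z; ring
    have e3 : ∫ z, η z • (h z - C) ∂μI = ∫ z, h z * η z ∂μI - (∫ z, η z ∂μI) * C := by
      rw [← integral_mul_const, ← integral_sub (hη.integrable_mul hh.1)
        (hη.integrable.mul_const _)]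
      congr 1; ext z; simp only [smul_eq_mul]; ring
    rw [e3, ← e2, e]
  have hloc : LocallyIntegrableOn (fun z => h z - C) (Ioo (-1 : ℝ) 1) volume := by
    have : IntegrableOn (fun z => h z - C) (Ioo (-1 : ℝ) 1) volume :=
      hh.1.sub (integrable_const _)
    exact this.locallyIntegrableOn
  have h3 := isOpen_Ioo.ae_eq_zero_of_integral_contDiff_smul_eq_zero hloc (fun g hg1 hg2 hg3 => by
    rw [← key g ⟨hg1, hg2, hg3⟩, ← integral_indicator measurableSet_Ioo]
    congr 1
    ext z
    by_cases hz : z ∈ Ioo (-1 : ℝ) 1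
    · rw [indicator_of_mem hz]
    · rw [indicator_of_notMem hz, IsTestFunction.eq_zero ⟨hg1, hg2, hg3⟩ hz, zero_smul])
  filter_upwards [(ae_restrict_iff' measurableSet_Ioo).2 h3] with z hz
  linarith

/-- A function with an integrable weak derivative is an indefinite integral of it. -/
theorem IsWeakDeriv.exists_ae_eq_primitive {f g : ℝ → ℝ} (h : IsWeakDeriv f g) :
    ∃ C : ℝ, f =ᵐ[μI] fun z => C + ∫ t in (-1 : ℝ)..z, g t := by
  have h2 := h.add ((isWeakDeriv_primitive h.2.1 0).smul (-1))
  have h3 : g + (-1 : ℝ) • g =ᵐ[μI] 0 := by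
    refine ae_of_all _ fun z => ?_
    simp
  obtain ⟨C, hC⟩ := (h2.congr (ae_eq_refl _) h3).exists_ae_eq_const
  refine ⟨C, hC.mono fun z hz => ?_⟩
  simp only [Pi.add_apply, Pi.smul_apply, smul_eq_mul] at hz
  linarith

theorem eqOn_Icc_of_ae_eq {f g : ℝ → ℝ} (hf : ContinuousOn f (Icc (-1) 1))
    (hg : ContinuousOn g (Icc (-1) 1)) (h : f =ᵐ[μI] g) : EqOn f g (Icc (-1) 1) := by
  have h1 : EqOn f g (Ioo (-1) 1) :=
    Measure.eqOn_Ioo_of_ae_eq _ h (hf.mono Ioo_subset_Icc_self) (hg.mono Ioo_subset_Icc_self)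
  refine h1.of_subset_closure hf hg Ioo_subset_Icc_self ?_
  rw [closure_Ioo (by norm_num)]

end WeakDerivatives

/-! ### Recovering a function and its slope from the second derivative -/

section Embedding

/-- The Banach algebra of continuous functions on `[-1,1]`. -/
abbrev CI : Type := C(Icc (-1 : ℝ) 1, ℝ)

theorem neg_one_le_one' : (-1 : ℝ) ≤ 1 := by norm_num

/-- Constant extension of a continuous function on `[-1,1]` to the real line. -/
def ext (f : CI) : ℝ → ℝ := IccExtend neg_one_le_one' f

theorem continuous_ext (f : CI) : Continuous (ext f) := f.continuous.Icc_extend'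

theorem ext_apply (f : CI) {z : ℝ} (hz : z ∈ Icc (-1 : ℝ) 1) : ext f z = f ⟨z, hz⟩ :=
  IccExtend_of_mem _ _ hz

@[simp] theorem ext_coe (f : CI) (z : Icc (-1 : ℝ) 1) : ext f z = f z := IccExtend_val _ _ _

theorem ext_injective {f g : CI} (h : EqOn (ext f) (ext g) (Icc (-1) 1)) : f = g := by
  ext z
  simpa using h z.2

/-- The restriction to `[-1,1]` of a function continuous there. -/
def restr (f : ℝ → ℝ) (hf : ContinuousOn f (Icc (-1) 1)) : CI :=
  ⟨(Icc (-1 : ℝ) 1).domRestrict f, hf.domRestrict⟩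

theorem ext_restr {f : ℝ → ℝ} (hf : ContinuousOn f (Icc (-1) 1)) {z : ℝ}
    (hz : z ∈ Icc (-1 : ℝ) 1) : ext (restr f hf) z = f z := by
  rw [ext_apply _ hz]; rfl

/-- Constant extension, as a linear map into the bounded continuous functions. -/
def extBCF : CI →L[ℝ] BoundedContinuousFunction ℝ ℝ :=
  LinearMap.mkContinuous
    { toFun := fun f => (BoundedContinuousFunction.mkOfCompact f).compContinuous
        ⟨projIcc (-1 : ℝ) 1 neg_one_le_one', continuous_projIcc⟩
      map_add' := fun _ _ => rfl
      map_smul' := fun _ _ => rfl } 1 (fun f => by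
    rw [one_mul, BoundedContinuousFunction.norm_le (norm_nonneg _)]
    exact fun x => f.norm_coe_le_norm _)

variable {q : ℝ≥0∞} [Fact (1 ≤ q)]

/-- The inclusion of the continuous functions into `L_q(-1,1)`. -/
def incl (q : ℝ≥0∞) [Fact (1 ≤ q)] : CI →L[ℝ] Lp ℝ q μI :=
  (BoundedContinuousFunction.toLp q μI ℝ).comp extBCF

theorem incl_ae (f : CI) : (incl q f : ℝ → ℝ) =ᵐ[μI] ext f :=
  BoundedContinuousFunction.coeFn_toLp _ _ _ (extBCF f)

theorem integrable_Lp (h : Lp ℝ q μI) : Integrable h μI :=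
  (Lp.memLp h).integrable Fact.out

theorem integrable_ext (f : CI) : Integrable (ext f) μI :=
  integrable_muI_of_continuousOn (continuous_ext f).continuousOn

/-- Hölder's inequality on a set of finite measure; it makes integration continuous from L_q to
C([-1,1]). -/
theorem exists_integral_norm_le (q : ℝ≥0∞) [Fact (1 ≤ q)] :
    ∃ C : ℝ, 0 ≤ C ∧ ∀ h : Lp ℝ q μI, ∫ z, ‖h z‖ ∂μI ≤ C * ‖h‖ := by
  refine ⟨((μI univ) ^ (1 / (1 : ℝ≥0∞).toReal - 1 / q.toReal)).toReal, ENNReal.toReal_nonneg,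
    fun h => ?_⟩
  have h1 := eLpNorm_le_eLpNorm_mul_rpow_measure_univ (μ := μI) (f := h) (p := 1) (q := q)
    Fact.out (Lp.aestronglyMeasurable h)
  rw [integral_norm_eq_lintegral_enorm (Lp.aestronglyMeasurable h), ← eLpNorm_one_eq_lintegral_enorm,
    Lp.norm_def, mul_comm, ← ENNReal.toReal_mul]
  refine ENNReal.toReal_mono (ENNReal.mul_ne_top (Lp.eLpNorm_ne_top h) ?_) h1
  refine ENNReal.rpow_ne_top_of_nonneg ?_ (measure_ne_top _ _)
  have hq : 1 ≤ q := Fact.out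
  rcases eq_or_ne q ⊤ with rfl | hq'
  · simp
  · have : 1 ≤ q.toReal := by
      rw [← ENNReal.toReal_one]; exact ENNReal.toReal_mono hq' hq
    rw [ENNReal.toReal_one, div_one, sub_nonneg, div_le_one (by linarith)]
    exact this

/-- The primitive `z ↦ ∫_{-1}^z h` of an `L_q`-function, as a continuous function. -/
def primLp (q : ℝ≥0∞) [Fact (1 ≤ q)] : Lp ℝ q μI →L[ℝ] CI :=
  LinearMap.mkContinuous
    { toFun := fun h => restr (fun z => ∫ t in (-1 : ℝ)..z, h t)
        (continuousOn_primitive_muI (integrable_Lp h))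
      map_add' := by
        intro a b
        ext z
        have hm : (-1 : ℝ) ∈ Icc (-1 : ℝ) 1 := by norm_num
        change ∫ t in (-1 : ℝ)..z, (a + b : Lp ℝ q μI) t
          = (∫ t in (-1 : ℝ)..z, a t) + ∫ t in (-1 : ℝ)..z, b t
        rw [← intervalIntegral.integral_add
          (intervalIntegrable_of_integrable_muI (integrable_Lp a) hm z.2)
          (intervalIntegrable_of_integrable_muI (integrable_Lp b) hm z.2),
          intervalIntegral.integral_of_le z.2.1, intervalIntegral.integral_of_le z.2.1,
          integral_Ioc_eq_integral_Ioo, integral_Ioc_eq_integral_Ioo]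
        apply integral_congr_ae
        exact ae_restrict_of_ae_restrict_of_subset (Ioo_subset_Ioo_right z.2.2) (Lp.coeFn_add a b)
      map_smul' := by
        intro r a
        ext z
        change ∫ t in (-1 : ℝ)..z, (r • a : Lp ℝ q μI) t = r * (∫ t in (-1 : ℝ)..z, a t)
        rw [← intervalIntegral.integral_const_mul,
          intervalIntegral.integral_of_le z.2.1, intervalIntegral.integral_of_le z.2.1,
          integral_Ioc_eq_integral_Ioo, integral_Ioc_eq_integral_Ioo]
        apply integral_congr_ae
        exact ae_restrict_of_ae_restrict_of_subset (Ioo_subset_Ioo_right z.2.2)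
          (Lp.coeFn_smul r a) } (exists_integral_norm_le q).choose (fun h => by
    have hC := (exists_integral_norm_le q).choose_spec
    rw [ContinuousMap.norm_le _ (mul_nonneg hC.1 (norm_nonneg _))]
    intro z
    refine le_trans ?_ (hC.2 h)
    change ‖∫ t in (-1 : ℝ)..z, h t‖ ≤ _
    refine (intervalIntegral.norm_integral_le_integral_norm z.2.1).trans ?_
    rw [intervalIntegral.integral_of_le z.2.1, integral_Ioc_eq_integral_Ioo]
    exact setIntegral_mono_set (integrable_Lp h).norm (ae_of_all _ fun _ => norm_nonneg _)
      (Ioo_subset_Ioo_right z.2.2).eventuallyLE)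

theorem primLp_apply (h : Lp ℝ q μI) (z : Icc (-1 : ℝ) 1) :
    primLp q h z = ∫ t in (-1 : ℝ)..z, h t := rfl

/-- The primitive `z ↦ ∫_{-1}^z f` of a continuous function. -/
def prim : CI →L[ℝ] CI := (primLp 1).comp (incl 1)

theorem integral_congr_muI {f g : ℝ → ℝ} (h : f =ᵐ[μI] g) (z : Icc (-1 : ℝ) 1) :
    ∫ t in (-1 : ℝ)..z, f t = ∫ t in (-1 : ℝ)..z, g t := by
  rw [intervalIntegral.integral_of_le z.2.1, intervalIntegral.integral_of_le z.2.1,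
    integral_Ioc_eq_integral_Ioo, integral_Ioc_eq_integral_Ioo]
  apply integral_congr_ae
  exact ae_restrict_of_ae_restrict_of_subset (Ioo_subset_Ioo_right z.2.2) h

theorem prim_apply (f : CI) (z : Icc (-1 : ℝ) 1) : prim f z = ∫ t in (-1 : ℝ)..z, ext f t := by
  rw [prim, ContinuousLinearMap.comp_apply, primLp_apply, integral_congr_muI (incl_ae f)]

theorem primLp_incl (f : CI) : primLp q (incl q f) = prim f := by
  ext z
  rw [primLp_apply, prim_apply, integral_congr_muI (incl_ae f)]

/-- Right end point of the interval. -/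
def rightEnd : Icc (-1 : ℝ) 1 := ⟨1, by norm_num⟩

/-- Left end point of the interval. -/
def leftEnd : Icc (-1 : ℝ) 1 := ⟨-1, by norm_num⟩

/-- Subtraction of the mean value. -/
def subMean : CI →L[ℝ] CI :=
  ContinuousLinearMap.id ℝ CI
    -- The mean is the total integral divided by the length 2; once it is removed, the primitive
    -- vanishes at the right end as well.
    - ((ContinuousMap.evalCLM ℝ rightEnd).comp prim).smulRight (ContinuousMap.const _ (1 / 2))

theorem subMean_apply (f : CI) (z : Icc (-1 : ℝ) 1) :
    subMean f z = f z - prim f rightEnd / 2 := by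
  simp [subMean]
  ring

theorem prim_leftEnd (f : CI) : prim f leftEnd = 0 := by
  rw [prim_apply]; simp [leftEnd]

theorem prim_const (a : ℝ) (z : Icc (-1 : ℝ) 1) :
    prim (ContinuousMap.const _ a) z = a * (z + 1) := by
  rw [prim_apply]
  have : ext (ContinuousMap.const _ a) = fun _ => a := rfl
  rw [this]
  simp
  ring

theorem subMean_eq (f : CI) : subMean f = f - ContinuousMap.const _ (prim f rightEnd / 2) := by
  ext z; rw [subMean_apply]; rfl

theorem prim_subMean_rightEnd (f : CI) : prim (subMean f) rightEnd = 0 := by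
  rw [subMean_eq, map_sub, ContinuousMap.sub_apply, prim_const]
  simp [rightEnd]
  ring

/-- The derivative of the solution of `w'' = h`, `w(±1) = 0`, for `h ∈ L_q`. -/
def slopeLp (q : ℝ≥0∞) [Fact (1 ≤ q)] : Lp ℝ q μI →L[ℝ] CI := subMean.comp (primLp q)

/-- The derivative of the solution of `w'' = f`, `w(±1) = 0`. -/
def slope : CI →L[ℝ] CI := subMean.comp prim

/-- The solution of `w'' = f`, `w(±1) = 0`. -/
def sol : CI →L[ℝ] CI := prim.comp slope

theorem slopeLp_incl (f : CI) : slopeLp q (incl q f) = slope f := by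
  simp only [slopeLp, slope, ContinuousLinearMap.comp_apply, primLp_incl]

theorem ext_sub_const (f : CI) (a : ℝ) (z : ℝ) :
    ext (f - ContinuousMap.const _ a) z = ext f z - a := rfl

theorem isWeakDeriv_prim (f : CI) (C : ℝ) :
    IsWeakDeriv (fun z => C + ext (prim f) z) (ext f) := by
  refine (isWeakDeriv_primitive (integrable_ext f) C).congr ?_ (ae_eq_refl _)
  refine (ae_restrict_iff' measurableSet_Ioo).2 (ae_of_all _ fun z hz => ?_)
  simp only [ext_apply _ (Ioo_subset_Icc_self hz), prim_apply]

theorem isWeakDeriv_slope (f : CI) : IsWeakDeriv (ext (slope f)) (ext f) := by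
  refine (isWeakDeriv_prim f (-(prim (prim f) rightEnd / 2))).congr
    (ae_of_all _ fun z => ?_) (ae_eq_refl _)
  rw [slope, ContinuousLinearMap.comp_apply, subMean_eq, ext_sub_const]
  ring

theorem isWeakDeriv_sol (f : CI) : IsWeakDeriv (ext (sol f)) (ext (slope f)) := by
  refine (isWeakDeriv_prim (slope f) 0).congr (ae_of_all _ fun z => ?_) (ae_eq_refl _)
  simp [sol]

theorem sol_leftEnd (f : CI) : sol f leftEnd = 0 := prim_leftEnd _

theorem sol_rightEnd (f : CI) : sol f rightEnd = 0 := prim_subMean_rightEnd _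

/-- The element of `W²_{q,D}` with continuous second derivative `f`. -/
def ofSnd (q : ℝ≥0∞) [Fact (1 ≤ q)] : CI →L[ℝ] W2D q :=
  (((incl q).comp sol).prod (((incl q).comp slope).prod (incl q))).codRestrict (W2D q) (fun f =>
    ⟨(isWeakDeriv_sol f).congr (incl_ae _).symm (incl_ae _).symm,
      (isWeakDeriv_slope f).congr (incl_ae _).symm (incl_ae _).symm,
      ext (sol f), (continuous_ext _).continuousOn, incl_ae _,
      by rw [ext_apply _ (by norm_num)]; exact sol_leftEnd f,
      by rw [ext_apply _ (by norm_num)]; exact sol_rightEnd f⟩)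

/-- The second weak derivative. -/
def sndD (q : ℝ≥0∞) [Fact (1 ≤ q)] : W2D q →L[ℝ] Lp ℝ q μI :=
  (ContinuousLinearMap.snd ℝ _ _).comp
    ((ContinuousLinearMap.snd ℝ _ _).comp (W2D q).subtypeL)

/-- The embedding of `W²_{q,D}` into the continuous functions. -/
def embVal (q : ℝ≥0∞) [Fact (1 ≤ q)] : W2D q →L[ℝ] CI :=
  prim.comp ((slopeLp q).comp (sndD q))

/-- The derivative, as a map from `W²_{q,D}` into the continuous functions. -/
def embSlope (q : ℝ≥0∞) [Fact (1 ≤ q)] : W2D q →L[ℝ] CI := (slopeLp q).comp (sndD q)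

theorem ext_prim {f : CI} {z : ℝ} (hz : z ∈ Icc (-1 : ℝ) 1) :
    ext (prim f) z = ∫ t in (-1 : ℝ)..z, ext f t := by
  rw [ext_apply _ hz, prim_apply]

/-- Two integrations of the second weak derivative give the slope and the value up to constants `C1`
and `C2`, and the two boundary conditions fix them. From here on, the chosen representative and the
L_q-class of the derivative may be replaced by continuous functions that depend linearly and
continuously on w. -/
theorem weakD_ae_and_rep_eqOn (w : W2D q) :
    weakD w =ᵐ[μI] ext (embSlope q w) ∧ EqOn (rep w) (ext (embVal q w)) (Icc (-1) 1) := by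
  obtain ⟨h1, h2, h3⟩ := w.2
  have hrep : IsContRepZeroTrace (w : Lp ℝ q μI × Lp ℝ q μI × Lp ℝ q μI).1 (rep w) := h3.choose_spec
  obtain ⟨C1, hC1⟩ := h2.exists_ae_eq_primitive
  obtain ⟨C2, hC2⟩ := h1.exists_ae_eq_primitive
  obtain ⟨hr1, hr2, hr3, hr4⟩ := hrep
  set P := primLp q (sndD q w) with hP
  have hD : weakD w =ᵐ[μI] ext (P + ContinuousMap.const _ C1) := by
    have : ∀ᵐ z ∂μI, z ∈ Ioo (-1 : ℝ) 1 := ae_restrict_mem measurableSet_Ioo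
    filter_upwards [hC1, this] with z hz hzI
    rw [ext_apply _ (Ioo_subset_Icc_self hzI)]
    change _ = P _ + C1
    rw [hP, primLp_apply, weakD, hz, add_comm]
    rfl
  have hV : EqOn (rep w) (fun z => C2 + ext (prim (P + ContinuousMap.const _ C1)) z)
      (Icc (-1) 1) := by
    apply eqOn_Icc_of_ae_eq hr1 (continuous_const.add (continuous_ext _)).continuousOn
    refine hr2.symm.trans (hC2.trans ?_)
    refine (ae_restrict_iff' measurableSet_Ioo).2 (ae_of_all _ fun z hz => ?_)
    change C2 + _ = C2 + _
    rw [ext_prim (Ioo_subset_Icc_self hz)]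
    congr 1
    exact integral_congr_muI hD ⟨z, Ioo_subset_Icc_self hz⟩
  have hl := hV (show (-1 : ℝ) ∈ Icc (-1 : ℝ) 1 by norm_num)
  have hr := hV (show (1 : ℝ) ∈ Icc (-1 : ℝ) 1 by norm_num)
  have e1 : ext (prim (P + ContinuousMap.const _ C1)) (-1) = 0 := by
    rw [ext_apply _ (by norm_num)]; exact prim_leftEnd _
  have e2 : ext (prim (P + ContinuousMap.const _ C1)) 1 = prim P rightEnd + 2 * C1 := by
    rw [ext_apply _ (by norm_num), map_add]
    change prim P rightEnd + prim (ContinuousMap.const _ C1) rightEnd = _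
    rw [prim_const]
    simp [rightEnd]; ring
  simp only [hr3, hr4, e1, e2] at hl hr
  have hC20 : C2 = 0 := by linarith
  have hC10 : C1 = -(prim P rightEnd / 2) := by linarith
  have hS : P + ContinuousMap.const _ C1 = embSlope q w := by
    ext z
    rw [embSlope, ContinuousLinearMap.comp_apply, slopeLp, ContinuousLinearMap.comp_apply,
      subMean_apply, hC10]
    change P z + _ = P z - _
    rw [ContinuousMap.const_apply]
    ring
  rw [hS] at hD hV
  refine ⟨hD, fun z hz => ?_⟩
  simp only [hV hz, hC20, zero_add]
  rfl

theorem weakD_ae (w : W2D q) : weakD w =ᵐ[μI] ext (embSlope q w) := (weakD_ae_and_rep_eqOn w).1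

theorem rep_eqOn (w : W2D q) : EqOn (rep w) (ext (embVal q w)) (Icc (-1) 1) :=
  (weakD_ae_and_rep_eqOn w).2

theorem embVal_eq_prim (w : W2D q) : embVal q w = prim (embSlope q w) := rfl

theorem embSlope_ofSnd (f : CI) : embSlope q (ofSnd q f) = slope f := slopeLp_incl f

theorem embVal_ofSnd (f : CI) : embVal q (ofSnd q f) = sol f := by
  rw [embVal_eq_prim, embSlope_ofSnd]; rfl

theorem hasDerivWithinAt_prim (f : CI) {z : ℝ} (hz : z ∈ Icc (-1 : ℝ) 1) :
    HasDerivWithinAt (ext (prim f)) (ext f z) (Icc (-1) 1) z := by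
  have h : HasDerivAt (fun z => ∫ t in (-1 : ℝ)..z, ext f t) (ext f z) z :=
    intervalIntegral.integral_hasDerivAt_right ((continuous_ext f).intervalIntegrable _ _)
      (continuous_ext f).stronglyMeasurable.stronglyMeasurableAtFilter
      (continuous_ext f).continuousAt
  exact h.hasDerivWithinAt.congr (fun x hx => ext_prim hx) (ext_prim hz)

theorem hasDerivWithinAt_rep (w : W2D q) {z : ℝ} (hz : z ∈ Icc (-1 : ℝ) 1) :
    HasDerivWithinAt (rep w) (ext (embSlope q w) z) (Icc (-1) 1) z :=
  (hasDerivWithinAt_prim (embSlope q w) hz).congr (fun _ hx => rep_eqOn w hx) (rep_eqOn w hz)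

theorem pointD_eq (w : W2D q) {z : ℝ} (hz : z ∈ Icc (-1 : ℝ) 1) :
    pointD w z = ext (embSlope q w) z :=
  (hasDerivWithinAt_rep w hz).derivWithin (uniqueDiffOn_Icc (by norm_num) z hz)

theorem embVal_leftEnd (w : W2D q) : embVal q w leftEnd = 0 := prim_leftEnd _

theorem embVal_rightEnd (w : W2D q) : embVal q w rightEnd = 0 := prim_subMean_rightEnd _

end Embedding

/-! ### Analyticity of the superposition operators on C([-1,1]) -/

section Nemytskii

/-- Evaluation at a point is a continuous algebra homomorphism, so it commutes with the exponential
series. -/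
theorem exp_CI_apply (f : CI) (z : Icc (-1 : ℝ) 1) : NormedSpace.exp f z = Real.exp (f z) := by
  have h := NormedSpace.map_exp_of_mem_ball (𝕂 := ℝ) (ContinuousMap.evalAlgHom ℝ ℝ z)
    (continuous_eval_const z) f
    ((NormedSpace.expSeries_radius_eq_top ℝ CI).symm ▸ edist_lt_top _ _)
  rw [Real.exp_eq_exp_ℝ]
  exact h

/-- The logarithm of a positive continuous function (zero for other functions). -/
def logC (U : CI) : CI :=
  open Classical in
  if h : ∀ z, 0 < U z then ⟨fun z => Real.log (U z), U.continuous.log fun z => (h z).ne'⟩ else 0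

theorem logC_apply {U : CI} (h : ∀ z, 0 < U z) (z : Icc (-1 : ℝ) 1) :
    logC U z = Real.log (U z) := by
  rw [logC, dif_pos h]; rfl

theorem exp_logC {U : CI} (h : ∀ z, 0 < U z) : NormedSpace.exp (logC U) = U := by
  ext z
  rw [exp_CI_apply, logC_apply h, Real.exp_log (h z)]

theorem contDiffAt_exp_CI (f : CI) : ContDiffAt ℝ ω (NormedSpace.exp : CI → CI) f :=
  (NormedSpace.exp_analytic (𝕂 := ℝ) f).contDiffAt

/-- The derivative of the Banach algebra exponential at log U is multiplication by U, a unit. The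
inverse function theorem thus gives an analytic local inverse, which has to be the pointwise
logarithm. -/
theorem contDiffAt_logC {U : CI} (h : ∀ z, 0 < U z) : ContDiffAt ℝ ω logC U := by
  have hu : IsUnit U := (ContinuousMap.isUnit_iff_forall_ne_zero U).2 fun z => (h z).ne'
  obtain ⟨v, hv⟩ := hu
  have hd : HasFDerivAt (NormedSpace.exp : CI → CI)
      ((ContinuousLinearEquiv.smulLeft v : CI ≃L[ℝ] CI) : CI →L[ℝ] CI) (logC U) := by
    refine (hasFDerivAt_exp (𝕂 := ℝ)).congr_fderiv ?_
    ext f z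
    rw [exp_logC h, ← hv]
    rfl
  have hn : (ω : WithTop ℕ∞) ≠ 0 := by simp
  have h1 := (contDiffAt_exp_CI (logC U)).to_localInverse hd hn
  rw [exp_logC h] at h1
  refine h1.congr_of_eventuallyEq ?_
  have h2 := ((contDiffAt_exp_CI (logC U)).hasStrictFDerivAt' hd hn).eventually_right_inverse
  rw [exp_logC h] at h2
  -- Near U, each y is the exponential of its image under the local inverse; this makes y positive
  -- and identifies that image with the logarithm.
  filter_upwards [h2] with y hy
  have hpos : ∀ z, 0 < y z := fun z => by
    rw [← hy, exp_CI_apply]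
    exact Real.exp_pos _
  ext z
  rw [logC_apply hpos]
  nth_rw 1 [← hy]
  rw [exp_CI_apply, Real.log_exp]
  rfl

theorem isUnit_CI {U : CI} (h : ∀ z, U z ≠ 0) : IsUnit U :=
  (ContinuousMap.isUnit_iff_forall_ne_zero U).2 h

theorem ringInverse_apply {U : CI} (h : ∀ z, U z ≠ 0) (z : Icc (-1 : ℝ) 1) :
    Ring.inverse U z = (U z)⁻¹ := by
  have := congrArg (fun f : CI => f z) (Ring.mul_inverse_cancel U (isUnit_CI h))
  simp only [ContinuousMap.mul_apply, ContinuousMap.one_apply] at this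
  exact eq_inv_of_mul_eq_one_right this

theorem contDiffAt_inverse_CI {U : CI} (h : ∀ z, U z ≠ 0) : ContDiffAt ℝ ω Ring.inverse U := by
  obtain ⟨v, hv⟩ := isUnit_CI h
  rw [← hv]
  exact contDiffAt_ringInverse ℝ v

/-- The continuous function `1 + σ² P²`. -/
def quadC (σ : ℝ) (P : CI) : CI := 1 + σ ^ 2 • (P * P)

theorem quadC_apply (σ : ℝ) (P : CI) (z : Icc (-1 : ℝ) 1) :
    quadC σ P z = 1 + σ ^ 2 * P z ^ 2 := by
  simp [quadC, pow_two]

theorem quadC_pos (σ : ℝ) (P : CI) (z : Icc (-1 : ℝ) 1) : 0 < quadC σ P z := by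
  rw [quadC_apply]; positivity

theorem contDiff_quadC (σ : ℝ) : ContDiff ℝ ω (quadC σ) :=
  contDiff_const.add ((contDiff_id.mul contDiff_id).const_smul _)

/-- `σ⁻² (1 + σ² P²) g_sar` as a function of the continuous functions `U = u + 1`, `P = ∂_z u`. -/
def forceC (σ : ℝ) (x : CI × CI) : CI :=
  -- The square root is written as exp(½ log) and log(2/U) as log 2 - log U, so that only algebra
  -- operations, inversion, exponential and logarithm occur.
  (σ ^ 2)⁻¹ • (quadC σ x.2 * NormedSpace.exp ((1 / 2 : ℝ) • logC (quadC σ x.2)) *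
    (Ring.inverse x.1 * Ring.inverse x.1) *
    (Ring.inverse (ContinuousMap.const _ (Real.log 2) - logC x.1) *
      Ring.inverse (ContinuousMap.const _ (Real.log 2) - logC x.1)))

/-- The second derivative `σ⁻² (1 + σ² P²) (1 / U - λ g_sar)` prescribed by the equation. -/
def rhsC (σ : ℝ) (x : ℝ × CI × CI) : CI :=
  (σ ^ 2)⁻¹ • (quadC σ x.2.2 * Ring.inverse x.2.1) - x.1 • forceC σ x.2

theorem log_two_sub_logC {U : CI} (h0 : ∀ z, 0 < U z) (z : Icc (-1 : ℝ) 1) :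
    (ContinuousMap.const _ (Real.log 2) - logC U : CI) z = Real.log (2 / U z) := by
  rw [ContinuousMap.sub_apply, logC_apply h0, ContinuousMap.const_apply,
    Real.log_div (by norm_num) (h0 z).ne']

theorem log_two_sub_logC_pos {U : CI} (h0 : ∀ z, 0 < U z) (h2 : ∀ z, U z < 2)
    (z : Icc (-1 : ℝ) 1) : 0 < (ContinuousMap.const _ (Real.log 2) - logC U : CI) z := by
  rw [log_two_sub_logC h0]
  exact Real.log_pos ((one_lt_div (h0 z)).2 (h2 z))

theorem forceC_apply {σ : ℝ} {U P : CI} (h0 : ∀ z, 0 < U z) (h2 : ∀ z, U z < 2)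
    (z : Icc (-1 : ℝ) 1) :
    forceC σ (U, P) z = (σ ^ 2)⁻¹ * ((1 + σ ^ 2 * P z ^ 2) * gSar σ (U z - 1) (P z)) := by
  simp only [forceC, ContinuousMap.smul_apply, ContinuousMap.mul_apply, smul_eq_mul]
  rw [ringInverse_apply fun z => (h0 z).ne',
    ringInverse_apply fun z => (log_two_sub_logC_pos h0 h2 z).ne', log_two_sub_logC h0,
    exp_CI_apply, ContinuousMap.smul_apply, logC_apply (quadC_pos σ P), smul_eq_mul,
    one_div_mul_eq_div, Real.exp_half, Real.exp_log (quadC_pos σ P z), quadC_apply, gSar]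
  rw [sub_add_cancel, one_div, mul_inv, pow_two (U z), pow_two (Real.log _), mul_inv, mul_inv]
  ring

theorem rhsC_apply {σ l : ℝ} {U P : CI} (h0 : ∀ z, 0 < U z) (h2 : ∀ z, U z < 2)
    (z : Icc (-1 : ℝ) 1) :
    rhsC σ (l, U, P) z = (σ ^ 2)⁻¹ * ((1 + σ ^ 2 * P z ^ 2) *
      (1 / U z - l * gSar σ (U z - 1) (P z))) := by
  simp only [rhsC, ContinuousMap.sub_apply, ContinuousMap.smul_apply, ContinuousMap.mul_apply,
    smul_eq_mul]
  rw [forceC_apply h0 h2, ringInverse_apply fun z => (h0 z).ne', quadC_apply]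
  ring

theorem contDiffAt_forceC (σ : ℝ) {x : CI × CI} (h0 : ∀ z, 0 < x.1 z) (h2 : ∀ z, x.1 z < 2) :
    ContDiffAt ℝ ω (forceC σ) x := by
  have hq : ContDiffAt ℝ ω (fun x : CI × CI => quadC σ x.2) x :=
    ((contDiff_quadC σ).comp contDiff_snd).contDiffAt
  have hlq : ContDiffAt ℝ ω (fun x : CI × CI => logC (quadC σ x.2)) x :=
    ContDiffAt.comp (g := logC) x (contDiffAt_logC (quadC_pos σ x.2)) hq
  have he : ContDiffAt ℝ ω
      (fun x : CI × CI => NormedSpace.exp ((1 / 2 : ℝ) • logC (quadC σ x.2))) x :=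
    ContDiffAt.comp (g := (NormedSpace.exp : CI → CI)) x (contDiffAt_exp_CI _) (hlq.const_smul _)
  have hi : ContDiffAt ℝ ω (fun x : CI × CI => Ring.inverse x.1) x :=
    ContDiffAt.comp (g := (Ring.inverse : CI → CI)) x
      (contDiffAt_inverse_CI fun z => (h0 z).ne') contDiffAt_fst
  have hl : ContDiffAt ℝ ω (fun x : CI × CI => ContinuousMap.const _ (Real.log 2) - logC x.1) x :=
    contDiffAt_const.sub (ContDiffAt.comp (g := logC) x (contDiffAt_logC h0) contDiffAt_fst)
  have hli : ContDiffAt ℝ ω (fun x : CI × CI =>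
      Ring.inverse (ContinuousMap.const _ (Real.log 2) - logC x.1)) x :=
    ContDiffAt.comp (g := (Ring.inverse : CI → CI)) x
      (contDiffAt_inverse_CI fun z => (log_two_sub_logC_pos h0 h2 z).ne') hl
  exact (((hq.mul he).mul (hi.mul hi)).mul (hli.mul hli)).const_smul _

theorem contDiffAt_rhsC (σ : ℝ) {x : ℝ × CI × CI} (h0 : ∀ z, 0 < x.2.1 z)
    (h2 : ∀ z, x.2.1 z < 2) : ContDiffAt ℝ ω (rhsC σ) x := by
  have hf : ContDiffAt ℝ ω (fun x : ℝ × CI × CI => forceC σ x.2) x :=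
    ContDiffAt.comp (g := forceC σ) x (contDiffAt_forceC σ h0 h2) contDiffAt_snd
  have hq : ContDiffAt ℝ ω (fun x : ℝ × CI × CI => quadC σ x.2.2) x :=
    ((contDiff_quadC σ).comp (contDiff_snd.comp contDiff_snd)).contDiffAt
  have hi : ContDiffAt ℝ ω (fun x : ℝ × CI × CI => Ring.inverse x.2.1) x :=
    ContDiffAt.comp (g := (Ring.inverse : CI → CI)) x
      (contDiffAt_inverse_CI fun z => (h0 z).ne') (contDiffAt_fst.comp x contDiffAt_snd)
  exact ((hq.mul hi).const_smul _).sub (contDiffAt_fst.smul hf)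

theorem exists_hasFDerivAt_rhsC {σ : ℝ} (hσ : σ ≠ 0) {U P : CI} (h0 : ∀ z, 0 < U z)
    (h2 : ∀ z, U z < 2) :
    ∃ L : ℝ × CI × CI →L[ℝ] CI, HasFDerivAt (rhsC σ) L (0, U, P) ∧
      ∀ (l : ℝ) (V Q : CI) (z : Icc (-1 : ℝ) 1), L (l, V, Q) z = 2 * P z / U z * Q z
        - (σ ^ 2)⁻¹ * (1 + σ ^ 2 * P z ^ 2) / U z ^ 2 * V z
        - l * ((σ ^ 2)⁻¹ * ((1 + σ ^ 2 * P z ^ 2) * gSar σ (U z - 1) (P z))) := by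
  set x : ℝ × CI × CI := (0, U, P)
  obtain ⟨v, hv⟩ := isUnit_CI fun z => (h0 z).ne'
  have hP : HasFDerivAt (fun x : ℝ × CI × CI => x.2.2)
    ((ContinuousLinearMap.snd ℝ CI CI).comp (ContinuousLinearMap.snd ℝ ℝ (CI × CI))) x :=
    ((ContinuousLinearMap.snd ℝ CI CI).comp (ContinuousLinearMap.snd ℝ ℝ (CI × CI))).hasFDerivAt
  have hU : HasFDerivAt (fun x : ℝ × CI × CI => x.2.1)
    ((ContinuousLinearMap.fst ℝ CI CI).comp (ContinuousLinearMap.snd ℝ ℝ (CI × CI))) x :=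
    ((ContinuousLinearMap.fst ℝ CI CI).comp (ContinuousLinearMap.snd ℝ ℝ (CI × CI))).hasFDerivAt
  have hl : HasFDerivAt (fun x : ℝ × CI × CI => x.1)
    (ContinuousLinearMap.fst ℝ ℝ (CI × CI)) x :=
    (ContinuousLinearMap.fst ℝ ℝ (CI × CI)).hasFDerivAt
  have hq : HasFDerivAt (fun x : ℝ × CI × CI => quadC σ x.2.2) _ x :=
    ((hP.mul hP).const_smul (σ ^ 2)).const_add 1
  have hinv : HasFDerivAt (𝕜 := ℝ) (Ring.inverse : CI → CI)
      (-ContinuousLinearMap.mulLeftRight ℝ CI ↑v⁻¹ ↑v⁻¹) ((fun x : ℝ × CI × CI => x.2.1) x) := by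
    have := hasFDerivAt_ringInverse (𝕜 := ℝ) v
    rw [hv] at this
    exact this
  have hi := hinv.comp x hU
  -- The derivative of the force need not be computed: it is multiplied by λ = 0, and only the value
  -- of the force survives.
  have hf : HasFDerivAt (fun x : ℝ × CI × CI => forceC σ x.2) _ x :=
    ((ContDiffAt.comp (g := forceC σ) x (contDiffAt_forceC σ h0 h2)
      contDiffAt_snd).differentiableAt (by simp)).hasFDerivAt
  have hvi : ∀ z, (↑v⁻¹ : CI) z = (U z)⁻¹ := fun z => by
    rw [← ringInverse_apply (fun z => (h0 z).ne') z, ← hv, Ring.inverse_unit]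
  refine ⟨_, ((hq.mul hi).const_smul (σ ^ 2)⁻¹).sub (hl.smul hf), fun l V Q z => ?_⟩
  have hfz := forceC_apply (σ := σ) (P := P) h0 h2 z
  have hri := ringInverse_apply (fun z => (h0 z).ne') z
  have hqz := quadC_apply σ P z
  have hne := (h0 z).ne'
  simp [x, hvi, hfz, hri, hqz]
  field_simp
  ring

end Nemytskii

/-! ### The even homogeneous solution and its zero c_crit -/

section Critical

theorem cCrit_pos : 0 < cCrit := existsUnique_cCrit.choose_spec.1.1

theorem cCrit_eq : cCrit * Real.sinh cCrit - Real.cosh cCrit = 0 :=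
  existsUnique_cCrit.choose_spec.1.2

/-- The even solution `x sinh x - cosh x` of `v'' - 2 tanh(x) v' + v = 0`. -/
def yEven (x : ℝ) : ℝ := x * Real.sinh x - Real.cosh x

theorem hasDerivAt_yEven (x : ℝ) : HasDerivAt yEven (x * Real.cosh x) x := by
  have h := ((hasDerivAt_id' x).mul (Real.hasDerivAt_sinh x)).sub (Real.hasDerivAt_cosh x)
  exact h.congr_deriv (by ring)

theorem continuous_yEven : Continuous yEven := by unfold yEven; fun_prop

theorem strictMonoOn_yEven : StrictMonoOn yEven (Ici 0) := by
  apply strictMonoOn_of_deriv_pos (convex_Ici 0) continuous_yEven.continuousOn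
  intro x hx
  rw [interior_Ici] at hx
  rw [(hasDerivAt_yEven x).deriv]
  exact mul_pos hx (Real.cosh_pos x)

theorem yEven_cCrit : yEven cCrit = 0 := cCrit_eq

theorem yEven_neg (x : ℝ) : yEven (-x) = yEven x := by
  simp [yEven]

theorem yEven_pos {x : ℝ} (hx : cCrit < x) : 0 < yEven x := by
  rw [← yEven_cCrit]
  exact strictMonoOn_yEven cCrit_pos.le (cCrit_pos.le.trans hx.le) hx

theorem yEven_lt_zero {x : ℝ} (h0 : 0 ≤ x) (hx : x < cCrit) : yEven x < 0 := by
  rw [← yEven_cCrit]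
  exact strictMonoOn_yEven h0 cCrit_pos.le hx

end Critical

/-! ### Invertibility of the linearized Dirichlet problem -/

section BoundaryValueProblem

theorem eq_of_hasDerivWithinAt_zero {g : ℝ → ℝ}
    (h : ∀ z ∈ Icc (-1 : ℝ) 1, HasDerivWithinAt g 0 (Icc (-1) 1) z) {x y : ℝ}
    (hx : x ∈ Icc (-1 : ℝ) 1) (hy : y ∈ Icc (-1 : ℝ) 1) : g x = g y := by
  have := (convex_Icc (-1 : ℝ) 1).norm_image_sub_le_of_norm_hasDerivWithin_le (C := 0) h
    (fun z _ => by simp) hx hy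
  rw [zero_mul, norm_le_zero_iff, sub_eq_zero] at this
  exact this.symm

theorem hasDerivWithinAt_slope (f : CI) {z : ℝ} (hz : z ∈ Icc (-1 : ℝ) 1) :
    HasDerivWithinAt (ext (slope f)) (ext f z) (Icc (-1) 1) z := by
  have : ext (slope f) = fun z => ext (prim f) z - prim (prim f) rightEnd / 2 := by
    funext z
    rw [slope, ContinuousLinearMap.comp_apply, subMean_eq, ext_sub_const]
  rw [this]
  exact (hasDerivWithinAt_prim f hz).sub_const _

theorem hasDerivWithinAt_sol (f : CI) {z : ℝ} (hz : z ∈ Icc (-1 : ℝ) 1) :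
    HasDerivWithinAt (ext (sol f)) (ext (slope f) z) (Icc (-1) 1) z :=
  hasDerivWithinAt_prim (slope f) hz

theorem ext_sol_left (f : CI) : ext (sol f) (-1) = 0 := by
  rw [ext_apply _ (by norm_num)]; exact sol_leftEnd f

theorem ext_sol_right (f : CI) : ext (sol f) 1 = 0 := by
  rw [ext_apply _ (by norm_num)]; exact sol_rightEnd f

theorem one_mem_I : (1 : ℝ) ∈ Icc (-1 : ℝ) 1 := by norm_num

theorem neg_one_mem_I : (-1 : ℝ) ∈ Icc (-1 : ℝ) 1 := by norm_num

theorem zero_mem_I : (0 : ℝ) ∈ Icc (-1 : ℝ) 1 := by norm_num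

/-- The slopes differ by a constant, so the values differ by an affine function, which vanishes at
both ends. This identifies explicit functions as `slope f` and `sol f`. -/
theorem slope_sol_unique {f : CI} {w s : ℝ → ℝ}
    (hw : ∀ z ∈ Icc (-1 : ℝ) 1, HasDerivWithinAt w (s z) (Icc (-1) 1) z)
    (hs : ∀ z ∈ Icc (-1 : ℝ) 1, HasDerivWithinAt s (ext f z) (Icc (-1) 1) z)
    (hl : w (-1) = 0) (hr : w 1 = 0) :
    EqOn (ext (slope f)) s (Icc (-1) 1) ∧ EqOn (ext (sol f)) w (Icc (-1) 1) := by
  set a := ext (slope f) 0 - s 0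
  have h1 : ∀ z ∈ Icc (-1 : ℝ) 1, ext (slope f) z - s z = a := fun z hz =>
    eq_of_hasDerivWithinAt_zero (g := fun z => ext (slope f) z - s z) (fun z hz =>
      ((hasDerivWithinAt_slope f hz).sub (hs z hz)).congr_deriv (sub_self _)) hz zero_mem_I
  have h2 : ∀ z ∈ Icc (-1 : ℝ) 1, ext (sol f) z - w z - a * z = ext (sol f) 1 - w 1 - a * 1 :=
    fun z hz => eq_of_hasDerivWithinAt_zero (g := fun z => ext (sol f) z - w z - a * z)
      (fun z hz => (((hasDerivWithinAt_sol f hz).sub (hw z hz)).sub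
        ((hasDerivWithinAt_id z _).const_mul a)).congr_deriv (by rw [h1 z hz]; ring)) hz one_mem_I
  have h3 := h2 (-1) neg_one_mem_I
  rw [ext_sol_left, ext_sol_right, hl, hr] at h3
  have ha : a = 0 := by linarith
  refine ⟨fun z hz => ?_, fun z hz => ?_⟩
  · have := h1 z hz
    linarith
  · have := h2 z hz
    rw [ext_sol_right, hr, ha] at this
    linarith

/-- The function `tanh (c z)`. -/
def tanhC (c : ℝ) : CI :=
  ⟨fun z => Real.sinh (c * z) / Real.cosh (c * z),
    (Real.continuous_sinh.comp (by fun_prop)).div (Real.continuous_cosh.comp (by fun_prop))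
      fun _ => (Real.cosh_pos _).ne'⟩

/-- The linearized operator `w'' - 2 c tanh(c z) w' + c² w`, in terms of `f = w''`. -/
def linOp (c : ℝ) : CI →L[ℝ] CI :=
  ContinuousLinearMap.id ℝ CI
    - (2 * c) • (ContinuousLinearMap.mul ℝ CI (tanhC c)).comp slope + c ^ 2 • sol

theorem linOp_apply (c : ℝ) (f : CI) (z : Icc (-1 : ℝ) 1) :
    linOp c f z = f z - 2 * c * (Real.sinh (c * z) / Real.cosh (c * z)) * slope f z
      + c ^ 2 * sol f z := by
  simp [linOp, tanhC]
  ring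

theorem ext_linOp (c : ℝ) (f : CI) {z : ℝ} (hz : z ∈ Icc (-1 : ℝ) 1) :
    ext (linOp c f) z = ext f z - 2 * c * (Real.sinh (c * z) / Real.cosh (c * z)) * ext (slope f) z
      + c ^ 2 * ext (sol f) z := by
  simp only [ext_apply _ hz, linOp_apply]

theorem hasDerivAt_sinh_mul (c z : ℝ) :
    HasDerivAt (fun z => Real.sinh (c * z)) (c * Real.cosh (c * z)) z :=
  (((hasDerivAt_id' z).const_mul c).sinh).congr_deriv (by ring)

theorem hasDerivAt_cosh_mul (c z : ℝ) :
    HasDerivAt (fun z => Real.cosh (c * z)) (c * Real.sinh (c * z)) z :=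
  (((hasDerivAt_id' z).const_mul c).cosh).congr_deriv (by ring)

theorem hasDerivAt_yEven_mul (c z : ℝ) :
    HasDerivAt (fun z => yEven (c * z)) (c * (c * z * Real.cosh (c * z))) z := by
  have := (hasDerivAt_yEven (c * z)).comp z ((hasDerivAt_id' z).const_mul c)
  exact this.congr_deriv (by ring)

/-- Lagrange's identity for the odd solution `sinh (c z)`. -/
theorem hasDerivWithinAt_lagrange_odd (c : ℝ) (f : CI) {z : ℝ} (hz : z ∈ Icc (-1 : ℝ) 1) :
    HasDerivWithinAt (fun z => (ext (slope f) z * Real.sinh (c * z)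
        - ext (sol f) z * (c * Real.cosh (c * z))) / Real.cosh (c * z) ^ 2)
      (ext (linOp c f) z * Real.sinh (c * z) / Real.cosh (c * z) ^ 2) (Icc (-1) 1) z := by
  have hC := (Real.cosh_pos (c * z)).ne'
  -- The weight 1/cosh² is the integrating factor for -2c tanh(cz) w'. The terms without the
  -- operator cancel because sinh(cz) solves the homogeneous equation.
  refine ((((hasDerivWithinAt_slope f hz).mul (hasDerivAt_sinh_mul c z).hasDerivWithinAt).sub
    ((hasDerivWithinAt_sol f hz).mul
      ((hasDerivAt_cosh_mul c z).const_mul c).hasDerivWithinAt)).div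
    ((hasDerivAt_cosh_mul c z).pow 2).hasDerivWithinAt (pow_ne_zero 2 hC)).congr_deriv ?_
  rw [ext_linOp c f hz]
  simp only [Pi.mul_apply, Pi.sub_apply, Pi.pow_apply]
  field_simp
  ring

/-- Lagrange's identity for the even solution `yEven (c z)`. -/
theorem hasDerivWithinAt_lagrange_even (c : ℝ) (f : CI) {z : ℝ} (hz : z ∈ Icc (-1 : ℝ) 1) :
    HasDerivWithinAt (fun z => (ext (slope f) z * yEven (c * z)
        - ext (sol f) z * (c * (c * z * Real.cosh (c * z)))) / Real.cosh (c * z) ^ 2)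
      (ext (linOp c f) z * yEven (c * z) / Real.cosh (c * z) ^ 2) (Icc (-1) 1) z := by
  have hC := (Real.cosh_pos (c * z)).ne'
  have hd : HasDerivAt (fun z => c * (c * z * Real.cosh (c * z)))
      (c * (c * Real.cosh (c * z) + c * z * (c * Real.sinh (c * z)))) z :=
    ((((hasDerivAt_id' z).const_mul c).mul (hasDerivAt_cosh_mul c z)).const_mul c).congr_deriv
      (by ring)
  refine ((((hasDerivWithinAt_slope f hz).mul (hasDerivAt_yEven_mul c z).hasDerivWithinAt).sub
    ((hasDerivWithinAt_sol f hz).mul hd.hasDerivWithinAt)).div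
    ((hasDerivAt_cosh_mul c z).pow 2).hasDerivWithinAt (pow_ne_zero 2 hC)).congr_deriv ?_
  rw [ext_linOp c f hz]
  simp only [Pi.mul_apply, Pi.sub_apply, Pi.pow_apply, yEven]
  field_simp
  ring

variable {c : ℝ}

/-- For a homogeneous solution both Lagrange brackets are constant. Comparing them at ±1, one with
an odd and one with an even comparison function, forces the boundary slopes to vanish, so both
brackets are zero everywhere. They form a linear system for (w', w) with Wronskian determinant -c
cosh²(cz) up to sign, hence w = 0. -/
theorem linOp_injective (hc : cCrit < c) : Function.Injective (linOp c) := by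
  rw [injective_iff_map_eq_zero]
  intro f hf
  have hc0 : 0 < c := cCrit_pos.trans hc
  have hz0 : ∀ z, ext (linOp c f) z = 0 := fun z => by rw [hf]; rfl
  have ho : ∀ x ∈ Icc (-1 : ℝ) 1, _ := fun x hx => eq_of_hasDerivWithinAt_zero (fun z hz =>
    (hasDerivWithinAt_lagrange_odd c f hz).congr_deriv (by rw [hz0]; ring)) hx one_mem_I
  have he : ∀ x ∈ Icc (-1 : ℝ) 1, _ := fun x hx => eq_of_hasDerivWithinAt_zero (fun z hz =>
    (hasDerivWithinAt_lagrange_even c f hz).congr_deriv (by rw [hz0]; ring)) hx one_mem_I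
  have ho1 := ho (-1) neg_one_mem_I
  have he1 := he (-1) neg_one_mem_I
  have hS : 0 < Real.sinh c := Real.sinh_pos_iff.2 hc0
  have hY : 0 < yEven c := yEven_pos hc
  have hC := Real.cosh_pos c
  simp only [ext_sol_left, ext_sol_right, zero_mul, sub_zero, mul_one, mul_neg, Real.sinh_neg,
    Real.cosh_neg, yEven_neg] at ho1 he1
  rw [div_left_inj' (pow_ne_zero 2 hC.ne')] at ho1 he1
  have e1 : ext (slope f) (-1) = ext (slope f) 1 := mul_right_cancel₀ hY.ne' he1
  have e2 : ext (slope f) 1 = 0 := by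
    rw [e1] at ho1
    have : ext (slope f) 1 * Real.sinh c = 0 := by linarith
    exact (mul_eq_zero.1 this).resolve_right hS.ne'
  have hw : ∀ z ∈ Icc (-1 : ℝ) 1, ext (slope f) z = 0 ∧ ext (sol f) z = 0 := by
    intro z hz
    have h1 := ho z hz
    have h2 := he z hz
    have hCz := Real.cosh_pos (c * z)
    simp only [ext_sol_right, e2, zero_mul, sub_zero, zero_div] at h1 h2
    rw [div_eq_zero_iff, or_iff_left (pow_ne_zero 2 hCz.ne')] at h1 h2
    have hsq := Real.cosh_sq (c * z)
    set X := ext (slope f) z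
    set Y := ext (sol f) z
    unfold yEven at h2
    -- Elimination of w' from the two brackets leaves the Wronskian times w.
    have hY0 : Y * (c * Real.cosh (c * z) ^ 2) = 0 := by
      linear_combination -Real.sinh (c * z) * h2 +
        (c * z * Real.sinh (c * z) - Real.cosh (c * z)) * h1
    have hY1 : Y = 0 := (mul_eq_zero.1 hY0).resolve_right (by positivity)
    rw [hY1] at h1 h2
    refine ⟨?_, hY1⟩
    have : X * Real.cosh (c * z) = 0 := by linear_combination -h2 + c * z * h1
    exact (mul_eq_zero.1 this).resolve_right hCz.ne'
  apply ext_injective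
  intro z hz
  have := ext_linOp c f hz
  rw [hz0, (hw z hz).1, (hw z hz).2] at this
  have h0 : ext (0 : CI) z = 0 := rfl
  rw [h0]
  linarith

/-- Variation of constants with y(cz) and sinh(cz), whose Wronskian is -c cosh²(cz). -/
theorem linOp_surjective (hc : cCrit < c) : Function.Surjective (linOp c) := by
  intro k
  have hc0 : 0 < c := cCrit_pos.trans hc
  have hS : 0 < Real.sinh c := Real.sinh_pos_iff.2 hc0
  have hY : 0 < yEven c := yEven_pos hc
  have hco : ContinuousOn (fun z => ext k z * Real.sinh (c * z) / (c * Real.cosh (c * z) ^ 2))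
      (Icc (-1) 1) := by
    have := continuous_ext k
    refine ContinuousOn.div (by fun_prop) (by fun_prop) fun z _ => ?_
    have := Real.cosh_pos (c * z)
    positivity
  have hce : ContinuousOn (fun z => -(ext k z * yEven (c * z) / (c * Real.cosh (c * z) ^ 2)))
      (Icc (-1) 1) := by
    have := continuous_ext k
    have := continuous_yEven
    refine (ContinuousOn.div (by fun_prop) (by fun_prop) fun z _ => ?_).neg
    have := Real.cosh_pos (c * z)
    positivity
  set α := ext (prim (restr _ hco))
  set β := ext (prim (restr _ hce))
  -- Since y is even and sinh is odd, adding and subtracting the boundary conditions decouples a and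
  -- b; the divisors are y(c) and sinh c, both positive.
  obtain ⟨a, b, hl, hr⟩ : ∃ a b : ℝ,
      (a + α (-1)) * yEven c - (b + β (-1)) * Real.sinh c = 0 ∧
      (a + α 1) * yEven c + (b + β 1) * Real.sinh c = 0 := by
    refine ⟨-(α 1 * yEven c + β 1 * Real.sinh c + α (-1) * yEven c - β (-1) * Real.sinh c)
      / (2 * yEven c), -(α 1 * yEven c + β 1 * Real.sinh c - α (-1) * yEven c
        + β (-1) * Real.sinh c) / (2 * Real.sinh c), ?_, ?_⟩
    · field_simp; ring
    · field_simp; ring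
  have hα : ∀ z ∈ Icc (-1 : ℝ) 1, HasDerivWithinAt α
      (ext k z * Real.sinh (c * z) / (c * Real.cosh (c * z) ^ 2)) (Icc (-1) 1) z := fun z hz => by
    have := hasDerivWithinAt_prim (restr _ hco) hz
    rwa [ext_restr hco hz] at this
  have hβ : ∀ z ∈ Icc (-1 : ℝ) 1, HasDerivWithinAt β
      (-(ext k z * yEven (c * z) / (c * Real.cosh (c * z) ^ 2))) (Icc (-1) 1) z := fun z hz => by
    have := hasDerivWithinAt_prim (restr _ hce) hz
    rwa [ext_restr hce hz] at this
  let w : ℝ → ℝ := fun z => (a + α z) * yEven (c * z) + (b + β z) * Real.sinh (c * z)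
  let s : ℝ → ℝ := fun z => (a + α z) * (c * (c * z * Real.cosh (c * z)))
    + (b + β z) * (c * Real.cosh (c * z))
  have hαc : Continuous α := continuous_ext _
  have hβc : Continuous β := continuous_ext _
  have hyc := continuous_yEven
  have hwc : Continuous w := by fun_prop
  have hsc : Continuous s := by fun_prop
  have hfc : ContinuousOn (fun z => ext k z + 2 * c * (Real.sinh (c * z) / Real.cosh (c * z)) * s z
      - c ^ 2 * w z) (Icc (-1) 1) := by
    have := continuous_ext k
    have h2 : Continuous fun z : ℝ => Real.sinh (c * z) / Real.cosh (c * z) :=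
      (by fun_prop : Continuous fun z : ℝ => Real.sinh (c * z)).div (by fun_prop)
        fun z => (Real.cosh_pos _).ne'
    fun_prop
  have hw : ∀ z ∈ Icc (-1 : ℝ) 1, HasDerivWithinAt w (s z) (Icc (-1) 1) z := fun z hz => by
    have hC := (Real.cosh_pos (c * z)).ne'
    refine ((((hα z hz).const_add a).mul (hasDerivAt_yEven_mul c z).hasDerivWithinAt).add
      (((hβ z hz).const_add b).mul (hasDerivAt_sinh_mul c z).hasDerivWithinAt)).congr_deriv ?_
    simp only [s]
    ring
  have hs : ∀ z ∈ Icc (-1 : ℝ) 1, HasDerivWithinAt s (ext (restr _ hfc) z) (Icc (-1) 1) z :=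
    fun z hz => by
    have hC := (Real.cosh_pos (c * z)).ne'
    have hd : HasDerivAt (fun z => c * (c * z * Real.cosh (c * z)))
        (c * (c * Real.cosh (c * z) + c * z * (c * Real.sinh (c * z)))) z :=
      ((((hasDerivAt_id' z).const_mul c).mul (hasDerivAt_cosh_mul c z)).const_mul c).congr_deriv
        (by ring)
    refine ((((hα z hz).const_add a).mul hd.hasDerivWithinAt).add
      (((hβ z hz).const_add b).mul
        ((hasDerivAt_cosh_mul c z).const_mul c).hasDerivWithinAt)).congr_deriv ?_
    rw [ext_restr hfc hz]
    have hsq := Real.cosh_sq (c * z)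
    simp only [s, w, yEven]
    field_simp
    ring
  have hw1 : w (-1) = 0 := by
    simp only [w, mul_neg, mul_one, yEven_neg, Real.sinh_neg]
    linarith
  have hw2 : w 1 = 0 := by
    simp only [w, mul_one]
    linarith
  obtain ⟨h1, h2⟩ := slope_sol_unique hw hs hw1 hw2
  refine ⟨restr _ hfc, ext_injective fun z hz => ?_⟩
  rw [ext_linOp _ _ hz, h1 hz, h2 hz, ext_restr hfc hz]
  ring

/-- The linearized operator as an isomorphism. -/
def linEquiv (hc : cCrit < c) : CI ≃L[ℝ] CI :=
  ContinuousLinearEquiv.ofBijective (linOp c) (LinearMap.ker_eq_bot.2 (linOp_injective hc))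
    (LinearMap.range_eq_top.2 (linOp_surjective hc))

theorem coe_linEquiv (hc : cCrit < c) : (linEquiv hc : CI →L[ℝ] CI) = linOp c :=
  ContinuousLinearEquiv.coe_ofBijective _ _ _

/-- Solutions with an even right hand side are even. -/
theorem sol_even (hc : cCrit < c) {f : CI}
    (hk : ∀ z ∈ Icc (-1 : ℝ) 1, ext (linOp c f) (-z) = ext (linOp c f) z) {z : ℝ}
    (hz : z ∈ Icc (-1 : ℝ) 1) :
    ext (sol f) (-z) = ext (sol f) z ∧ ext (slope f) (-z) = -ext (slope f) z := by
  have hneg : ∀ {z : ℝ}, z ∈ Icc (-1 : ℝ) 1 → -z ∈ Icc (-1 : ℝ) 1 := fun h =>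
    ⟨neg_le_neg h.2, neg_le.1 (by linarith [h.1])⟩
  have hfc : ContinuousOn (fun z => ext f (-z)) (Icc (-1) 1) :=
    ((continuous_ext f).comp continuous_neg).continuousOn
  have hnd : ∀ z : ℝ, HasDerivWithinAt (fun z : ℝ => -z) (-1) (Icc (-1) 1) z := fun z =>
    (hasDerivAt_neg z).hasDerivWithinAt
  obtain ⟨h1, h2⟩ := slope_sol_unique (f := restr _ hfc) (w := fun z => ext (sol f) (-z))
    (s := fun z => -ext (slope f) (-z))
    (fun z hz => ((hasDerivWithinAt_sol f (hneg hz)).scomp z (hnd z)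
      fun x hx => hneg hx).congr_deriv (by simp))
    (fun z hz => ((hasDerivWithinAt_slope f (hneg hz)).scomp z (hnd z)
      fun x hx => hneg hx).neg.congr_deriv (by rw [ext_restr hfc hz]; simp))
    (by simpa using ext_sol_right f) (by simpa using ext_sol_left f)
  -- The reflected function solves the same boundary value problem, so injectivity identifies it
  -- with the original.
  have h3 : restr _ hfc = f := by
    apply linOp_injective hc
    apply ext_injective
    intro z hz
    rw [ext_linOp _ _ hz, h1 hz, h2 hz, ← hk z hz, ext_linOp _ _ (hneg hz), ext_restr hfc hz]
    simp only [mul_neg, Real.sinh_neg, Real.cosh_neg]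
    ring
  rw [h3] at h1 h2
  refine ⟨(h2 hz).symm, ?_⟩
  rw [h1 hz, neg_neg]

end BoundaryValueProblem

/-! ### The inner catenoid and the linearization there -/

section Catenoid

/-- The inner catenoid, shifted by one: `cosh (c z) / cosh c`. -/
def catVal (c : ℝ) : CI := ⟨fun z => Real.cosh (c * z) / Real.cosh c, by fun_prop⟩

/-- The derivative of the inner catenoid. -/
def catSlope (c : ℝ) : CI := ⟨fun z => c * Real.sinh (c * z) / Real.cosh c, by fun_prop⟩

/-- The second derivative of the inner catenoid. -/
def catSnd (c : ℝ) : CI := ⟨fun z => c ^ 2 * Real.cosh (c * z) / Real.cosh c, by fun_prop⟩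

theorem catVal_apply (c : ℝ) (z : Icc (-1 : ℝ) 1) :
    catVal c z = Real.cosh (c * z) / Real.cosh c := rfl

theorem catSlope_apply (c : ℝ) (z : Icc (-1 : ℝ) 1) :
    catSlope c z = c * Real.sinh (c * z) / Real.cosh c := rfl

theorem catSnd_apply (c : ℝ) (z : Icc (-1 : ℝ) 1) :
    catSnd c z = c ^ 2 * Real.cosh (c * z) / Real.cosh c := rfl

theorem catVal_le_one {c : ℝ} (z : Icc (-1 : ℝ) 1) : catVal c z ≤ 1 := by
  rw [catVal_apply, div_le_one (Real.cosh_pos _), Real.cosh_le_cosh, abs_mul]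
  exact mul_le_of_le_one_right (abs_nonneg _) (abs_le.2 z.2)

theorem le_catVal {c : ℝ} (z : Icc (-1 : ℝ) 1) : (Real.cosh c)⁻¹ ≤ catVal c z := by
  rw [catVal_apply, inv_eq_one_div]
  gcongr
  exact Real.one_le_cosh _

theorem catVal_pos {c : ℝ} (z : Icc (-1 : ℝ) 1) : 0 < catVal c z :=
  (inv_pos.2 (Real.cosh_pos c)).trans_le (le_catVal z)

theorem catVal_lt_two {c : ℝ} (z : Icc (-1 : ℝ) 1) : catVal c z < 2 :=
  (catVal_le_one z).trans_lt one_lt_two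

theorem slope_sol_catSnd (c : ℝ) : slope (catSnd c) = catSlope c ∧ 1 + sol (catSnd c) = catVal c := by
  have hcp := Real.cosh_pos c
  obtain ⟨h1, h2⟩ := slope_sol_unique (f := catSnd c)
    (w := fun z => Real.cosh (c * z) / Real.cosh c - 1)
    (s := fun z => c * Real.sinh (c * z) / Real.cosh c)
    (fun z hz => (((hasDerivAt_cosh_mul c z).div_const _).sub_const _).hasDerivWithinAt)
    (fun z hz => ((((hasDerivAt_sinh_mul c z).const_mul c).div_const _).congr_deriv (by
      rw [ext_apply _ hz, catSnd_apply]; ring)).hasDerivWithinAt)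
    (by simp [hcp.ne']) (by simp [hcp.ne'])
  constructor
  · ext z
    rw [← ext_coe, h1 z.2]; rfl
  · ext z
    rw [ContinuousMap.add_apply, ← ext_coe (sol _), h2 z.2, catVal_apply, ContinuousMap.one_apply]
    ring

/-- The right hand side `c² cosh(c z) / ln²(2 cosh c / cosh (c z))` of the linearized problem. -/
def source (c : ℝ) (z : ℝ) : ℝ :=
  c ^ 2 * Real.cosh (c * z) / Real.log (2 * Real.cosh c / Real.cosh (c * z)) ^ 2

variable {σ c : ℝ}

/-- With σ = cosh c / c, the factor 1 + σ² (∂_z u)² collapses to cosh²(cz), which removes the square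
root. -/
theorem force_catenoid (hc : 0 < c) (hσ : σ = Real.cosh c / c) (z : Icc (-1 : ℝ) 1) :
    (σ ^ 2)⁻¹ * ((1 + σ ^ 2 * catSlope c z ^ 2) * gSar σ (catVal c z - 1) (catSlope c z))
      = source c z := by
  have hcp := Real.cosh_pos c
  have hCp := Real.cosh_pos (c * z)
  have hsq := Real.cosh_sq (c * z)
  have h1 : 1 + σ ^ 2 * catSlope c z ^ 2 = Real.cosh (c * z) ^ 2 := by
    rw [hσ, catSlope_apply, hsq]
    field_simp
    ring
  rw [gSar, h1, Real.sqrt_sq hCp.le, sub_add_cancel, catVal_apply, source, hσ]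
  have h2 : 2 / (Real.cosh (c * z) / Real.cosh c) = 2 * Real.cosh c / Real.cosh (c * z) := by
    field_simp
  rw [h2]
  rcases eq_or_ne (Real.log (2 * Real.cosh c / Real.cosh (c * z))) 0 with h0 | h0
  · simp [h0]
  · field_simp

theorem rhsC_catenoid (hc : 0 < c) (hσ : σ = Real.cosh c / c) :
    rhsC σ (0, catVal c, catSlope c) = catSnd c := by
  have hcp := Real.cosh_pos c
  ext z
  have hCp := Real.cosh_pos (c * z)
  have hsq := Real.cosh_sq (c * z)
  rw [rhsC_apply catVal_pos catVal_lt_two, catSnd_apply, catVal_apply, catSlope_apply, hσ,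
    zero_mul, sub_zero]
  have h1 : 1 + (Real.cosh c / c) ^ 2 * (c * Real.sinh (c * z) / Real.cosh c) ^ 2
      = Real.cosh (c * z) ^ 2 := by
    rw [hsq]
    field_simp
    ring
  rw [h1]
  field_simp

theorem exists_hasFDerivAt_rhsC_catenoid (hc : 0 < c) (hσ : σ = Real.cosh c / c) :
    ∃ L : ℝ × CI × CI →L[ℝ] CI, HasFDerivAt (rhsC σ) L (0, catVal c, catSlope c) ∧
      ∀ (l : ℝ) (V Q : CI) (z : Icc (-1 : ℝ) 1), L (l, V, Q) z =
        2 * c * (Real.sinh (c * z) / Real.cosh (c * z)) * Q z - c ^ 2 * V z - l * source c z := by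
  have hcp := Real.cosh_pos c
  have hσ0 : σ ≠ 0 := by rw [hσ]; positivity
  obtain ⟨L, hL, h⟩ := exists_hasFDerivAt_rhsC hσ0 (catVal_pos (c := c)) catVal_lt_two
    (P := catSlope c)
  refine ⟨L, hL, fun l V Q z => ?_⟩
  have hCp := Real.cosh_pos (c * z)
  have hsq := Real.cosh_sq (c * z)
  rw [h, force_catenoid hc hσ, catSlope_apply, catVal_apply, hσ]
  have h1 : 1 + (Real.cosh c / c) ^ 2 * (c * Real.sinh (c * z) / Real.cosh c) ^ 2
      = Real.cosh (c * z) ^ 2 := by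
    rw [hsq]
    field_simp
    ring
  rw [h1]
  field_simp

end Catenoid

/-! ### Weak solutions and the equation for the second derivative -/

section WeakSolutions

variable {q : ℝ≥0∞} [Fact (1 ≤ q)]

theorem ae_muI_of_forall {p : ℝ → Prop} (h : ∀ z ∈ Ioo (-1 : ℝ) 1, p z) : ∀ᵐ z ∂μI, p z :=
  (ae_restrict_iff' measurableSet_Ioo).2 (ae_of_all _ h)

theorem isWeakDeriv_of_hasDerivWithinAt {g : ℝ → ℝ} {k : CI}
    (h : ∀ z ∈ Icc (-1 : ℝ) 1, HasDerivWithinAt g (ext k z) (Icc (-1) 1) z) :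
    IsWeakDeriv g (ext k) := by
  refine (isWeakDeriv_prim k (g 1 - ext (prim k) 1)).congr (ae_muI_of_forall fun z hz => ?_)
    (ae_eq_refl _)
  have := eq_of_hasDerivWithinAt_zero (g := fun z => g z - ext (prim k) z) (fun z hz =>
    ((h z hz).sub (hasDerivWithinAt_prim k hz)).congr_deriv (sub_self _))
    (Ioo_subset_Icc_self hz) one_mem_I
  simp only at this ⊢
  linarith

theorem hasDerivWithinAt_of_isWeakDeriv {g : ℝ → ℝ} {k : CI} (hg : ContinuousOn g (Icc (-1) 1))
    (h : IsWeakDeriv g (ext k)) {z : ℝ} (hz : z ∈ Icc (-1 : ℝ) 1) :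
    HasDerivWithinAt g (ext k z) (Icc (-1) 1) z := by
  obtain ⟨C, hC⟩ := h.exists_ae_eq_primitive
  have h1 : EqOn g (fun z => C + ext (prim k) z) (Icc (-1) 1) := by
    refine eqOn_Icc_of_ae_eq hg (continuous_const.add (continuous_ext _)).continuousOn
      (hC.trans (ae_muI_of_forall fun z hz => ?_))
    simp only [ext_prim (Ioo_subset_Icc_self hz)]
  exact ((hasDerivWithinAt_prim k hz).const_add C).congr h1 (h1 hz)

/-- The right hand side of the equation as a continuous function. -/
theorem exists_rhs_continuous (σ l : ℝ) {U P : CI} (h0 : ∀ z, 0 < U z) (h2 : ∀ z, U z < 2) :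
    ∃ k : CI, ∀ z, k z = -(1 / U z) + l * gSar σ (U z - 1) (P z) := by
  have hlog : ∀ z, Real.log (2 / U z) ≠ 0 := fun z =>
    (Real.log_pos ((one_lt_div (h0 z)).2 (h2 z))).ne'
  have hUc : Continuous U := U.continuous
  have hPc : Continuous P := P.continuous
  refine ⟨⟨fun z => -(1 / U z) + l * gSar σ (U z - 1) (P z), ?_⟩, fun z => rfl⟩
  have hd : Continuous fun z => 2 / U z := continuous_const.div hUc fun z => (h0 z).ne'
  have hl : Continuous fun z => Real.log (2 / U z) :=
    hd.log fun z => (div_pos two_pos (h0 z)).ne'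
  have h1 : Continuous fun z => 1 / U z := continuous_const.div hUc fun z => (h0 z).ne'
  have hg : Continuous fun z => gSar σ (U z - 1) (P z) := by
    simp only [gSar, sub_add_cancel]
    refine Continuous.mul (by fun_prop) (continuous_const.div (by fun_prop) fun z => ?_)
    exact mul_ne_zero (pow_ne_zero _ (h0 z).ne') (pow_ne_zero _ (hlog z))
  fun_prop

/-- The derivative of arctan(σ u') is σ u'' / (1 + σ² u'²), so the fixed point equation for f = u''
is the classical form of the model. -/
theorem isSolution_ofSnd {σ l : ℝ} (hσ : σ ≠ 0) {f : CI} (h0 : ∀ z, 0 < (1 + sol f) z)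
    (h2 : ∀ z, (1 + sol f) z < 2) (hf : f = rhsC σ (l, 1 + sol f, slope f)) :
    IsSolution σ l (ofSnd q f) := by
  have hrep : ∀ z (hz : z ∈ Icc (-1 : ℝ) 1), rep (ofSnd q f) z = (1 + sol f) ⟨z, hz⟩ - 1 := by
    intro z hz
    rw [rep_eqOn _ hz, embVal_ofSnd, ext_apply _ hz, ContinuousMap.add_apply,
      ContinuousMap.one_apply]
    ring
  refine ⟨fun z hz => ?_, ?_⟩
  · rw [hrep z (Ioo_subset_Icc_self hz)]
    constructor
    · linarith [h0 ⟨z, Ioo_subset_Icc_self hz⟩]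
    · linarith [h2 ⟨z, Ioo_subset_Icc_self hz⟩]
  · obtain ⟨k, hk⟩ := exists_rhs_continuous σ l (P := slope f) h0 h2
    have h := isWeakDeriv_of_hasDerivWithinAt (g := fun z => -σ * Real.arctan (σ * ext (slope f) z))
      (k := k) (fun z hz => by
        refine ((((hasDerivWithinAt_slope f hz).const_mul σ).arctan).const_mul (-σ)).congr_deriv ?_
        rw [ext_apply _ hz, ext_apply _ hz, ext_apply _ hz, hk]
        nth_rw 2 [hf]
        rw [rhsC_apply h0 h2]
        have : 0 < 1 + (σ * slope f ⟨z, hz⟩) ^ 2 := by positivity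
        have h' : 1 + σ ^ 2 * slope f ⟨z, hz⟩ ^ 2 = 1 + (σ * slope f ⟨z, hz⟩) ^ 2 := by ring
        rw [h']
        field_simp
        ring)
    have hw := weakD_ae (ofSnd q f)
    rw [embSlope_ofSnd] at hw
    refine h.congr ?_ ?_
    · filter_upwards [hw] with z hz
      rw [hz]
    · filter_upwards [hw, ae_muI_of_forall (p := fun z => z ∈ Ioo (-1 : ℝ) 1) fun z hz => hz]
        with z hz hzI
      have hzI' := Ioo_subset_Icc_self hzI
      rw [hz, hrep z hzI', ext_apply _ hzI', ext_apply _ hzI', hk, sub_add_cancel]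

theorem IsSolution.bounds {σ l : ℝ} {u : W2D q} (h : IsSolution σ l u) (z : Icc (-1 : ℝ) 1) :
    0 < (1 + embVal q u) z ∧ (1 + embVal q u) z < 2 := by
  rw [ContinuousMap.add_apply, ContinuousMap.one_apply]
  obtain ⟨z, hz⟩ := z
  rcases eq_or_lt_of_le hz.1 with h1 | h1
  · subst h1
    have := embVal_leftEnd u
    rw [leftEnd] at this
    rw [this]; norm_num
  rcases eq_or_lt_of_le hz.2 with h2 | h2
  · subst h2
    have := embVal_rightEnd u
    rw [rightEnd] at this
    rw [this]; norm_num
  have := h.1 z ⟨h1, h2⟩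
  rw [rep_eqOn _ hz, ext_apply _ hz] at this
  constructor <;> linarith [this.1, this.2]

/-- A regularity argument: arctan(σ u') has a continuous weak derivative and is thus C¹; applying
the tangent shows that u' is C¹ with derivative `rhsC`. Uniqueness for the Dirichlet problem then
gives the integrated equation. -/
theorem IsSolution.embSlope_embVal_eq {σ l : ℝ} (hσ : σ ≠ 0) {u : W2D q}
    (h : IsSolution σ l u) :
    slope (rhsC σ (l, 1 + embVal q u, embSlope q u)) = embSlope q u ∧
      sol (rhsC σ (l, 1 + embVal q u, embSlope q u)) = embVal q u := by
  have h0 := fun z => (h.bounds z).1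
  have h2 := fun z => (h.bounds z).2
  set U := 1 + embVal q u with hU
  set P := embSlope q u with hP
  obtain ⟨k, hk⟩ := exists_rhs_continuous σ l (P := P) h0 h2
  have hw : IsWeakDeriv (fun z => -σ * Real.arctan (σ * ext P z)) (ext k) := by
    refine h.2.congr ?_ ?_
    · filter_upwards [weakD_ae u] with z hz
      rw [hz]
    · filter_upwards [weakD_ae u,
        ae_muI_of_forall (p := fun z => z ∈ Ioo (-1 : ℝ) 1) fun z hz => hz] with z hz hzI
      have hzI' := Ioo_subset_Icc_self hzI
      have hr : rep u z = U ⟨z, hzI'⟩ - 1 := by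
        rw [rep_eqOn _ hzI', ext_apply _ hzI', hU, ContinuousMap.add_apply,
          ContinuousMap.one_apply]
        ring
      rw [hz, hr, ext_apply _ hzI', ext_apply _ hzI', hk, sub_add_cancel]
  have hcont : Continuous fun z => -σ * Real.arctan (σ * ext P z) := by
    have := continuous_ext P
    have := Real.continuous_arctan
    fun_prop
  have hd : ∀ z ∈ Icc (-1 : ℝ) 1,
      HasDerivWithinAt (ext P) (ext (rhsC σ (l, U, P)) z) (Icc (-1) 1) z := by
    intro z hz
    have h1 := (hasDerivWithinAt_of_isWeakDeriv hcont.continuousOn hw hz).const_mul (-σ⁻¹)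
    have h3 : HasDerivAt Real.tan (1 / Real.cos (Real.arctan (σ * ext P z)) ^ 2)
        (-σ⁻¹ * (-σ * Real.arctan (σ * ext P z))) := by
      have : -σ⁻¹ * (-σ * Real.arctan (σ * ext P z)) = Real.arctan (σ * ext P z) := by
        field_simp
      rw [this]
      exact Real.hasDerivAt_tan (Real.cos_arctan_pos _).ne'
    have h4 := (h3.comp_hasDerivWithinAt z h1).const_mul σ⁻¹
    have h5 : (fun z => σ⁻¹ * (Real.tan ∘ fun z => -σ⁻¹ * (-σ * Real.arctan (σ * ext P z))) z)
        = ext P := by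
      funext z
      have : -σ⁻¹ * (-σ * Real.arctan (σ * ext P z)) = Real.arctan (σ * ext P z) := by
        field_simp
      simp only [Function.comp_apply, this, Real.tan_arctan]
      field_simp
    rw [h5] at h4
    refine h4.congr_deriv ?_
    rw [Real.cos_sq_arctan, ext_apply _ hz, ext_apply _ hz, ext_apply _ hz, hk, rhsC_apply h0 h2]
    field_simp
    ring
  have hv : ∀ z ∈ Icc (-1 : ℝ) 1,
      HasDerivWithinAt (ext (embVal q u)) (ext P z) (Icc (-1) 1) z := fun z hz =>
    hasDerivWithinAt_prim P hz
  obtain ⟨e1, e2⟩ := slope_sol_unique hv hd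
    (by rw [ext_apply _ neg_one_mem_I]; exact embVal_leftEnd u)
    (by rw [ext_apply _ one_mem_I]; exact embVal_rightEnd u)
  exact ⟨ext_injective e1, ext_injective e2⟩

end WeakSolutions

/-! ### The correspondence between σ and c -/

section Parameter

/-- The derivative of cosh c / c is y(c) / c², positive beyond c_crit. -/
theorem strictMonoOn_cosh_div : StrictMonoOn (fun c : ℝ => Real.cosh c / c) (Ici cCrit) := by
  have hne : ∀ c ∈ Ici cCrit, c ≠ 0 := fun c hc => (cCrit_pos.trans_le hc).ne'
  refine strictMonoOn_of_deriv_pos (convex_Ici _)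
    (Real.continuous_cosh.continuousOn.div continuousOn_id hne) fun c hc => ?_
  rw [interior_Ici] at hc
  have h0 : 0 < c := cCrit_pos.trans hc
  have h := (Real.hasDerivAt_cosh c).div (hasDerivAt_id' c) h0.ne'
  have h' := h.deriv
  change 0 < deriv (Real.cosh / fun x => x) c
  rw [h']
  have := yEven_pos hc
  unfold yEven at this
  apply div_pos _ (by positivity)
  linarith

theorem cosh_div_lt_iff {c d : ℝ} (hc : cCrit ≤ c) (hd : cCrit ≤ d) :
    Real.cosh c / c < Real.cosh d / d ↔ c < d :=
  strictMonoOn_cosh_div.lt_iff_lt hc hd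

theorem exists_cosh_div_eq {σ : ℝ} (hσ : sigmaCrit < σ) :
    ∃ c : ℝ, cCrit < c ∧ σ = Real.cosh c / c := by
  have hb : ∃ b, cCrit ≤ b ∧ σ ≤ Real.cosh b / b := by
    -- As cosh b ≥ b²/2, the quotient at b is at least b/2, which is at least σ.
    refine ⟨max cCrit (2 * σ), le_max_left _ _, ?_⟩
    set b := max cCrit (2 * σ)
    have hb0 : 0 < b := cCrit_pos.trans_le (le_max_left _ _)
    have h2 : 2 * σ ≤ b := le_max_right _ _
    rw [le_div_iff₀ hb0]
    have h1 : b ^ 2 / 2 ≤ Real.cosh b := by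
      have h6 : b / 2 ≤ Real.sinh (b / 2) := Real.self_le_sinh_iff.2 (by positivity)
      have h7 : Real.cosh b = 1 + 2 * Real.sinh (b / 2) ^ 2 := by
        have := Real.cosh_two_mul (b / 2)
        rw [mul_div_cancel₀ _ two_ne_zero, Real.cosh_sq] at this
        linarith
      rw [h7]
      nlinarith [mul_self_le_mul_self (by positivity : 0 ≤ b / 2) h6]
    nlinarith
  obtain ⟨b, hb1, hb2⟩ := hb
  have hcont : ContinuousOn (fun c : ℝ => Real.cosh c / c) (Icc cCrit b) :=
    Real.continuous_cosh.continuousOn.div continuousOn_id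
      fun c hc => (cCrit_pos.trans_le hc.1).ne'
  obtain ⟨c, hc, hce⟩ := intermediate_value_Icc hb1 hcont ⟨hσ.le, hb2⟩
  refine ⟨c, lt_of_le_of_ne hc.1 ?_, hce.symm⟩
  rintro rfl
  exact hσ.ne hce

end Parameter

/-! ### Existence of the branch and its derivative at λ = 0 -/

section Branch

variable {q : ℝ≥0∞} [Fact (1 ≤ q)] {σ c : ℝ}

/-- The equation `f - rhs = 0` for the second derivative of a solution. -/
def residual (σ : ℝ) (x : ℝ × CI) : CI := x.2 - rhsC σ (x.1, 1 + sol x.2, slope x.2)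

theorem hasFDerivAt_params (l : ℝ) (f : CI) :
    HasFDerivAt (fun x : ℝ × CI => (x.1, 1 + sol x.2, slope x.2))
      ((ContinuousLinearMap.fst ℝ ℝ CI).prod
        ((sol.comp (ContinuousLinearMap.snd ℝ ℝ CI)).prod
          (slope.comp (ContinuousLinearMap.snd ℝ ℝ CI)))) (l, f) :=
  (ContinuousLinearMap.fst ℝ ℝ CI).hasFDerivAt.prodMk
    (((sol.comp (ContinuousLinearMap.snd ℝ ℝ CI)).hasFDerivAt.const_add 1).prodMk
      (slope.comp (ContinuousLinearMap.snd ℝ ℝ CI)).hasFDerivAt)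

theorem residual_catenoid (hc : 0 < c) (hσ : σ = Real.cosh c / c) :
    residual σ (0, catSnd c) = 0 := by
  rw [residual, (slope_sol_catSnd c).1, (slope_sol_catSnd c).2, rhsC_catenoid hc hσ, sub_self]

theorem contDiffAt_residual (c σ : ℝ) : ContDiffAt ℝ ω (residual σ) (0, catSnd c) := by
  refine contDiffAt_snd.sub ?_
  have h : ContDiffAt ℝ ω (fun x : ℝ × CI => (x.1, 1 + sol x.2, slope x.2)) (0, catSnd c) :=
    contDiffAt_fst.prodMk ((contDiffAt_const.add
      (sol.contDiff.contDiffAt.comp _ contDiffAt_snd)).prodMk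
        (slope.contDiff.contDiffAt.comp _ contDiffAt_snd))
  refine ContDiffAt.comp (g := rhsC σ) _ (contDiffAt_rhsC σ ?_ ?_) h
  · simp only [(slope_sol_catSnd c).2]
    exact catVal_pos
  · simp only [(slope_sol_catSnd c).2]
    exact catVal_lt_two

/-- This is the partial derivative that the implicit function theorem requires to be invertible. -/
theorem fderiv_residual_inr (hc : 0 < c) (hσ : σ = Real.cosh c / c) :
    fderiv ℝ (residual σ) (0, catSnd c) ∘L .inr ℝ ℝ CI = linOp c := by
  obtain ⟨L, hL, hLz⟩ := exists_hasFDerivAt_rhsC_catenoid hc hσ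
  have h1 := hasFDerivAt_params 0 (catSnd c)
  have h2 : HasFDerivAt (rhsC σ) L ((fun x : ℝ × CI => (x.1, 1 + sol x.2, slope x.2))
      (0, catSnd c)) := by
    simp only [(slope_sol_catSnd c).1, (slope_sol_catSnd c).2]
    exact hL
  have h3 := (ContinuousLinearMap.snd ℝ ℝ CI).hasFDerivAt.sub (h2.comp (0, catSnd c) h1)
  have h4 : fderiv ℝ (residual σ) (0, catSnd c) = _ := h3.fderiv
  rw [h4]
  ext f z
  rw [linOp_apply]
  simp [hLz]
  ring

theorem isInnerCatenoid_ofSnd (hc : cCrit < c) (hσ : σ = Real.cosh c / c) :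
    IsInnerCatenoid σ (rep (ofSnd q (catSnd c))) := by
  refine ⟨c, hc, hσ, fun z hz => ?_⟩
  have := (slope_sol_catSnd c).2
  rw [rep_eqOn _ hz, embVal_ofSnd, eq_sub_iff_add_eq'.2 this, ext_apply _ hz]
  rfl

/-- The implicit function theorem yields an analytic curve of continuous second derivatives, which
`ofSnd` carries linearly and continuously into the Sobolev space. -/
theorem exists_isInnerBranch (q : ℝ≥0∞) [Fact (1 ≤ q)] {σ : ℝ} (hσ : sigmaCrit < σ) :
    ∃ (δ₀ : ℝ) (u : ℝ → W2D q), IsInnerBranch σ δ₀ u := by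
  obtain ⟨c, hc, hσc⟩ := exists_cosh_div_eq hσ
  have hc0 : 0 < c := cCrit_pos.trans hc
  have hcp := Real.cosh_pos c
  have hσ0 : σ ≠ 0 := by rw [hσc]; positivity
  have hcd := contDiffAt_residual c σ
  have hn : (ω : WithTop ℕ∞) ≠ 0 := by simp
  have hinv : (fderiv ℝ (residual σ) (0, catSnd c) ∘L .inr ℝ ℝ CI).IsInvertible := by
    rw [fderiv_residual_inr hc0 hσc]
    exact ⟨linEquiv hc, coe_linEquiv hc⟩
  set ψ := hcd.implicitFunction hn hinv
  have hψ0 : ψ 0 = catSnd c := hcd.implicitFunction_apply_self hn hinv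
  have hψe : ∀ᶠ l in 𝓝 (0 : ℝ), residual σ (l, ψ l) = 0 := by
    have := hcd.eventually_apply_implicitFunction hn hinv
    rwa [residual_catenoid hc0 hσc] at this
  have hψd : ContDiffAt ℝ ω ψ 0 := hcd.contDiffAt_implicitFunction hn hinv
  have hψa : ∀ᶠ l in 𝓝 (0 : ℝ), AnalyticAt ℝ ψ l :=
    (hψd.analyticAt).eventually_analyticAt
  -- On [-1,1] the shifted catenoid lies between 1/cosh c and 1, and 1/cosh c ≤ 1, so a perturbation
  -- smaller than 1/cosh c keeps u + 1 inside (0,2).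
  have hψn : ∀ᶠ l in 𝓝 (0 : ℝ), ‖sol (ψ l) - sol (ψ 0)‖ < (Real.cosh c)⁻¹ := by
    have h1 : ContinuousAt (fun l => ‖sol (ψ l) - sol (ψ 0)‖) 0 :=
      ((sol.continuous.continuousAt.comp hψd.continuousAt).sub continuousAt_const).norm
    have h2 : ‖sol (ψ 0) - sol (ψ 0)‖ < (Real.cosh c)⁻¹ := by
      rw [sub_self, norm_zero]; positivity
    exact h1.eventually_lt continuousAt_const h2
  obtain ⟨δ, hδ, hball⟩ := Metric.eventually_nhds_iff.1 (hψe.and (hψa.and hψn))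
  have hmem : ∀ l ∈ Ico 0 δ, dist l 0 < δ := fun l hl => by
    rw [Real.dist_eq, sub_zero, abs_of_nonneg hl.1]
    exact hl.2
  refine ⟨δ, fun l => ofSnd q (ψ l), hδ, fun l hl => ?_, ?_, fun l hl => ?_⟩
  · exact ((ofSnd q).analyticAt _).comp_analyticWithinAt
      (hball (hmem l hl)).2.1.analyticWithinAt
  · rw [hψ0]
    exact isInnerCatenoid_ofSnd hc hσc
  · obtain ⟨h1, -, h3⟩ := hball (hmem l hl)
    rw [hψ0] at h3
    have h4 : ∀ z, (1 + sol (ψ l)) z = catVal c z + (sol (ψ l) - sol (catSnd c)) z := fun z => by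
      rw [← (slope_sol_catSnd c).2]
      simp
    have h5 : ∀ z, |(sol (ψ l) - sol (catSnd c)) z| < (Real.cosh c)⁻¹ := fun z =>
      (ContinuousMap.norm_coe_le_norm _ z).trans_lt h3
    have h6 : (Real.cosh c)⁻¹ ≤ 1 := inv_le_one_of_one_le₀ (Real.one_le_cosh c)
    refine isSolution_ofSnd hσ0 (fun z => ?_) (fun z => ?_) (sub_eq_zero.1 h1)
    · rw [h4]
      linarith [(abs_lt.1 (h5 z)).1, le_catVal (c := c) z]
    · rw [h4]
      linarith [(abs_lt.1 (h5 z)).2, catVal_le_one (c := c) z]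

theorem IsInnerBranch.hasDerivWithinAt {δ₀ : ℝ} {u : ℝ → W2D q} (h : IsInnerBranch σ δ₀ u) :
    HasDerivWithinAt u (dLam δ₀ u) (Ico 0 δ₀) 0 := by
  have h0 : (0 : ℝ) ∈ Ico 0 δ₀ := ⟨le_rfl, h.pos⟩
  have := (h.analytic 0 h0).differentiableWithinAt
  rw [insert_eq_of_mem h0] at this
  exact this.hasDerivWithinAt

theorem embVal_embSlope_of_eqOn_catenoid {w : W2D q}
    (h : ∀ z ∈ Icc (-1 : ℝ) 1, rep w z = Real.cosh (c * z) / Real.cosh c - 1) :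
    1 + embVal q w = catVal c ∧ embSlope q w = catSlope c := by
  constructor
  · ext z
    rw [ContinuousMap.add_apply, ContinuousMap.one_apply, ← ext_coe, ← rep_eqOn w z.2, h z z.2,
      catVal_apply]
    ring
  · apply ext_injective
    intro z hz
    have h1 := hasDerivWithinAt_rep w hz
    have h2 : HasDerivWithinAt (rep w) (c * Real.sinh (c * z) / Real.cosh c) (Icc (-1) 1) z :=
      (((hasDerivAt_cosh_mul c z).div_const _).sub_const 1).hasDerivWithinAt.congr h (h z hz)
    rw [(uniqueDiffOn_Icc (by norm_num) z hz).eq_deriv _ h1 h2, ext_apply _ hz, catSlope_apply]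

/-- The derivative of a branch at `λ = 0` solves the linearized boundary value problem. -/
theorem IsInnerBranch.exists_dLam_eq {δ₀ : ℝ} {u : ℝ → W2D q} (h : IsInnerBranch σ δ₀ u) :
    ∃ (c : ℝ) (k : CI), cCrit < c ∧ σ = Real.cosh c / c ∧
      (∀ z ∈ Icc (-1 : ℝ) 1, rep (u 0) z = Real.cosh (c * z) / Real.cosh c - 1) ∧
      (∀ z ∈ Icc (-1 : ℝ) 1, ext (linOp c k) z = -source c z) ∧
      embVal q (dLam δ₀ u) = sol k ∧ embSlope q (dLam δ₀ u) = slope k := by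
  obtain ⟨c, hc, hσc, hcat⟩ := h.init
  have hc0 : 0 < c := cCrit_pos.trans hc
  have hcp := Real.cosh_pos c
  have hσ0 : σ ≠ 0 := by rw [hσc]; positivity
  set w := dLam δ₀ u
  have hd := h.hasDerivWithinAt
  have h0 : (0 : ℝ) ∈ Ico 0 δ₀ := ⟨le_rfl, h.pos⟩
  have hun : UniqueDiffWithinAt ℝ (Ico 0 δ₀) 0 := uniqueDiffOn_Ico 0 δ₀ 0 h0
  have hv : HasDerivWithinAt (fun l => embVal q (u l)) (embVal q w) (Ico 0 δ₀) 0 :=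
    (embVal q).hasFDerivAt.comp_hasDerivWithinAt 0 hd
  have hs : HasDerivWithinAt (fun l => embSlope q (u l)) (embSlope q w) (Ico 0 δ₀) 0 :=
    (embSlope q).hasFDerivAt.comp_hasDerivWithinAt 0 hd
  have hx : HasDerivWithinAt (fun l => (l, 1 + embVal q (u l), embSlope q (u l)))
      ((1 : ℝ), embVal q w, embSlope q w) (Ico 0 δ₀) 0 :=
    (hasDerivWithinAt_id _ _).prodMk ((hv.const_add 1).prodMk hs)
  obtain ⟨L, hL, hLz⟩ := exists_hasFDerivAt_rhsC_catenoid hc0 hσc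
  obtain ⟨e1, e2⟩ := embVal_embSlope_of_eqOn_catenoid hcat
  have hL' : HasFDerivAt (rhsC σ) L ((fun l => (l, 1 + embVal q (u l), embSlope q (u l))) 0) := by
    simp only [e1, e2]; exact hL
  have hg := hL'.comp_hasDerivWithinAt 0 hx
  set k := L (1, embVal q w, embSlope q w) with hk
  -- The equation is differentiated after integration by `slope` and `sol`, since second derivatives
  -- along a general branch are controlled only in L_q. Uniqueness of one-sided derivatives then
  -- identifies k as the second derivative of w.
  have hgs : HasDerivWithinAt (fun l => embSlope q (u l)) (slope k) (Ico 0 δ₀) 0 :=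
    (slope.hasFDerivAt.comp_hasDerivWithinAt 0 hg).congr
      (fun l hl => ((h.solves l hl).embSlope_embVal_eq hσ0).1.symm)
      ((h.solves 0 h0).embSlope_embVal_eq hσ0).1.symm
  have hgv : HasDerivWithinAt (fun l => embVal q (u l)) (sol k) (Ico 0 δ₀) 0 :=
    (sol.hasFDerivAt.comp_hasDerivWithinAt 0 hg).congr
      (fun l hl => ((h.solves l hl).embSlope_embVal_eq hσ0).2.symm)
      ((h.solves 0 h0).embSlope_embVal_eq hσ0).2.symm
  have ev : embVal q w = sol k := hun.eq_deriv _ hv hgv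
  have es : embSlope q w = slope k := hun.eq_deriv _ hs hgs
  refine ⟨c, k, hc, hσc, hcat, fun z hz => ?_, ev, es⟩
  have hkz := hLz 1 (embVal q w) (embSlope q w) ⟨z, hz⟩
  rw [← hk, ev, es] at hkz
  rw [ext_apply _ hz, linOp_apply, hkz]
  ring

end Branch

/-! ### Monotonicity from one-sided derivatives -/

section Monotonicity

theorem hasDerivAt_of_interior {g : ℝ → ℝ} {g' z : ℝ} (hz : z ∈ Ioo (-1 : ℝ) 1)
    (h : HasDerivWithinAt g g' (Icc (-1) 1) z) : HasDerivAt g g' z :=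
  h.hasDerivAt (Icc_mem_nhds hz.1 hz.2)

theorem strictMonoOn_of_hasDerivWithinAt_pos {g g' : ℝ → ℝ} {a b : ℝ} (ha : -1 ≤ a) (hb : b ≤ 1)
    (h : ∀ z ∈ Icc a b, HasDerivWithinAt g (g' z) (Icc (-1) 1) z)
    (hpos : ∀ z ∈ Ioo a b, 0 < g' z) : StrictMonoOn g (Icc a b) := by
  refine strictMonoOn_of_deriv_pos (convex_Icc a b)
    (fun z hz => (h z hz).continuousWithinAt.mono (Icc_subset_Icc ha hb)) fun z hz => ?_
  rw [interior_Icc] at hz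
  rw [(hasDerivAt_of_interior (Ioo_subset_Ioo ha hb hz) (h z (Ioo_subset_Icc_self hz))).deriv]
  exact hpos z hz

theorem strictAntiOn_of_hasDerivWithinAt_neg {g g' : ℝ → ℝ} {a b : ℝ} (ha : -1 ≤ a) (hb : b ≤ 1)
    (h : ∀ z ∈ Icc a b, HasDerivWithinAt g (g' z) (Icc (-1) 1) z)
    (hneg : ∀ z ∈ Ioo a b, g' z < 0) : StrictAntiOn g (Icc a b) := by
  have := strictMonoOn_of_hasDerivWithinAt_pos ha hb (fun z hz => (h z hz).neg)
    fun z hz => neg_pos.2 (hneg z hz)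
  exact fun x hx y hy hxy => neg_lt_neg_iff.1 (this hx hy hxy)

end Monotonicity

/-! ### The sign of the deciding integral near c_crit and for large c -/

section SignIntegral

/-- Here cosh(cz) ≤ cosh c, so the argument is at least 2, and log 2 > 1/2. This keeps the
logarithmic denominators away from zero. -/
theorem one_half_lt_log {c z : ℝ} (hz : |z| ≤ 1) :
    1 / 2 < Real.log (2 * Real.cosh c / Real.cosh (c * z)) := by
  have hC := Real.cosh_pos (c * z)
  have h : Real.cosh (c * z) ≤ Real.cosh c := by
    rw [Real.cosh_le_cosh, abs_mul]
    exact mul_le_of_le_one_right (abs_nonneg _) hz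
  have h2 : 2 ≤ 2 * Real.cosh c / Real.cosh (c * z) := by
    rw [le_div_iff₀ hC]; linarith
  have h3 := Real.log_le_log two_pos h2
  linarith [Real.log_two_gt_d9]

/-- The truncation of the real line to `[0,1]`. -/
def clamp (z : ℝ) : ℝ := max 0 (min z 1)

theorem clamp_of_mem {z : ℝ} (hz : z ∈ Icc (0 : ℝ) 1) : clamp z = z := by
  rw [clamp, min_eq_left hz.2, max_eq_right hz.1]

theorem abs_clamp_le (z : ℝ) : |clamp z| ≤ 1 :=
  abs_le.2 ⟨(by norm_num : (-1 : ℝ) ≤ 0).trans (le_max_left _ _),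
    max_le zero_le_one (min_le_right _ _)⟩

/-- The density `(1 - c z tanh (c z)) / ln²(2 cosh c / cosh (c z))` for `z ∈ [0,1]`. -/
def density (c z : ℝ) : ℝ :=
  -(yEven (c * clamp z)) / (Real.cosh (c * clamp z) *
    Real.log (2 * Real.cosh c / Real.cosh (c * clamp z)) ^ 2)

/-- Truncating z makes the lower bound for the logarithm valid for all real arguments, so the
density is jointly continuous on the whole plane and its integral is continuous in c. -/
theorem continuous_density : Continuous (Function.uncurry density) := by
  have hcl : Continuous clamp := by unfold clamp; fun_prop
  have hy := continuous_yEven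
  have hd : Continuous fun p : ℝ × ℝ => 2 * Real.cosh p.1 / Real.cosh (p.1 * clamp p.2) :=
    (by fun_prop : Continuous fun p : ℝ × ℝ => 2 * Real.cosh p.1).div (by fun_prop)
      fun p => (Real.cosh_pos _).ne'
  have hl : Continuous fun p : ℝ × ℝ => Real.log (2 * Real.cosh p.1 / Real.cosh (p.1 * clamp p.2)) :=
    hd.log fun p => by
      have h1 := Real.cosh_pos p.1
      have h2 := Real.cosh_pos (p.1 * clamp p.2)
      positivity
  refine Continuous.div (f := fun p : ℝ × ℝ => -(yEven (p.1 * clamp p.2))) (by fun_prop)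
    (by fun_prop) fun p => ?_
  have h1 := one_half_lt_log (c := p.1) (abs_clamp_le p.2)
  have h2 := Real.cosh_pos (p.1 * clamp p.2)
  have h3 : 0 < Real.log (2 * Real.cosh p.1 / Real.cosh (p.1 * clamp p.2)) := by linarith
  positivity

theorem continuous_density_right (c : ℝ) : Continuous (density c) :=
  continuous_density.comp (Continuous.prodMk_right c)

/-- The integral whose sign decides on the direction of deflection. -/
def signIntegral (c : ℝ) : ℝ := ∫ z in (0 : ℝ)..1, density c z

theorem continuous_signIntegral : Continuous signIntegral :=
  intervalIntegral.continuous_parametric_intervalIntegral_of_continuous' continuous_density 0 1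

/-- At the critical parameter y(cz) is negative for every z in [0,1), so the density has one sign.
-/
theorem signIntegral_cCrit_pos : 0 < signIntegral cCrit := by
  have hlt : ∀ z ∈ Ico (0 : ℝ) 1, 0 < density cCrit z := fun z hz => by
    have h1 := one_half_lt_log (c := cCrit) (abs_clamp_le z)
    rw [clamp_of_mem ⟨hz.1, hz.2.le⟩] at h1
    rw [density, clamp_of_mem ⟨hz.1, hz.2.le⟩]
    have h2 := Real.cosh_pos (cCrit * z)
    have h3 : yEven (cCrit * z) < 0 := yEven_lt_zero (mul_nonneg cCrit_pos.le hz.1)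
      (mul_lt_of_lt_one_right cCrit_pos hz.2)
    have h4 : 0 < Real.log (2 * Real.cosh cCrit / Real.cosh (cCrit * z)) := by linarith
    have := neg_pos.2 h3
    positivity
  have hc := continuous_density_right cCrit
  refine intervalIntegral.intervalIntegral_pos_of_pos_on (hc.intervalIntegrable _ _)
    (fun z hz => hlt z ⟨hz.1.le, hz.2⟩) one_pos

/-- The numerator 1 - x tanh x is at most 1, and the squared logarithm exceeds 1/4. -/
theorem density_le_four {c z : ℝ} (hc : 0 ≤ c) (hz : z ∈ Icc (0 : ℝ) 1) : density c z ≤ 4 := by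
  have h1 := one_half_lt_log (c := c) (abs_clamp_le z)
  rw [clamp_of_mem hz] at h1
  rw [density, clamp_of_mem hz]
  set ℓ := Real.log (2 * Real.cosh c / Real.cosh (c * z))
  have h2 := Real.cosh_pos (c * z)
  have hl : 0 < ℓ := by linarith
  rw [div_le_iff₀ (by positivity)]
  have h3 : 0 ≤ c * z * Real.sinh (c * z) :=
    mul_nonneg (mul_nonneg hc hz.1) (Real.sinh_nonneg_iff.2 (mul_nonneg hc hz.1))
  have h4 : 1 ≤ 4 * ℓ ^ 2 := by nlinarith
  unfold yEven
  nlinarith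

theorem density_nonpos {c z : ℝ} (hz : z ∈ Icc (0 : ℝ) 1) (h : cCrit ≤ c * z) :
    density c z ≤ 0 := by
  rw [density, clamp_of_mem hz]
  have : 0 ≤ yEven (c * z) := by
    rw [← yEven_cCrit]
    exact strictMonoOn_yEven.monotoneOn cCrit_pos.le (cCrit_pos.le.trans h) h
  have h2 := Real.cosh_pos (c * z)
  exact div_nonpos_of_nonpos_of_nonneg (by linarith) (by positivity)

/-- For x = cz in [c - 1, c] one has cosh c ≤ e cosh x, so the logarithm is at most log 2 + 1 ≤ 2.
Also sinh x ≥ cosh x / 2, whence y(x) ≥ (c - 3)/2 · cosh x. Dividing by 4 gives the bound. -/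
theorem density_le_of_near_end {c z : ℝ} (hc : 3 < c) (hz : z ∈ Icc (1 - 1 / c) 1) :
    density c z ≤ -((c - 3) / 8) := by
  have hc0 : 0 < c := by linarith
  have hx : c - 1 ≤ c * z := by
    have := mul_le_mul_of_nonneg_left hz.1 hc0.le
    rwa [mul_sub, mul_one, mul_one_div_cancel hc0.ne'] at this
  have hxc : c * z ≤ c := mul_le_of_le_one_right hc0.le hz.2
  have hz0 : 0 ≤ z := by
    by_contra hn
    nlinarith
  have hzI : z ∈ Icc (0 : ℝ) 1 := ⟨hz0, hz.2⟩
  have h1 := one_half_lt_log (c := c) (abs_clamp_le z)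
  rw [clamp_of_mem hzI] at h1
  rw [density, clamp_of_mem hzI]
  set x := c * z
  have hC := Real.cosh_pos x
  have hℓ : Real.log (2 * Real.cosh c / Real.cosh x) ≤ 2 := by
    have e1 : Real.cosh c ≤ Real.exp (c - x) * Real.cosh x := by
      have : c = (c - x) + x := by ring
      conv_lhs => rw [this, Real.cosh_add]
      rw [← Real.cosh_add_sinh (c - x), add_mul]
      have h5 : 0 ≤ Real.sinh (c - x) := Real.sinh_nonneg_iff.2 (by linarith)
      nlinarith [(Real.sinh_lt_cosh x).le]
    have e2 : 2 * Real.cosh c / Real.cosh x ≤ 2 * Real.exp 1 := by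
      rw [div_le_iff₀ hC]
      have : Real.exp (c - x) ≤ Real.exp 1 := Real.exp_le_exp.2 (by linarith)
      nlinarith
    have e3 := Real.log_le_log (by positivity) e2
    rw [Real.log_mul two_ne_zero (Real.exp_pos _).ne', Real.log_exp] at e3
    linarith [Real.log_two_lt_d9]
  set ℓ := Real.log (2 * Real.cosh c / Real.cosh x)
  have hl0 : 0 < ℓ := by linarith
  have hsinh : Real.cosh x ≤ 2 * Real.sinh x := by
    have h6 : Real.cosh x - Real.sinh x = Real.exp (-x) := Real.cosh_sub_sinh x
    have h7 : Real.exp (-x) ≤ 1 := Real.exp_le_one_iff.2 (by linarith)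
    have h8 : x ≤ Real.sinh x := Real.self_le_sinh_iff.2 (by linarith)
    linarith
  have hy : (c - 3) / 2 * Real.cosh x ≤ yEven x := by
    unfold yEven
    nlinarith
  have hℓ2 : ℓ ^ 2 ≤ 4 := by nlinarith
  rw [div_le_iff₀ (by positivity)]
  have : (c - 3) / 8 * (Real.cosh x * ℓ ^ 2) ≤ (c - 3) / 8 * (Real.cosh x * 4) := by
    gcongr
  nlinarith

/-- The density can be positive only for z < c_crit / c, contributing at most 4 c_crit / c. The last
piece, of length 1/c, contributes at most -(c - 3)/(8c). The sum is negative once c > 3 + 32 c_crit.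
-/
theorem signIntegral_neg {c : ℝ} (hc : 4 + 32 * cCrit ≤ c) : signIntegral c < 0 := by
  have h0 := cCrit_pos
  have hc0 : 0 < c := by linarith
  set a := cCrit / c
  set b := 1 - 1 / c
  have ha0 : 0 ≤ a := by positivity
  have hb1 : b ≤ 1 := by
    have : 0 < 1 / c := by positivity
    simp only [b]; linarith
  have hab : a ≤ b := by
    simp only [a, b]
    rw [div_le_iff₀ hc0, sub_mul, one_mul, one_div_mul_cancel hc0.ne']
    linarith
  have hint : ∀ x y, IntervalIntegrable (density c) volume x y := fun x y =>
    (continuous_density_right c).intervalIntegrable x y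
  have hci : ∀ (m x y : ℝ), IntervalIntegrable (fun _ : ℝ => m) volume x y := fun m x y =>
    intervalIntegrable_const
  have e : signIntegral c = (∫ z in (0 : ℝ)..a, density c z) + (∫ z in a..b, density c z)
      + ∫ z in b..1, density c z := by
    rw [intervalIntegral.integral_add_adjacent_intervals (hint _ _) (hint _ _),
      intervalIntegral.integral_add_adjacent_intervals (hint _ _) (hint _ _)]
    rfl
  have i1 : ∫ z in (0 : ℝ)..a, density c z ≤ 4 * a := by
    have := intervalIntegral.integral_mono_on ha0 (hint 0 a) (hci 4 0 a) fun z hz =>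
      density_le_four hc0.le ⟨hz.1, hz.2.trans (hab.trans hb1)⟩
    rw [intervalIntegral.integral_const, smul_eq_mul] at this
    linarith
  have i2 : ∫ z in a..b, density c z ≤ 0 := by
    have := intervalIntegral.integral_mono_on hab (hint a b) (hci 0 a b) fun z hz =>
      density_nonpos (c := c) ⟨ha0.trans hz.1, hz.2.trans hb1⟩ (by
        have := mul_le_mul_of_nonneg_left hz.1 hc0.le
        simp only [a] at this
        rwa [mul_div_cancel₀ _ hc0.ne'] at this)
    rw [intervalIntegral.integral_const, smul_zero] at this
    exact this
  have i3 : ∫ z in b..1, density c z ≤ 1 / c * -((c - 3) / 8) := by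
    have := intervalIntegral.integral_mono_on hb1 (hint b 1) (hci (-((c - 3) / 8)) b 1)
      fun z hz => density_le_of_near_end (by linarith) hz
    rw [intervalIntegral.integral_const, smul_eq_mul] at this
    simpa [b] using this
  have key : 4 * a + 1 / c * -((c - 3) / 8) < 0 := by
    have : 4 * a + 1 / c * -((c - 3) / 8) = (4 * cCrit - (c - 3) / 8) / c := by
      simp only [a]
      field_simp
      ring
    rw [this]
    apply div_neg_of_neg_of_pos _ hc0
    linarith
  linarith

end SignIntegral

/-! ### Sign pattern of the linearized deflection by Sturm comparison -/

section Deflection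

variable {c : ℝ} {k : CI}

theorem source_neg (c z : ℝ) : source c (-z) = source c z := by
  simp only [source, mul_neg, Real.cosh_neg]

theorem source_pos (hc : 0 < c) {z : ℝ} (hz : z ∈ Icc (-1 : ℝ) 1) : 0 < source c z := by
  have h1 := one_half_lt_log (c := c) (abs_le.2 hz)
  have h2 := Real.cosh_pos (c * z)
  have h3 : 0 < Real.log (2 * Real.cosh c / Real.cosh (c * z)) := by linarith
  unfold source
  positivity

/-- The Lagrange bracket of the solution with the even homogeneous solution. -/
def bracketEven (c : ℝ) (k : CI) (z : ℝ) : ℝ :=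
  (ext (slope k) z * yEven (c * z) - ext (sol k) z * (c * (c * z * Real.cosh (c * z))))
    / Real.cosh (c * z) ^ 2

theorem hasDerivWithinAt_bracketEven (hk : ∀ z ∈ Icc (-1 : ℝ) 1, ext (linOp c k) z = -source c z)
    {z : ℝ} (hz : z ∈ Icc (-1 : ℝ) 1) :
    HasDerivWithinAt (bracketEven c k) (-source c z * yEven (c * z) / Real.cosh (c * z) ^ 2)
      (Icc (-1) 1) z := by
  rw [← hk z hz]
  exact hasDerivWithinAt_lagrange_even c k hz

theorem sol_even_of_source (hc : cCrit < c)
    (hk : ∀ z ∈ Icc (-1 : ℝ) 1, ext (linOp c k) z = -source c z) {z : ℝ}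
    (hz : z ∈ Icc (-1 : ℝ) 1) :
    ext (sol k) (-z) = ext (sol k) z ∧ ext (slope k) (-z) = -ext (slope k) z :=
  sol_even hc (fun z hz => by
    rw [hk z hz, hk (-z) ⟨neg_le_neg hz.2, by linarith [hz.1]⟩, source_neg]) hz

/-- Evenness gives w'(0) = 0, and the other term carries a factor z. -/
theorem bracketEven_zero (hc : cCrit < c)
    (hk : ∀ z ∈ Icc (-1 : ℝ) 1, ext (linOp c k) z = -source c z) : bracketEven c k 0 = 0 := by
  have h := (sol_even_of_source hc hk zero_mem_I).2
  rw [neg_zero] at h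
  have h0 : ext (slope k) 0 = 0 := by linarith
  simp [bracketEven, h0]

theorem bracketEven_one (c : ℝ) (k : CI) :
    bracketEven c k 1 = ext (slope k) 1 * yEven c / Real.cosh c ^ 2 := by
  simp [bracketEven, ext_sol_right]

/-- Integrating Lagrange's identity from 0, where the bracket vanishes, to 1 produces the deciding
integral; the boundary condition turns the left side into a multiple of w'(1). -/
theorem bracketEven_one_eq (hc : cCrit < c)
    (hk : ∀ z ∈ Icc (-1 : ℝ) 1, ext (linOp c k) z = -source c z) :
    bracketEven c k 1 = c ^ 2 * signIntegral c := by
  have hsub : ∀ z ∈ Icc (0 : ℝ) 1, z ∈ Icc (-1 : ℝ) 1 := fun z hz => ⟨by linarith [hz.1], hz.2⟩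
  have hd : ∀ z ∈ Icc (0 : ℝ) 1,
      HasDerivWithinAt (bracketEven c k) (c ^ 2 * density c z) (Icc (-1) 1) z := fun z hz => by
    refine (hasDerivWithinAt_bracketEven hk (hsub z hz)).congr_deriv ?_
    rw [density, clamp_of_mem hz, source]
    have h1 := one_half_lt_log (c := c) (abs_clamp_le z)
    rw [clamp_of_mem hz] at h1
    have h2 := Real.cosh_pos (c * z)
    have h3 : Real.log (2 * Real.cosh c / Real.cosh (c * z)) ≠ 0 := by linarith
    field_simp
  have := intervalIntegral.integral_eq_sub_of_hasDerivAt_of_le (a := 0) (b := 1) zero_le_one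
    (fun z hz => (hd z hz).continuousWithinAt.mono (Icc_subset_Icc_left (by norm_num)))
    (fun z hz => hasDerivAt_of_interior ⟨by linarith [hz.1], hz.2⟩
      (hd z (Ioo_subset_Icc_self hz)))
    ((continuous_const.mul (continuous_density_right c)).intervalIntegrable _ _)
  rw [bracketEven_zero hc hk, sub_zero, intervalIntegral.integral_const_mul] at this
  exact this.symm

/-- At the centre, the deflection is always inward. -/
theorem sol_zero_neg (hc : cCrit < c)
    (hk : ∀ z ∈ Icc (-1 : ℝ) 1, ext (linOp c k) z = -source c z) : ext (sol k) 0 < 0 := by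
  have hc0 : 0 < c := cCrit_pos.trans hc
  have hY := yEven_pos hc
  have hC := Real.cosh_pos c
  -- K is the bracket of w with y(c) sinh(cz) - sinh(c) y(cz), the homogeneous solution that
  -- vanishes at z = 1 and is positive on (0,1). Hence K decreases to K(1) = 0, while K(0) is a
  -- negative multiple of w(0).
  set K : ℝ → ℝ := fun z => yEven c * ((ext (slope k) z * Real.sinh (c * z)
    - ext (sol k) z * (c * Real.cosh (c * z))) / Real.cosh (c * z) ^ 2)
      - Real.sinh c * bracketEven c k z
  have hsub : ∀ z ∈ Icc (0 : ℝ) 1, z ∈ Icc (-1 : ℝ) 1 := fun z hz => ⟨by linarith [hz.1], hz.2⟩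
  have hanti : StrictAntiOn K (Icc 0 1) := by
    refine strictAntiOn_of_hasDerivWithinAt_neg (by norm_num) le_rfl (fun z hz =>
      ((hasDerivWithinAt_lagrange_odd c k (hsub z hz)).const_mul _).sub
        ((hasDerivWithinAt_bracketEven hk (hsub z hz)).const_mul _)) fun z hz => ?_
    have hzI := hsub z (Ioo_subset_Icc_self hz)
    rw [hk z hzI]
    have hs := source_pos hc0 hzI
    have hCz := Real.cosh_pos (c * z)
    have hx0 : 0 < c * z := mul_pos hc0 hz.1
    have hxc : c * z < c := mul_lt_of_lt_one_right hc0 hz.2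
    have h1 : yEven c * Real.sinh (c * z) - Real.sinh c * yEven (c * z)
        = Real.sinh (c * z) * Real.sinh c * (c - c * z) + Real.sinh (c - c * z) := by
      rw [Real.sinh_sub, yEven, yEven]; ring
    have h2 : 0 < Real.sinh (c * z) * Real.sinh c * (c - c * z) + Real.sinh (c - c * z) := by
      have e1 := Real.sinh_pos_iff.2 hx0
      have e2 := Real.sinh_pos_iff.2 hc0
      have e3 : 0 < c - c * z := by linarith
      have e4 := Real.sinh_pos_iff.2 e3
      positivity
    have h3 : yEven c * (-source c z * Real.sinh (c * z) / Real.cosh (c * z) ^ 2)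
        - Real.sinh c * (-source c z * yEven (c * z) / Real.cosh (c * z) ^ 2)
        = -(source c z * (yEven c * Real.sinh (c * z) - Real.sinh c * yEven (c * z))
          / Real.cosh (c * z) ^ 2) := by ring
    rw [h3, h1, neg_lt_zero]
    positivity
  have h01 := hanti (show (0 : ℝ) ∈ Icc (0 : ℝ) 1 by norm_num)
    (show (1 : ℝ) ∈ Icc (0 : ℝ) 1 by norm_num) one_pos
  have hK1 : K 1 = 0 := by
    simp only [K, bracketEven_one, ext_sol_right, mul_one, zero_mul, sub_zero]
    ring
  have hK0 : K 0 = -(yEven c * c) * ext (sol k) 0 := by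
    simp only [K, bracketEven_zero hc hk]
    simp
    ring
  rw [hK1, hK0] at h01
  have : 0 < yEven c * c := by positivity
  nlinarith

/-- The numerator in the quotient rule is the Lagrange bracket, up to the weight, so the sign of the
bracket decides the monotonicity of w / y away from zeros of y. -/
theorem hasDerivWithinAt_quotient {z : ℝ} (hz : z ∈ Icc (-1 : ℝ) 1) (h : yEven (c * z) ≠ 0) :
    HasDerivWithinAt (fun z => ext (sol k) z / yEven (c * z))
      (bracketEven c k z * Real.cosh (c * z) ^ 2 / yEven (c * z) ^ 2) (Icc (-1) 1) z := by
  refine ((hasDerivWithinAt_sol k hz).div (hasDerivAt_yEven_mul c z).hasDerivWithinAt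
    h).congr_deriv ?_
  have hC := (Real.cosh_pos (c * z)).ne'
  rw [bracketEven, div_mul_cancel₀ _ (pow_ne_zero 2 hC)]

/-- The source is positive and y(cz) changes sign at z = c_crit / c, so the bracket first increases
and then decreases. -/
theorem bracketEven_strictMonoOn (hc : cCrit < c)
    (hk : ∀ z ∈ Icc (-1 : ℝ) 1, ext (linOp c k) z = -source c z) :
    StrictMonoOn (bracketEven c k) (Icc 0 (cCrit / c)) := by
  have hc0 : 0 < c := cCrit_pos.trans hc
  have hζ : cCrit / c ≤ 1 := (div_le_one hc0).2 hc.le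
  refine strictMonoOn_of_hasDerivWithinAt_pos (by norm_num) hζ (fun z hz =>
    hasDerivWithinAt_bracketEven hk ⟨by linarith [hz.1], hz.2.trans hζ⟩) fun z hz => ?_
  have hs := source_pos hc0 (z := z) ⟨by linarith [hz.1], hz.2.le.trans hζ⟩
  have hC := Real.cosh_pos (c * z)
  have hy : yEven (c * z) < 0 := yEven_lt_zero (mul_nonneg hc0.le hz.1.le) (by
    rw [mul_comm]; exact (lt_div_iff₀ hc0).1 hz.2)
  exact div_pos (mul_pos_of_neg_of_neg (neg_neg_of_pos hs) hy) (by positivity)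

theorem bracketEven_strictAntiOn (hc : cCrit < c)
    (hk : ∀ z ∈ Icc (-1 : ℝ) 1, ext (linOp c k) z = -source c z) :
    StrictAntiOn (bracketEven c k) (Icc (cCrit / c) 1) := by
  have hc0 : 0 < c := cCrit_pos.trans hc
  have hζ : 0 < cCrit / c := div_pos cCrit_pos hc0
  refine strictAntiOn_of_hasDerivWithinAt_neg (by linarith) le_rfl (fun z hz =>
    hasDerivWithinAt_bracketEven hk ⟨by linarith [hz.1], hz.2⟩) fun z hz => ?_
  have hs := source_pos hc0 (z := z) ⟨by linarith [hz.1], hz.2.le⟩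
  have hC := Real.cosh_pos (c * z)
  have hy : 0 < yEven (c * z) := yEven_pos (by
    rw [mul_comm]; exact (div_lt_iff₀ hc0).1 hz.1)
  exact div_neg_of_neg_of_pos (mul_neg_of_neg_of_pos (neg_neg_of_pos hs) hy) (by positivity)

theorem bracketEven_pos (hc : cCrit < c)
    (hk : ∀ z ∈ Icc (-1 : ℝ) 1, ext (linOp c k) z = -source c z) {z : ℝ} (h0 : 0 < z)
    (hz : z ≤ cCrit / c) : 0 < bracketEven c k z := by
  rw [← bracketEven_zero hc hk]
  exact bracketEven_strictMonoOn hc hk ⟨le_rfl, h0.le.trans hz⟩ ⟨h0.le, hz⟩ h0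

/-- Left of the zero of y, the quotient w / y is positive at 0 and increasing, while y < 0. At the
zero itself the bracket reduces to a negative multiple of w, and the bracket is positive. -/
theorem sol_neg_inner (hc : cCrit < c)
    (hk : ∀ z ∈ Icc (-1 : ℝ) 1, ext (linOp c k) z = -source c z) {z : ℝ}
    (hz : z ∈ Icc 0 (cCrit / c)) : ext (sol k) z < 0 := by
  have hc0 : 0 < c := cCrit_pos.trans hc
  have hζ : cCrit / c ≤ 1 := (div_le_one hc0).2 hc.le
  rcases hz.2.eq_or_lt with h | h
  · have hp := bracketEven_pos hc hk (h ▸ div_pos cCrit_pos hc0) hz.2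
    have hC := Real.cosh_pos (c * z)
    have hcz : c * z = cCrit := by rw [h, mul_div_cancel₀ _ hc0.ne']
    rw [bracketEven, lt_div_iff₀ (by positivity), hcz, yEven_cCrit] at hp
    have : 0 < c * (cCrit * Real.cosh cCrit) :=
      mul_pos hc0 (mul_pos cCrit_pos (Real.cosh_pos _))
    nlinarith
  · have hy : ∀ x ∈ Icc 0 z, yEven (c * x) < 0 := fun x hx =>
      yEven_lt_zero (mul_nonneg hc0.le hx.1) (by
        rw [mul_comm]; exact (lt_div_iff₀ hc0).1 (hx.2.trans_lt h))
    have hm := strictMonoOn_of_hasDerivWithinAt_pos (a := 0) (b := z) (by norm_num)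
      (hz.2.trans hζ) (fun x hx => hasDerivWithinAt_quotient (c := c) (k := k)
        ⟨by linarith [hx.1], hx.2.trans (hz.2.trans hζ)⟩ (hy x hx).ne) (fun x hx => by
          have h1 := bracketEven_pos hc hk hx.1 (hx.2.le.trans hz.2)
          have h2 := Real.cosh_pos (c * x)
          have h3 := (hy x (Ioo_subset_Icc_self hx)).ne
          positivity)
    have h0 : 0 < ext (sol k) 0 / yEven (c * 0) :=
      div_pos_of_neg_of_neg (sol_zero_neg hc hk) (hy 0 ⟨le_rfl, hz.1⟩)
    have h1 : ext (sol k) 0 / yEven (c * 0) ≤ ext (sol k) z / yEven (c * z) :=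
      hm.monotoneOn ⟨le_rfl, hz.1⟩ ⟨hz.1, le_rfl⟩ hz.1
    by_contra hn
    have := div_nonpos_of_nonneg_of_nonpos (not_lt.1 hn) (hy z ⟨hz.1, le_rfl⟩).le
    linarith

theorem yEven_mul_pos (hc : cCrit < c) {z : ℝ} (hz : cCrit / c < z) : 0 < yEven (c * z) :=
  yEven_pos (by rw [mul_comm]; exact (div_lt_iff₀ (cCrit_pos.trans hc)).1 hz)

/-- The quotient by the even homogeneous solution is increasing where the bracket is positive. -/
theorem quotient_strictMonoOn (hc : cCrit < c) {a b : ℝ} (ha : cCrit / c < a) (hb : b ≤ 1)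
    (h : ∀ z ∈ Ioo a b, 0 < bracketEven c k z) :
    StrictMonoOn (fun z => ext (sol k) z / yEven (c * z)) (Icc a b) := by
  have hζ : 0 < cCrit / c := div_pos cCrit_pos (cCrit_pos.trans hc)
  refine strictMonoOn_of_hasDerivWithinAt_pos (by linarith) hb (fun x hx =>
    hasDerivWithinAt_quotient ⟨by linarith [hx.1], hx.2.trans hb⟩
      (yEven_mul_pos hc (ha.trans_le hx.1)).ne') fun x hx => ?_
  have h1 := h x hx
  have h2 := Real.cosh_pos (c * x)
  have h3 := yEven_mul_pos hc (ha.trans hx.1)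
  positivity

theorem quotient_strictAntiOn (hc : cCrit < c) {a b : ℝ} (ha : cCrit / c < a) (hb : b ≤ 1)
    (h : ∀ z ∈ Ioo a b, bracketEven c k z < 0) :
    StrictAntiOn (fun z => ext (sol k) z / yEven (c * z)) (Icc a b) := by
  have hζ : 0 < cCrit / c := div_pos cCrit_pos (cCrit_pos.trans hc)
  refine strictAntiOn_of_hasDerivWithinAt_neg (by linarith) hb (fun x hx =>
    hasDerivWithinAt_quotient ⟨by linarith [hx.1], hx.2.trans hb⟩
      (yEven_mul_pos hc (ha.trans_le hx.1)).ne') fun x hx => ?_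
  have h1 := h x hx
  have h2 := Real.cosh_pos (c * x)
  have h3 := yEven_mul_pos hc (ha.trans hx.1)
  exact div_neg_of_neg_of_pos (mul_neg_of_neg_of_pos h1 (by positivity)) (by positivity)

/-- If the bracket is still positive at 1, it is positive beyond the zero of y, so w / y increases
there to its final value 0. -/
theorem sol_neg_of_bracket_pos (hc : cCrit < c)
    (hk : ∀ z ∈ Icc (-1 : ℝ) 1, ext (linOp c k) z = -source c z)
    (hG : 0 < bracketEven c k 1) {z : ℝ} (hz : z ∈ Ico (0 : ℝ) 1) : ext (sol k) z < 0 := by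
  have hc0 : 0 < c := cCrit_pos.trans hc
  rcases le_or_gt z (cCrit / c) with h | h
  · exact sol_neg_inner hc hk ⟨hz.1, h⟩
  · have hm := quotient_strictMonoOn (k := k) hc h le_rfl fun x hx =>
      hG.trans (bracketEven_strictAntiOn hc hk ⟨(h.trans hx.1).le, hx.2.le⟩
        ⟨(h.trans hz.2).le, le_rfl⟩ hx.2)
    have h1 := hm ⟨le_rfl, hz.2.le⟩ ⟨hz.2.le, le_rfl⟩ hz.2
    simp only [ext_sol_right, zero_div] at h1
    exact (div_neg_iff.1 h1).elim (fun h' => absurd h'.2 (yEven_mul_pos hc h).le.not_gt)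
      fun h' => h'.1

/-- If the bracket is negative at 1, it has one zero η beyond ζ = c_crit / c. Past η the quotient w
/ y decreases to 0, so w > 0; at ζ one has w < 0; between them w / y increases, so the sign changes
once, at some r. The slope at r is positive because there the bracket reduces to w'(r) times a
positive factor. -/
theorem exists_sol_sign_change (hc : cCrit < c)
    (hk : ∀ z ∈ Icc (-1 : ℝ) 1, ext (linOp c k) z = -source c z)
    (hG : bracketEven c k 1 < 0) :
    ∃ r ∈ Ioo (0 : ℝ) 1, (∀ z ∈ Ico 0 r, ext (sol k) z < 0) ∧
      (∀ z ∈ Ioo r 1, 0 < ext (sol k) z) ∧ 0 < ext (slope k) r := by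
  have hc0 : 0 < c := cCrit_pos.trans hc
  set ζ := cCrit / c
  have hζ0 : 0 < ζ := div_pos cCrit_pos hc0
  have hζ1 : ζ < 1 := (div_lt_one hc0).2 hc
  have hGζ : 0 < bracketEven c k ζ := bracketEven_pos hc hk hζ0 le_rfl
  have hGc : ContinuousOn (bracketEven c k) (Icc ζ 1) := fun z hz =>
    (hasDerivWithinAt_bracketEven hk ⟨by linarith [hz.1], hz.2⟩).continuousWithinAt.mono
      (Icc_subset_Icc_left (by linarith))
  obtain ⟨η, hη, hGη⟩ := intermediate_value_Icc' hζ1.le hGc ⟨hG.le, hGζ.le⟩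
  have hη1 : ζ < η := lt_of_le_of_ne hη.1 (by rintro h; rw [← h] at hGη; linarith)
  have hη2 : η < 1 := lt_of_le_of_ne hη.2 (by rintro h; rw [h] at hGη; linarith)
  have hanti := bracketEven_strictAntiOn hc hk
  have hpos : ∀ z, ζ < z → z < η → 0 < bracketEven c k z := fun z h1 h2 => by
    rw [← hGη]; exact hanti ⟨h1.le, (h2.trans hη2).le⟩ hη h2
  have hneg : ∀ z, η < z → z ≤ 1 → bracketEven c k z < 0 := fun z h1 h2 => by
    rw [← hGη]; exact hanti hη ⟨(hη1.trans h1).le, h2⟩ h1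
  have houter : ∀ z ∈ Ico η 1, 0 < ext (sol k) z := fun z hz => by
    have hz' := hη1.trans_le hz.1
    have hm := quotient_strictAntiOn (k := k) hc hz' le_rfl
      fun x hx => hneg x (hz.1.trans_lt hx.1) hx.2.le
    have h1 := hm ⟨le_rfl, hz.2.le⟩ ⟨hz.2.le, le_rfl⟩ hz.2
    simp only [ext_sol_right, zero_div] at h1
    exact (div_pos_iff_of_pos_right (yEven_mul_pos hc hz')).1 h1
  have hwζ : ext (sol k) ζ < 0 := sol_neg_inner hc hk ⟨hζ0.le, le_rfl⟩
  have hwη := houter η ⟨le_rfl, hη2⟩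
  obtain ⟨r, hr, hwr⟩ := intermediate_value_Icc hη1.le (continuous_ext (sol k)).continuousOn
    ⟨hwζ.le, hwη.le⟩
  have hr1 : ζ < r := lt_of_le_of_ne hr.1 (by rintro h; rw [← h] at hwr; linarith)
  have hr2 : r < η := lt_of_le_of_ne hr.2 (by rintro h; rw [h] at hwr; linarith)
  refine ⟨r, ⟨hζ0.trans hr1, hr2.trans hη2⟩, fun z hz => ?_, fun z hz => ?_, ?_⟩
  · rcases le_or_gt z ζ with h | h
    · exact sol_neg_inner hc hk ⟨hz.1, h⟩
    · have hm := quotient_strictMonoOn (k := k) hc h (hr2.le.trans hη2.le)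
        fun x hx => hpos x (h.trans hx.1) (hx.2.trans hr2)
      have h1 := hm ⟨le_rfl, hz.2.le⟩ ⟨hz.2.le, le_rfl⟩ hz.2
      simp only [hwr, zero_div] at h1
      exact (div_neg_iff.1 h1).elim (fun h' => absurd h'.2 (yEven_mul_pos hc h).le.not_gt)
        fun h' => h'.1
  · rcases le_or_gt η z with h | h
    · exact houter z ⟨h, hz.2⟩
    · have hm := quotient_strictMonoOn (k := k) hc hr1 hz.2.le
        fun x hx => hpos x (hr1.trans hx.1) (hx.2.trans h)
      have h1 := hm ⟨le_rfl, hz.1.le⟩ ⟨hz.1.le, le_rfl⟩ hz.1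
      simp only [hwr, zero_div] at h1
      exact (div_pos_iff_of_pos_right (yEven_mul_pos hc (hr1.trans hz.1))).1 h1
  · have h1 := hpos r hr1 hr2
    have hC := Real.cosh_pos (c * r)
    rw [bracketEven, hwr, zero_mul, sub_zero, div_pos_iff_of_pos_right (by positivity),
      mul_pos_iff_of_pos_right (yEven_mul_pos hc hr1)] at h1
    exact h1

end Deflection

/-! ### Existence of the lower and upper thresholds -/

section Thresholds

variable {q : ℝ≥0∞} [Fact (1 ≤ q)] {c : ℝ} {k : CI} {w : W2D q}

theorem abs_mem_of_mem_Ioo {z r : ℝ} (hz : z ∈ Ioo (-r) r) : |z| ∈ Ico 0 r :=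
  ⟨abs_nonneg z, abs_lt.2 hz⟩

theorem rep_eq_sol_abs (hc : cCrit < c)
    (hk : ∀ z ∈ Icc (-1 : ℝ) 1, ext (linOp c k) z = -source c z) (hv : embVal q w = sol k)
    {z : ℝ} (hz : z ∈ Icc (-1 : ℝ) 1) : rep w z = ext (sol k) |z| := by
  rw [rep_eqOn w hz, hv]
  rcases abs_choice z with h | h
  · rw [h]
  · rw [h, (sol_even_of_source hc hk hz).1]

theorem slope_one_pos_iff (hc : cCrit < c) : 0 < bracketEven c k 1 ↔ 0 < ext (slope k) 1 := by
  have hC := Real.cosh_pos c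
  rw [bracketEven_one, div_pos_iff_of_pos_right (by positivity),
    mul_pos_iff_of_pos_right (yEven_pos hc)]

theorem slope_one_neg_of (hc : cCrit < c) (h : bracketEven c k 1 < 0) : ext (slope k) 1 < 0 := by
  have hC := Real.cosh_pos c
  rw [bracketEven_one, div_neg_iff] at h
  rcases h with h | h
  · exact absurd h.2 (by positivity : 0 < Real.cosh c ^ 2).le.not_gt
  · exact neg_of_mul_neg_left h.1 (yEven_pos hc).le

theorem deflectsInward_of_signIntegral_pos (hc : cCrit < c)
    (hk : ∀ z ∈ Icc (-1 : ℝ) 1, ext (linOp c k) z = -source c z) (hv : embVal q w = sol k)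
    (hs : embSlope q w = slope k) (hI : 0 < signIntegral c) : DeflectsInward w := by
  have hc0 : 0 < c := cCrit_pos.trans hc
  have hG : 0 < bracketEven c k 1 := by rw [bracketEven_one_eq hc hk]; positivity
  have h1 := (slope_one_pos_iff hc).1 hG
  refine ⟨fun z hz => ?_, ?_, ?_⟩
  · rw [rep_eq_sol_abs hc hk hv (Ioo_subset_Icc_self hz)]
    exact sol_neg_of_bracket_pos hc hk hG (abs_mem_of_mem_Ioo hz)
  · rw [pointD_eq w neg_one_mem_I, hs, (sol_even_of_source hc hk one_mem_I).2]
    linarith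
  · rw [pointD_eq w one_mem_I, hs]
    exact h1

theorem exists_deflectsMixed_of_signIntegral_neg (hc : cCrit < c)
    (hk : ∀ z ∈ Icc (-1 : ℝ) 1, ext (linOp c k) z = -source c z) (hv : embVal q w = sol k)
    (hs : embSlope q w = slope k) (hI : signIntegral c < 0) :
    ∃ r ∈ Ioo (0 : ℝ) 1, DeflectsMixed w r := by
  have hc0 : 0 < c := cCrit_pos.trans hc
  have hG : bracketEven c k 1 < 0 := by
    rw [bracketEven_one_eq hc hk]
    exact mul_neg_of_pos_of_neg (by positivity) hI
  have h1 := slope_one_neg_of hc hG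
  obtain ⟨r, hr, hin, hout, hsl⟩ := exists_sol_sign_change hc hk hG
  have hrI : r ∈ Icc (-1 : ℝ) 1 := ⟨by linarith [hr.1], hr.2.le⟩
  have hrI' : -r ∈ Icc (-1 : ℝ) 1 := ⟨by linarith [hr.2], by linarith [hr.1]⟩
  refine ⟨r, hr, fun z hz => ?_, fun z hz => ?_, ?_, ?_, ?_, ?_⟩
  · rw [rep_eq_sol_abs hc hk hv ⟨by linarith [hz.1, hr.2], by linarith [hz.2, hr.2]⟩]
    exact hin _ (abs_mem_of_mem_Ioo hz)
  · have hzI : z ∈ Icc (-1 : ℝ) 1 ∧ |z| ∈ Ioo r 1 := by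
      rcases hz with hz | hz
      · have h0 : z < 0 := by linarith [hz.2, hr.1]
        rw [abs_of_neg h0]
        exact ⟨⟨hz.1.le, by linarith⟩, by linarith [hz.2], by linarith [hz.1]⟩
      · have h0 : 0 < z := by linarith [hz.1, hr.1]
        rw [abs_of_pos h0]
        exact ⟨⟨by linarith, hz.2.le⟩, hz⟩
    rw [rep_eq_sol_abs hc hk hv hzI.1]
    exact hout _ hzI.2
  · rw [pointD_eq w neg_one_mem_I, hs, (sol_even_of_source hc hk one_mem_I).2]
    linarith
  · rw [pointD_eq w hrI', hs, (sol_even_of_source hc hk hrI).2]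
    linarith
  · rw [pointD_eq w hrI, hs]
    exact hsl
  · rw [pointD_eq w one_mem_I, hs]
    exact h1

theorem exists_thresholds :
    ∃ sLow sUp : ℝ, IsLowerThreshold sLow ∧ IsUpperThreshold sUp ∧ sLow ≤ sUp := by
  have hcp := cCrit_pos
  obtain ⟨ε, hε, hball⟩ := Metric.eventually_nhds_iff.1
    (continuous_signIntegral.continuousAt.eventually (lt_mem_nhds signIntegral_cCrit_pos))
  -- The cap 1 only ensures c₁ ≤ c₂; the value c₂ is the bound from `signIntegral_neg`.
  set c₁ := cCrit + min ε 1
  set c₂ := 4 + 32 * cCrit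
  have hm : 0 < min ε 1 := lt_min hε one_pos
  have h1 : cCrit < c₁ := by simp only [c₁]; linarith
  have h12 : c₁ ≤ c₂ := by
    have := min_le_right ε 1
    simp only [c₁, c₂]; linarith
  have h2 : cCrit < c₂ := h1.trans_le h12
  refine ⟨Real.cosh c₁ / c₁, Real.cosh c₂ / c₂, ⟨?_, ?_⟩, ⟨?_, ?_⟩, ?_⟩
  · exact (cosh_div_lt_iff le_rfl h1.le).2 h1
  · intro σ _ hσ q _ _ _ δ₀ u hu
    obtain ⟨c, k, hc, hσc, -, hk, hv, hs⟩ := hu.exists_dLam_eq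
    rw [hσc, cosh_div_lt_iff hc.le h1.le] at hσ
    refine deflectsInward_of_signIntegral_pos hc hk hv hs (hball ?_)
    rw [Real.dist_eq, abs_of_pos (by linarith)]
    have := min_le_left ε 1
    simp only [c₁] at hσ
    linarith
  · exact (cosh_div_lt_iff le_rfl h2.le).2 h2
  · intro σ hσ q _ _ _ δ₀ u hu
    obtain ⟨c, k, hc, hσc, -, hk, hv, hs⟩ := hu.exists_dLam_eq
    rw [hσc, cosh_div_lt_iff h2.le hc.le] at hσ
    exact exists_deflectsMixed_of_signIntegral_neg hc hk hv hs (signIntegral_neg hσ.le)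
  · exact strictMonoOn_cosh_div.monotoneOn h1.le h2.le h12

end Thresholds

/-! ### From infinitesimal to finite deflection -/

section FiniteDeflection

variable {q : ℝ≥0∞} [Fact (1 ≤ q)] {σ δ₀ : ℝ} {u : ℝ → W2D q}

/-- Analytic curves on a half-open interval are strictly differentiable at the end point. -/
theorem exists_norm_sub_sub_smul_le {E : Type*} [NormedAddCommGroup E] [NormedSpace ℝ E]
    [CompleteSpace E] {F : ℝ → E} (hδ : 0 < δ₀) (hF : AnalyticOn ℝ F (Ico 0 δ₀)) {ε : ℝ}
    (hε : 0 < ε) :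
    ∃ δ, 0 < δ ∧ δ ≤ δ₀ ∧ ∀ x y : ℝ, 0 ≤ x → x < y → y < δ →
      ‖F y - F x - (y - x) • derivWithin F (Ico 0 δ₀) 0‖ ≤ ε * (y - x) := by
  have hcd : ContDiffOn ℝ 1 F (Ico 0 δ₀) := hF.contDiffOn_of_completeSpace
  have hcont := hcd.continuousOn_derivWithin (uniqueDiffOn_Ico 0 δ₀) le_rfl
  have h0 : (0 : ℝ) ∈ Ico 0 δ₀ := ⟨le_rfl, hδ⟩
  set W := derivWithin F (Ico 0 δ₀) 0
  obtain ⟨δ, hδ1, hδ2⟩ := Metric.continuousWithinAt_iff.1 (hcont 0 h0) ε hε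
  refine ⟨min δ δ₀, lt_min hδ1 hδ, min_le_right _ _, fun x y hx hxy hy => ?_⟩
  have hsub : Ico 0 (min δ δ₀) ⊆ Ico 0 δ₀ := Ico_subset_Ico_right (min_le_right _ _)
  -- The mean value inequality is applied to F(t) - tW, whose derivative is small near 0 by
  -- continuity of F'.
  have hder : ∀ t ∈ Ico 0 (min δ δ₀), HasDerivWithinAt (fun t => F t - t • W)
      (derivWithin F (Ico 0 δ₀) t - W) (Ico 0 (min δ δ₀)) t := fun t ht => by
    have h1 := ((hcd.differentiableOn one_ne_zero t (hsub ht)).hasDerivWithinAt.mono hsub)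
    have h2 := (hasDerivWithinAt_id t (Ico 0 (min δ δ₀))).smul_const W
    rw [one_smul] at h2
    exact h1.sub h2
  have hb : ∀ t ∈ Ico 0 (min δ δ₀), ‖derivWithin F (Ico 0 δ₀) t - W‖ ≤ ε := fun t ht => by
    rw [← dist_eq_norm]
    refine (hδ2 (hsub ht) ?_).le
    rw [Real.dist_eq, sub_zero, abs_of_nonneg ht.1]
    exact ht.2.trans_le (min_le_left _ _)
  have := (convex_Ico 0 (min δ δ₀)).norm_image_sub_le_of_norm_hasDerivWithin_le hder hb
    ⟨hx, hxy.trans hy⟩ ⟨hx.trans hxy.le, hy⟩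
  rw [Real.norm_of_nonneg (sub_pos.2 hxy).le] at this
  convert this using 2
  rw [sub_smul]
  abel

/-- The embedding of `W²_{q,D}` into `C¹`, as pairs of a function and its derivative. -/
def emb (q : ℝ≥0∞) [Fact (1 ≤ q)] : W2D q →L[ℝ] CI × CI := (embVal q).prod (embSlope q)

/-- The difference quotients of a branch near `λ = 0` are `C¹`-close to its derivative. -/
theorem IsInnerBranch.exists_quotient_mem (h : IsInnerBranch σ δ₀ u) {N : Set (CI × CI)}
    (hN : N ∈ 𝓝 (emb q (dLam δ₀ u))) :
    ∃ δ, 0 < δ ∧ δ ≤ δ₀ ∧ ∀ x y : ℝ, 0 ≤ x → x < y → y < δ →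
      emb q ((y - x)⁻¹ • (u y - u x)) ∈ N := by
  obtain ⟨ε, hε, hball⟩ := Metric.mem_nhds_iff.1 hN
  have hF : AnalyticOn ℝ (fun l => emb q (u l)) (Ico 0 δ₀) := fun l hl =>
    ((emb q).analyticAt _).comp_analyticWithinAt (h.analytic l hl)
  -- Half of ε is used because the estimate is not strict and the target ball is open.
  obtain ⟨δ, h1, h2, h3⟩ := exists_norm_sub_sub_smul_le h.pos hF (half_pos hε)
  have hd : derivWithin (fun l => emb q (u l)) (Ico 0 δ₀) 0 = emb q (dLam δ₀ u) :=
    ((emb q).hasFDerivAt.comp_hasDerivWithinAt 0 h.hasDerivWithinAt).derivWithin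
      (uniqueDiffOn_Ico 0 δ₀ 0 ⟨le_rfl, h.pos⟩)
  refine ⟨δ, h1, h2, fun x y hx hxy hy => hball ?_⟩
  have h4 := h3 x y hx hxy hy
  have hxy' : 0 < y - x := sub_pos.2 hxy
  rw [hd] at h4
  rw [mem_ball_iff_norm]
  have h5 : emb q ((y - x)⁻¹ • (u y - u x)) - emb q (dLam δ₀ u)
      = (y - x)⁻¹ • (emb q (u y) - emb q (u x) - (y - x) • emb q (dLam δ₀ u)) := by
    rw [map_smul, map_sub, smul_sub _ _ ((y - x) • _), inv_smul_smul₀ hxy'.ne']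
  rw [h5, norm_smul, Real.norm_of_nonneg (inv_pos.2 hxy').le]
  calc (y - x)⁻¹ * _ ≤ (y - x)⁻¹ * (ε / 2 * (y - x)) := by gcongr
    _ = ε / 2 := by field_simp
    _ < ε := half_lt_self hε

/-- By compactness f has a positive minimum on the interval, which serves as the radius of a ball in
the supremum norm. -/
theorem eventually_forall_pos {f : CI} {a b : ℝ} (ha : -1 ≤ a) (hb : b ≤ 1)
    (hf : ∀ z ∈ Icc a b, 0 < ext f z) : ∀ᶠ g in 𝓝 f, ∀ z ∈ Icc a b, 0 < ext g z := by
  rcases (Icc a b).eq_empty_or_nonempty with he | hne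
  · simp [he]
  obtain ⟨x, hx, hmin⟩ := isCompact_Icc.exists_isMinOn hne (continuous_ext f).continuousOn
  filter_upwards [Metric.ball_mem_nhds f (hf x hx)] with g hg z hz
  have hzI : z ∈ Icc (-1 : ℝ) 1 := ⟨ha.trans hz.1, hz.2.trans hb⟩
  have h1 : |g ⟨z, hzI⟩ - f ⟨z, hzI⟩| < ext f x := by
    rw [mem_ball_iff_norm] at hg
    exact (ContinuousMap.norm_coe_le_norm (g - f) ⟨z, hzI⟩).trans_lt hg
  have h2 : ext f x ≤ ext f z := hmin hz
  rw [ext_apply f hzI] at h2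
  rw [ext_apply g hzI]
  linarith [(abs_lt.1 h1).1]

theorem eventually_forall_neg {f : CI} {a b : ℝ} (ha : -1 ≤ a) (hb : b ≤ 1)
    (hf : ∀ z ∈ Icc a b, ext f z < 0) : ∀ᶠ g in 𝓝 f, ∀ z ∈ Icc a b, ext g z < 0 := by
  have h := eventually_forall_pos (f := -f) ha hb fun z hz => neg_pos.2 (hf z hz)
  filter_upwards [continuous_neg.continuousAt.eventually h] with g hg z hz
  exact neg_pos.1 (hg z hz)

theorem exists_forall_Icc_pos {f : CI} {x : ℝ} (hx : 0 < ext f x) :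
    ∃ η > 0, ∀ z ∈ Icc (x - η) (x + η), 0 < ext f z := by
  obtain ⟨η, hη, h⟩ := Metric.eventually_nhds_iff.1
    ((continuous_ext f).continuousAt.eventually (lt_mem_nhds hx))
  refine ⟨η / 2, half_pos hη, fun z hz => h ?_⟩
  rw [Real.dist_eq, abs_lt]
  constructor <;> linarith [hz.1, hz.2]

theorem exists_forall_Icc_neg {f : CI} {x : ℝ} (hx : ext f x < 0) :
    ∃ η > 0, ∀ z ∈ Icc (x - η) (x + η), ext f z < 0 := by
  obtain ⟨η, hη, h⟩ := exists_forall_Icc_pos (f := -f) (x := x) (neg_pos.2 hx)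
  exact ⟨η, hη, fun z hz => neg_pos.1 (h z hz)⟩

theorem rep_left (w : W2D q) : rep w (-1) = 0 := by
  rw [rep_eqOn w neg_one_mem_I, ext_apply _ neg_one_mem_I]; exact embVal_leftEnd w

theorem rep_right (w : W2D q) : rep w 1 = 0 := by
  rw [rep_eqOn w one_mem_I, ext_apply _ one_mem_I]; exact embVal_rightEnd w

theorem rep_strictMonoOn (w : W2D q) {a b : ℝ} (ha : -1 ≤ a) (hb : b ≤ 1)
    (h : ∀ z ∈ Icc a b, 0 < ext (embSlope q w) z) : StrictMonoOn (rep w) (Icc a b) :=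
  strictMonoOn_of_hasDerivWithinAt_pos ha hb
    (fun _ hz => hasDerivWithinAt_rep w ⟨ha.trans hz.1, hz.2.trans hb⟩)
    fun z hz => h z (Ioo_subset_Icc_self hz)

theorem rep_strictAntiOn (w : W2D q) {a b : ℝ} (ha : -1 ≤ a) (hb : b ≤ 1)
    (h : ∀ z ∈ Icc a b, ext (embSlope q w) z < 0) : StrictAntiOn (rep w) (Icc a b) :=
  strictAntiOn_of_hasDerivWithinAt_neg ha hb
    (fun _ hz => hasDerivWithinAt_rep w ⟨ha.trans hz.1, hz.2.trans hb⟩)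
    fun z hz => h z (Ioo_subset_Icc_self hz)

/-- Negativity on `(-1,1)` with strict slopes at the end points is a `C¹`-open property. -/
theorem DeflectsInward.eventually {w : W2D q} (hw : DeflectsInward w) :
    ∀ᶠ p in 𝓝 (emb q w), ∀ h : W2D q, emb q h = p → ∀ z ∈ Ioo (-1 : ℝ) 1, rep h z < 0 := by
  obtain ⟨h1, h2, h3⟩ := hw
  rw [pointD_eq w neg_one_mem_I] at h2
  rw [pointD_eq w one_mem_I] at h3
  obtain ⟨η₁, hη₁, hl⟩ := exists_forall_Icc_neg h2
  obtain ⟨η₂, hη₂, hr⟩ := exists_forall_Icc_pos h3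
  -- Near ±1 the values tend to 0 and carry no margin, so there the sign comes from the zero
  -- boundary value and the strict slope; only [a,b] is handled through the values themselves.
  set a := -1 + min η₁ 1
  set b := 1 - min η₂ 1
  have hm1 : 0 < min η₁ 1 := lt_min hη₁ one_pos
  have hm2 : 0 < min η₂ 1 := lt_min hη₂ one_pos
  have hm1' := min_le_left η₁ 1
  have hm2' := min_le_left η₂ 1
  have ha0 : -1 < a := by simp only [a]; linarith
  have ha1 : a ≤ 1 := by simp only [a]; linarith [min_le_right η₁ 1]
  have hb0 : -1 ≤ b := by simp only [b]; linarith [min_le_right η₂ 1]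
  have hb1 : b < 1 := by simp only [b]; linarith
  have e1 := eventually_forall_neg (f := embSlope q w) (a := -1) (b := a) le_rfl ha1
    fun z hz => hl z ⟨by linarith [hz.1], by linarith [hz.2]⟩
  have e2 := eventually_forall_pos (f := embSlope q w) (a := b) (b := 1) hb0 le_rfl
    fun z hz => hr z ⟨by linarith [hz.1], by linarith [hz.2]⟩
  have e3 := eventually_forall_neg (f := embVal q w) (a := a) (b := b) ha0.le hb1.le
    fun z hz => by
      rw [← rep_eqOn w ⟨ha0.le.trans hz.1, hz.2.trans hb1.le⟩]
      exact h1 z ⟨ha0.trans_le hz.1, hz.2.trans_lt hb1⟩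
  filter_upwards [(continuous_snd.tendsto (emb q w)).eventually e1,
    (continuous_snd.tendsto (emb q w)).eventually e2,
    (continuous_fst.tendsto (emb q w)).eventually e3] with p p1 p2 p3 h hp z hz
  subst hp
  rcases le_or_gt z a with hza | hza
  · rw [← rep_left h]
    exact rep_strictAntiOn h le_rfl ha1 p1 ⟨le_rfl, ha0.le⟩ ⟨hz.1.le, hza⟩ hz.1
  rcases le_or_gt b z with hzb | hzb
  · rw [← rep_right h]
    exact rep_strictMonoOn h hb0 le_rfl p2 ⟨hzb, hz.2.le⟩ ⟨hb1.le, le_rfl⟩ hz.2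
  · rw [rep_eqOn h (Ioo_subset_Icc_self hz)]
    exact p3 z ⟨hza.le, hzb.le⟩

/-- The sign pattern of functions `C¹`-close to a mixed deflection. -/
def HasMixedPattern (h : W2D q) (r d : ℝ) : Prop :=
  (∀ z ∈ Icc (-r + d) (r - d), rep h z < 0) ∧
  (∀ z ∈ Ioc (-1) (-r - d) ∪ Ico (r + d) 1, 0 < rep h z) ∧
  StrictAntiOn (rep h) (Icc (-r - d) (-r + d)) ∧ StrictMonoOn (rep h) (Icc (r - d) (r + d))

/-- Slopes control collars at ±1 and the transition zones around ±r; values control the compact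
pieces in between. The bound η depends only on the slopes near ±r, so d may be any smaller number
that keeps the zones inside (-1,1) and away from 0. -/
theorem DeflectsMixed.eventually {w : W2D q} {r : ℝ} (hr : r ∈ Ioo (0 : ℝ) 1)
    (hw : DeflectsMixed w r) :
    ∃ η > 0, ∀ d, 0 < d → d < η → d < r → d < 1 - r →
      ∀ᶠ p in 𝓝 (emb q w), ∀ h : W2D q, emb q h = p → HasMixedPattern h r d := by
  obtain ⟨hr0, hr1⟩ := hr
  obtain ⟨h1, h2, s1, s2, s3, s4⟩ := hw
  rw [pointD_eq w neg_one_mem_I] at s1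
  rw [pointD_eq w ⟨by linarith, by linarith⟩] at s2 s3
  rw [pointD_eq w one_mem_I] at s4
  obtain ⟨η₁, hη₁, t1⟩ := exists_forall_Icc_pos s1
  obtain ⟨η₂, hη₂, t2⟩ := exists_forall_Icc_neg s2
  obtain ⟨η₃, hη₃, t3⟩ := exists_forall_Icc_pos s3
  obtain ⟨η₄, hη₄, t4⟩ := exists_forall_Icc_neg s4
  refine ⟨min η₂ η₃, lt_min hη₂ hη₃, fun d hd0 hdη hdr hdr' => ?_⟩
  have hd2 : d < η₂ := hdη.trans_le (min_le_left _ _)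
  have hd3 : d < η₃ := hdη.trans_le (min_le_right _ _)
  -- The cap 1 - r keeps the end collars outside (-r, r). The pieces [a, -r - d] and [r + d, b] may
  -- be empty, which is harmless.
  set a := -1 + min η₁ (1 - r)
  set b := 1 - min η₄ (1 - r)
  have hm1 : 0 < min η₁ (1 - r) := lt_min hη₁ (by linarith)
  have hm4 : 0 < min η₄ (1 - r) := lt_min hη₄ (by linarith)
  have ha0 : -1 < a := by simp only [a]; linarith
  have ha1 : a ≤ -r := by simp only [a]; linarith [min_le_right η₁ (1 - r)]
  have haη : a ≤ -1 + η₁ := by simp only [a]; linarith [min_le_left η₁ (1 - r)]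
  have hb0 : r ≤ b := by simp only [b]; linarith [min_le_right η₄ (1 - r)]
  have hb1 : b < 1 := by simp only [b]; linarith
  have hbη : 1 - η₄ ≤ b := by simp only [b]; linarith [min_le_left η₄ (1 - r)]
  have hrep : ∀ z ∈ Icc (-1 : ℝ) 1, ext (embVal q w) z = rep w z := fun z hz =>
    (rep_eqOn w hz).symm
  have e1 := eventually_forall_pos (f := embSlope q w) (a := -1) (b := a) le_rfl
    (by linarith) fun z hz => t1 z ⟨by linarith [hz.1], by linarith [hz.2]⟩
  have e2 := eventually_forall_neg (f := embSlope q w) (a := -r - d) (b := -r + d)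
    (by linarith) (by linarith) fun z hz => t2 z ⟨by linarith [hz.1], by linarith [hz.2]⟩
  have e3 := eventually_forall_pos (f := embSlope q w) (a := r - d) (b := r + d)
    (by linarith) (by linarith) fun z hz => t3 z ⟨by linarith [hz.1], by linarith [hz.2]⟩
  have e4 := eventually_forall_neg (f := embSlope q w) (a := b) (b := 1) (by linarith)
    le_rfl fun z hz => t4 z ⟨by linarith [hz.1], by linarith [hz.2]⟩
  have e5 := eventually_forall_neg (f := embVal q w) (a := -r + d) (b := r - d)
    (by linarith) (by linarith) fun z hz => by
      rw [hrep z ⟨by linarith [hz.1], by linarith [hz.2]⟩]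
      exact h1 z ⟨by linarith [hz.1], by linarith [hz.2]⟩
  have e6 := eventually_forall_pos (f := embVal q w) (a := a) (b := -r - d)
    (by linarith) (by linarith) fun z hz => by
      rw [hrep z ⟨by linarith [hz.1], by linarith [hz.2]⟩]
      exact h2 z (Or.inl ⟨by linarith [hz.1], by linarith [hz.2]⟩)
  have e7 := eventually_forall_pos (f := embVal q w) (a := r + d) (b := b)
    (by linarith) (by linarith) fun z hz => by
      rw [hrep z ⟨by linarith [hz.1], by linarith [hz.2]⟩]
      exact h2 z (Or.inr ⟨by linarith [hz.1], by linarith [hz.2]⟩)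
  have hS := continuous_snd.tendsto (emb q w)
  have hV := continuous_fst.tendsto (emb q w)
  filter_upwards [hS.eventually e1, hS.eventually e2, hS.eventually e3, hS.eventually e4,
    hV.eventually e5, hV.eventually e6, hV.eventually e7] with p p1 p2 p3 p4 p5 p6 p7 h hp
  subst hp
  refine ⟨fun z hz => ?_, fun z hz => ?_, rep_strictAntiOn h (by linarith) (by linarith) p2,
    rep_strictMonoOn h (by linarith) (by linarith) p3⟩
  · rw [rep_eqOn h ⟨by linarith [hz.1], by linarith [hz.2]⟩]
    exact p5 z hz
  · rcases hz with hz | hz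
    · rcases le_or_gt z a with hza | hza
      · rw [← rep_left h]
        exact rep_strictMonoOn h le_rfl (by linarith) p1 ⟨le_rfl, ha0.le⟩ ⟨hz.1.le, hza⟩ hz.1
      · rw [rep_eqOn h ⟨hz.1.le, by linarith [hz.2]⟩]
        exact p6 z ⟨hza.le, hz.2⟩
    · rcases le_or_gt b z with hzb | hzb
      · rw [← rep_right h]
        exact rep_strictAntiOn h (by linarith) le_rfl p4 ⟨hzb, hz.2.le⟩ ⟨hb1.le, le_rfl⟩ hz.2
      · rw [rep_eqOn h ⟨by linarith [hz.1], hz.2.le⟩]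
        exact p7 z ⟨hz.1, hzb.le⟩

/-- A function with the mixed sign pattern has exactly two zeros. -/
theorem HasMixedPattern.exists_zeros {h : W2D q} {r d : ℝ} (hd0 : 0 < d) (hdr : d < r)
    (hdr' : d < 1 - r) (hp : HasMixedPattern h r d) :
    ∃ z₁ ∈ Ioo (-r - d) (-r + d), ∃ z₂ ∈ Ioo (r - d) (r + d),
      {z ∈ Ioo (-1 : ℝ) 1 | rep h z = 0} = {z₁, z₂} := by
  obtain ⟨h1, h2, h3, h4⟩ := hp
  have hcont : ContinuousOn (rep h) (Icc (-1) 1) :=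
    (continuous_ext _).continuousOn.congr (rep_eqOn h)
  obtain ⟨z₁, hz₁, e₁⟩ := intermediate_value_Ioo' (by linarith : -r - d ≤ -r + d)
    (hcont.mono (Icc_subset_Icc (by linarith) (by linarith)))
    (show (0 : ℝ) ∈ _ from ⟨h1 _ ⟨le_rfl, by linarith⟩, h2 _ (Or.inl ⟨by linarith, le_rfl⟩)⟩)
  obtain ⟨z₂, hz₂, e₂⟩ := intermediate_value_Ioo (by linarith : r - d ≤ r + d)
    (hcont.mono (Icc_subset_Icc (by linarith) (by linarith)))
    (show (0 : ℝ) ∈ _ from ⟨h1 _ ⟨by linarith, le_rfl⟩, h2 _ (Or.inr ⟨le_rfl, by linarith⟩)⟩)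
  refine ⟨z₁, hz₁, z₂, hz₂, Subset.antisymm ?_ ?_⟩
  -- Outside the transition zones the sign is strict; inside each zone strict monotonicity leaves
  -- only the zero already found.
  · rintro z ⟨hz, hz0⟩
    rcases le_or_gt z (-r - d) with ha | ha
    · exact absurd hz0 (h2 z (Or.inl ⟨hz.1, ha⟩)).ne'
    rcases le_or_gt z (-r + d) with hb | hb
    · exact Or.inl (h3.injOn ⟨ha.le, hb⟩ (Ioo_subset_Icc_self hz₁) (hz0.trans e₁.symm))
    rcases le_or_gt z (r - d) with hc | hc
    · exact absurd hz0 (h1 z ⟨hb.le, hc⟩).ne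
    rcases le_or_gt (r + d) z with hd | hd
    · exact absurd hz0 (h2 z (Or.inr ⟨hd, hz.2⟩)).ne'
    · exact Or.inr (h4.injOn ⟨hc.le, hd.le⟩ (Ioo_subset_Icc_self hz₂) (hz0.trans e₂.symm))
  · rintro z (rfl | rfl)
    · exact ⟨⟨by linarith [hz₁.1], by linarith [hz₁.2]⟩, e₁⟩
    · exact ⟨⟨by linarith [hz₂.1], by linarith [hz₂.2]⟩, e₂⟩

theorem rep_quotient {x y z : ℝ} (hz : z ∈ Icc (-1 : ℝ) 1) :
    rep ((y - x)⁻¹ • (u y - u x)) z = (y - x)⁻¹ * (rep (u y) z - rep (u x) z) := by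
  rw [rep_eqOn _ hz, rep_eqOn _ hz, rep_eqOn _ hz, map_smul, map_sub]
  rfl

theorem IsInnerBranch.inward (h : IsInnerBranch σ δ₀ u) (hw : DeflectsInward (dLam δ₀ u)) :
    ∃ δ : ℝ, 0 < δ ∧ δ ≤ δ₀ ∧ ∀ x y : ℝ, 0 ≤ x → x < y → y < δ →
      ∀ z ∈ Ioo (-1 : ℝ) 1, rep (u x) z > rep (u y) z := by
  obtain ⟨δ, h1, h2, h3⟩ := h.exists_quotient_mem hw.eventually
  refine ⟨δ, h1, h2, fun x y hx hxy hy z hz => ?_⟩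
  have h4 := h3 x y hx hxy hy _ rfl z hz
  rw [rep_quotient (Ioo_subset_Icc_self hz)] at h4
  have := neg_of_mul_neg_right h4 (inv_pos.2 (sub_pos.2 hxy)).le
  linarith

/-- Near `λ = 0`, the solutions of a branch inherit the monotonicity of the catenoid. -/
theorem IsInnerBranch.exists_strictMono (h : IsInnerBranch σ δ₀ u) {r d : ℝ} (hdr : d < r)
    (hdr' : d < 1 - r) :
    ∃ δ : ℝ, 0 < δ ∧ ∀ l : ℝ, 0 ≤ l → l < δ → l < δ₀ →
      StrictAntiOn (rep (u l)) (Icc (-r - d) (-r + d)) ∧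
      StrictMonoOn (rep (u l)) (Icc (r - d) (r + d)) := by
  obtain ⟨c, hc, -, hcat⟩ := h.init
  have hc0 : 0 < c := cCrit_pos.trans hc
  have hcp := Real.cosh_pos c
  have hs0 := (embVal_embSlope_of_eqOn_catenoid hcat).2
  have hsl : ∀ z ∈ Icc (-1 : ℝ) 1,
      ext (embSlope q (u 0)) z = c * Real.sinh (c * z) / Real.cosh c := fun z hz => by
    rw [hs0, ext_apply _ hz, catSlope_apply]
  -- As d < r, the zones around ±r avoid 0, the only point where the slope of the catenoid vanishes.
  have e1 := eventually_forall_neg (f := embSlope q (u 0)) (a := -r - d) (b := -r + d)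
    (by linarith) (by linarith) fun z hz => by
      rw [hsl z ⟨by linarith [hz.1], by linarith [hz.1, hz.2]⟩]
      have : Real.sinh (c * z) < 0 :=
        Real.sinh_neg_iff.2 (mul_neg_of_pos_of_neg hc0 (by linarith [hz.2]))
      exact div_neg_of_neg_of_pos (mul_neg_of_pos_of_neg hc0 this) hcp
  have e2 := eventually_forall_pos (f := embSlope q (u 0)) (a := r - d) (b := r + d)
    (by linarith) (by linarith) fun z hz => by
      rw [hsl z ⟨by linarith [hz.1, hz.2], by linarith [hz.2]⟩]
      have : 0 < Real.sinh (c * z) := Real.sinh_pos_iff.2 (mul_pos hc0 (by linarith [hz.1]))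
      positivity
  have hcont : ContinuousWithinAt (fun l => embSlope q (u l)) (Ico 0 δ₀) 0 :=
    (embSlope q).continuous.continuousAt.comp_continuousWithinAt h.hasDerivWithinAt.continuousWithinAt
  obtain ⟨δ, hδ, hδ'⟩ := Metric.eventually_nhds_iff.1
    (eventually_nhdsWithin_iff.1 (hcont.eventually (e1.and e2)))
  refine ⟨δ, hδ, fun l hl hlδ hl0 => ?_⟩
  obtain ⟨p1, p2⟩ := hδ' (by rwa [Real.dist_eq, sub_zero, abs_of_nonneg hl]) ⟨hl, hl0⟩
  exact ⟨rep_strictAntiOn _ (by linarith) (by linarith) p1,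
    rep_strictMonoOn _ (by linarith) (by linarith) p2⟩

/-- For λ̄ < λ, the difference quotient has the same zeros and signs as u^λ - u^λ̄, so the mixed
pattern and its two zeros carry over. Monotonicity of each u^λ comes separately from the catenoid.
-/
theorem IsInnerBranch.mixed (h : IsInnerBranch σ δ₀ u) {r : ℝ} (hr : r ∈ Ioo (0 : ℝ) 1)
    (hw : DeflectsMixed (dLam δ₀ u) r) :
    ∃ (δ r₀ : ℝ) (n : ℕ), 0 < δ ∧ δ ≤ δ₀ ∧ r₀ ∈ Ioo (0 : ℝ) 1 ∧
      0 < n ∧ 2 / (n : ℝ) < min r₀ (1 - r₀) ∧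
      (∀ x y : ℝ, 0 ≤ x → x < y → y < δ →
        (∀ z ∈ Icc (-r₀ + 1 / (n : ℝ)) (r₀ - 1 / (n : ℝ)), rep (u x) z > rep (u y) z) ∧
        (∀ z ∈ Ioc (-1 : ℝ) (-r₀ - 1 / (n : ℝ)) ∪ Ico (r₀ + 1 / (n : ℝ)) 1,
          rep (u x) z < rep (u y) z) ∧
        ∃ z₁ ∈ Ioo (-r₀ - 1 / (n : ℝ)) (-r₀ + 1 / (n : ℝ)),
        ∃ z₂ ∈ Ioo (r₀ - 1 / (n : ℝ)) (r₀ + 1 / (n : ℝ)),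
          {z ∈ Ioo (-1 : ℝ) 1 | rep (u y) z = rep (u x) z} = {z₁, z₂}) ∧
      (∀ l : ℝ, 0 ≤ l → l < δ →
        StrictAntiOn (rep (u l)) (Icc (-r₀ - 1 / (n : ℝ)) (-r₀ + 1 / (n : ℝ))) ∧
        StrictMonoOn (rep (u l)) (Icc (r₀ - 1 / (n : ℝ)) (r₀ + 1 / (n : ℝ)))) := by
  obtain ⟨η, hη, hev⟩ := hw.eventually hr
  have hm : 0 < min r (1 - r) := lt_min hr.1 (by linarith [hr.2])
  -- Half of min(r, 1 - r) is what 2/n < min(r₀, 1 - r₀) demands; n is m + 1 because the Archimedean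
  -- bound is for 1/(m + 1).
  obtain ⟨m, hm'⟩ := exists_nat_one_div_lt (lt_min hη (half_pos hm))
  set n := m + 1
  have hnpos : (0 : ℝ) < (n : ℝ) := by positivity
  have hn : 1 / (n : ℝ) < min η (min r (1 - r) / 2) := by simpa [n] using hm'
  set d := 1 / (n : ℝ) with hd
  have hd0 : 0 < d := by positivity
  have hdη : d < η := hn.trans_le (min_le_left _ _)
  have hd2 : 2 * d < min r (1 - r) := by linarith [hn.trans_le (min_le_right _ _)]
  have hdr : d < r := by linarith [min_le_left r (1 - r)]
  have hdr' : d < 1 - r := by linarith [min_le_right r (1 - r)]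
  obtain ⟨δ₁, h1, h2, h3⟩ := h.exists_quotient_mem (hev d hd0 hdη hdr hdr')
  obtain ⟨δ₂, h4, h5⟩ := h.exists_strictMono hdr hdr'
  refine ⟨min δ₁ δ₂, r, n, lt_min h1 h4, (min_le_left _ _).trans h2, hr, Nat.succ_pos m, ?_,
    fun x y hx hxy hy => ?_, fun l hl hlδ => h5 l hl (hlδ.trans_le (min_le_right _ _))
      ((hlδ.trans_le (min_le_left _ _)).trans_le h2)⟩
  · rw [show 2 / (n : ℝ) = 2 * d by rw [hd]; ring]
    exact hd2
  · have hp := h3 x y hx hxy (hy.trans_le (min_le_left _ _)) _ rfl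
    have hi : 0 < (y - x)⁻¹ := inv_pos.2 (sub_pos.2 hxy)
    obtain ⟨z₁, hz₁, z₂, hz₂, hset⟩ := hp.exists_zeros hd0 hdr hdr'
    refine ⟨fun z hz => ?_, fun z hz => ?_, z₁, hz₁, z₂, hz₂, ?_⟩
    · have h6 := hp.1 z hz
      rw [rep_quotient ⟨by linarith [hz.1], by linarith [hz.2]⟩] at h6
      have := neg_of_mul_neg_right h6 hi.le
      linarith
    · have h6 := hp.2.1 z hz
      rw [rep_quotient (by
        rcases hz with hz | hz
        · exact ⟨hz.1.le, by linarith [hz.2]⟩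
        · exact ⟨by linarith [hz.1], hz.2.le⟩)] at h6
      have := (mul_pos_iff_of_pos_left hi).1 h6
      linarith
    · rw [← hset]
      ext z
      refine and_congr_right fun hz => ?_
      rw [rep_quotient (Ioo_subset_Icc_self hz), mul_eq_zero, or_iff_right hi.ne', sub_eq_zero]

end FiniteDeflection

end SoapFilm

end

/-! ### The main theorem -/

theorem theorem5p2 :
    -- the curves `[λ ↦ u^λ_in]` exist
    (∀ (q : ℝ≥0∞) [Fact (1 ≤ q)], 2 < q → q < ⊤ → ∀ σ : ℝ, SoapFilm.sigmaCrit < σ →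
      ∃ (δ₀ : ℝ) (u : ℝ → SoapFilm.W2D q), SoapFilm.IsInnerBranch σ δ₀ u) ∧
    -- thresholds `σ_* ≤ σ^*` exist
    (∃ sLow sUp : ℝ, SoapFilm.IsLowerThreshold sLow ∧ SoapFilm.IsUpperThreshold sUp ∧
      sLow ≤ sUp) ∧
    -- finite deflection, for any such thresholds and any such curve
    (∀ sLow sUp : ℝ, SoapFilm.IsLowerThreshold sLow → SoapFilm.IsUpperThreshold sUp →
      ∀ (q : ℝ≥0∞) [Fact (1 ≤ q)], 2 < q → q < ⊤ → ∀ σ : ℝ, SoapFilm.sigmaCrit < σ →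
      ∀ (δ₀ : ℝ) (u : ℝ → SoapFilm.W2D q), SoapFilm.IsInnerBranch σ δ₀ u →
        (σ < sLow →
          ∃ δ : ℝ, 0 < δ ∧ δ ≤ δ₀ ∧
            ∀ lam' lam : ℝ, 0 ≤ lam' → lam' < lam → lam < δ →
              ∀ z ∈ Ioo (-1 : ℝ) 1, SoapFilm.rep (u lam') z > SoapFilm.rep (u lam) z) ∧
        (sUp < σ →
          ∃ (δ r₀ : ℝ) (n : ℕ), 0 < δ ∧ δ ≤ δ₀ ∧ r₀ ∈ Ioo (0 : ℝ) 1 ∧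
            0 < n ∧ 2 / (n : ℝ) < min r₀ (1 - r₀) ∧
            (∀ lam' lam : ℝ, 0 ≤ lam' → lam' < lam → lam < δ →
              (∀ z ∈ Icc (-r₀ + 1 / (n : ℝ)) (r₀ - 1 / (n : ℝ)),
                SoapFilm.rep (u lam') z > SoapFilm.rep (u lam) z) ∧
              (∀ z ∈ Ioc (-1 : ℝ) (-r₀ - 1 / (n : ℝ)) ∪ Ico (r₀ + 1 / (n : ℝ)) 1,
                SoapFilm.rep (u lam') z < SoapFilm.rep (u lam) z) ∧
              ∃ z₁ ∈ Ioo (-r₀ - 1 / (n : ℝ)) (-r₀ + 1 / (n : ℝ)),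
              ∃ z₂ ∈ Ioo (r₀ - 1 / (n : ℝ)) (r₀ + 1 / (n : ℝ)),
                {z ∈ Ioo (-1 : ℝ) 1 | SoapFilm.rep (u lam) z = SoapFilm.rep (u lam') z}
                  = {z₁, z₂}) ∧
            (∀ lam : ℝ, 0 ≤ lam → lam < δ →
              StrictAntiOn (SoapFilm.rep (u lam))
                (Icc (-r₀ - 1 / (n : ℝ)) (-r₀ + 1 / (n : ℝ))) ∧
              StrictMonoOn (SoapFilm.rep (u lam))
                (Icc (r₀ - 1 / (n : ℝ)) (r₀ + 1 / (n : ℝ)))))) := by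
  refine ⟨fun q _ _ _ σ hσ => SoapFilm.exists_isInnerBranch q hσ, SoapFilm.exists_thresholds, ?_⟩
  intro sLow sUp hLow hUp q _ hq2 hq σ hσ δ₀ u hu
  refine ⟨fun h => hu.inward (hLow.2 σ hσ h q hq2 hq δ₀ u hu), fun h => ?_⟩
  obtain ⟨r, hr, hw⟩ := hUp.2 σ h q hq2 hq δ₀ u hu
  exact hu.mixed hr hw
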